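/- Let $n\ge 1$ and write $\mathbf 1=(1,\dots,1)$. For $1\le i\le j\le n$ let $\Delta_{[i,j]}=\mathrm{conv}(e_i,e_{i+1},\dots,e_j)\subset\mathbb R^n$, let $\mathbf P=(\Delta_{[i,j]})_{1\le i\le j\le n}$ and $P=\sum_{i\le j}\Delta_{[i,j]}$ (Minkowski sum). For a polytope $Q$ put $h_Q(v)=-\min_{y\in Q}\langle v,y\rangle$, and for variables $\mathbf x=(x_{ij})_{1\le i\le j\le n}$ put $h_{\mathbf x\mathbf P}(v)=\sum_{i\le j}x_{ij}\,h_{\Delta_{[i,j]}}(v)$, the support function of the associahedron (in its Loday realization) $\mathbf x\mathbf P=\sum_{i\le j}x_{ij}\Delta_{[i,j]}$. Let $\mathrm{Cone}(P)^*=\{v:\langle v,y\rangle\ge 0\ \text{for all}\ y\in P\}$. The hyperplane dual mixed volume of $\mathbf P$ (at $\mathbf z=0$) is the rational function $$\tilde m_{\mathbf P}(\mathbf x)=\sum_{F=\mathrm{span}_{\ge0}(v_{1},\dots,v_{n-1})\in\mathcal T}\frac{|\det(v_{1},\dots,v_{n-1},\mathbf 1)|}{h_{\mathbf x\mathbf P}(v_{1})\cdots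 h_{\mathbf x\mathbf P}(v_{n-1})},$$ where $\mathcal T$ is a triangulation of the boundary of $\mathrm{Cone}(P)^*$ into $(n-1)$-dimensional simplicial cones, with one generator chosen on each ray that occurs. Such triangulations exist, and for each of them, and each choice of generators, the following holds. (1) No denominator of $\tilde m_{\mathbf P}(\mathbf x)$ vanishes identically on the hyperplane $\langle\mathbf x,\mathbf 1\rangle=\sum_{i\le j}x_{ij}=0$, and there, as rational functions, $$\tilde m_{\mathbf P}(\mathbf x)|_{\langle\mathbf x,\mathbf 1\rangle=0}=(-1)^{n-1}\sum_{B\in\mathcal{PB}(n)}\ \prod_{e\in B}\frac1{\sum_{i\le j,\ i,j\in L_{B,e}}x_{ij}}.$$ Here $\mathcal{PB}(n)$ is the set of plane binary trees with $n$ nodes (every node has at most one left child and at most one right child), the nodes are labelled by $1,\dots,n$ so that at every node labelled $i$ the labels in its left branch are smaller than $i$ and those in its right branch are larger than $i$, the product is over the edges $e$ of $B$, and $L_{B,e}\subseteq\{1,\dots,n\}$ is the set of labels in the component of $B\setminus e$ that does not contain the root. (2) Let $\mathcal{PC}(N)$ be the set of planar cubic trees with $N$ leaves: trees drawn in a disk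 (up to isotopy), with $N$ boundary vertices of degree $1$, labelled $1,\dots,N$ in counterclockwise order, and $N-2$ interior vertices of degree $3$. The tree-level planar $\phi^3$-amplitude of $N$ particles is $$\mathcal A_N^{\phi^3}(s)=\sum_{T\in\mathcal{PC}(N)}\ \prod_{e}\frac1{X_e},\qquad X_e=\sum_{i<j,\ i,j\in L_{T,e}}s_{ij},$$ where $e$ runs over the interior edges of $T$ (those joining two interior vertices), $L_{T,e}$ is the set of leaves in the component of $T\setminus e$ that does not contain the leaf $N$, and the Mandelstam variables $s_{ij}$ ($1\le i,j\le N$) satisfy $s_{ii}=0$, $s_{ij}=s_{ji}$ and $\sum_j s_{ij}=0$ for all $i$. For $N=n+2$, the substitution $x_{ij}\mapsto s_{i,j+1}$ ($1\le i\le j\le n$) takes values in the hyperplane $\langle\mathbf x,\mathbf 1\rangle=0$, no denominator of $\tilde m_{\mathbf P}$ vanishes identically under it, and, as rational functions on the space of Mandelstam variables, $$\tilde m_{\mathbf P}(\mathbf x)\big|_{x_{ij}=s_{i,j+1}}=(-1)^{n-1}\,\mathcal A^{\phi^3}_{n+2}(s).$$ -/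

import Mathlib

open scoped NNReal Pointwise

noncomputable section

/-! ### Hyperplane dual mixed volumes -/

/-- The support function `h_S(v) = - min_{y ∈ S} ⟨v, y⟩` of a (compact, nonempty) set `S ⊆ ℝ^d`. -/
def supportFn {d : ℕ} (S : Set (Fin d → ℝ)) (v : Fin d → ℝ) : ℝ :=
  -sInf ((fun y => dotProduct v y) '' S)

/-- The support function `h_{xP - z}(v) = ∑ i, x i * h_{P i}(v) + ⟨v, z⟩` of the (virtual)
Minkowski combination `∑ i, x i • P i - z`, for coefficients `x`, `z` in an extension field `K`
of `ℝ` (so that `x` and `z` may be real numbers or indeterminates). -/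
def mixedSupport {K : Type*} [Field K] [Algebra ℝ K] {d : ℕ} {ι : Type*} [Fintype ι]
    (P : ι → Set (Fin d → ℝ)) (x : ι → K) (z : Fin d → K) (v : Fin d → ℝ) : K :=
  ∑ i, x i * algebraMap ℝ K (supportFn (P i) v) + ∑ k, algebraMap ℝ K (v k) * z k

/-- The cone `{t • y | y ∈ P, t ≥ 0}` over `P`. -/
def coneOver {d : ℕ} (P : Set (Fin d → ℝ)) : Set (Fin d → ℝ) :=
  {w | ∃ y ∈ P, ∃ t : ℝ, 0 ≤ t ∧ w = t • y}

/-- The dual cone `C^* = {v | ⟨v, y⟩ ≥ 0 for all y ∈ C}`. -/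
def dualCone {d : ℕ} (C : Set (Fin d → ℝ)) : Set (Fin d → ℝ) :=
  {v | ∀ y ∈ C, 0 ≤ dotProduct v y}

/-- The set of nonnegative linear combinations of vectors in `S`. -/
def posSpan {d : ℕ} (S : Set (Fin d → ℝ)) : Set (Fin d → ℝ) :=
  (Submodule.span ℝ≥0 S : Set (Fin d → ℝ))

/-- `T` is a triangulation of `S ⊆ ℝ^d` into `r`-dimensional simplicial cones. Every cone is given
by the tuple of its generators; one generator has been picked for every ray that occurs, and every
cone is listed once. -/
structure IsConeTriangulation {d r : ℕ} (S : Set (Fin d → ℝ))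
    (T : Finset (Fin r → Fin d → ℝ)) : Prop where
  linearIndependent : ∀ F ∈ T, LinearIndependent ℝ F
  union_eq : ⋃ F ∈ T, posSpan (Set.range F) = S
  inter_eq : ∀ F ∈ T, ∀ G ∈ T,
    posSpan (Set.range F) ∩ posSpan (Set.range G) = posSpan (Set.range F ∩ Set.range G)
  listed_once : ∀ F ∈ T, ∀ G ∈ T, Set.range F = Set.range G → F = G

/-- `T` is a triangulation of the boundary of `Cone(P)^*`, where `P = ∑ i, P i` is the Minkowski
sum. -/
def IsBoundaryTriangulation {d : ℕ} {ι : Type*} [Fintype ι] (P : ι → Set (Fin d → ℝ))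
    (T : Finset (Fin (d - 1) → Fin d → ℝ)) : Prop :=
  IsConeTriangulation (frontier (dualCone (coneOver (∑ i, P i)))) T

/-- The matrix with rows `F 0, …, F (d - 2), (1, …, 1)`. -/
def bordered {d : ℕ} (F : Fin (d - 1) → Fin d → ℝ) : Matrix (Fin d) (Fin d) ℝ :=
  Matrix.of fun i => if h : (i : ℕ) < d - 1 then F ⟨i, h⟩ else fun _ => 1

/-- The hyperplane dual mixed volume function, computed with the triangulation `T` of the boundary
of `Cone(P)^*`:
`∑_{F ∈ T} |det(v_1, …, v_{d-1}, 1)| / (h_{xP - z}(v_1) ⋯ h_{xP - z}(v_{d-1}))`. -/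
def hyperplaneDualMixedVolume {K : Type*} [Field K] [Algebra ℝ K] {d : ℕ} {ι : Type*} [Fintype ι]
    (P : ι → Set (Fin d → ℝ)) (T : Finset (Fin (d - 1) → Fin d → ℝ))
    (x : ι → K) (z : Fin d → K) : K :=
  ∑ F ∈ T, algebraMap ℝ K |(bordered F).det| / ∏ i, mixedSupport P x z (F i)

/-- No denominator of `hyperplaneDualMixedVolume P T` vanishes at `(x, z)`. -/
def RegularAt {K : Type*} [Field K] [Algebra ℝ K] {d : ℕ} {ι : Type*} [Fintype ι]
    (P : ι → Set (Fin d → ℝ)) (T : Finset (Fin (d - 1) → Fin d → ℝ))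
    (x : ι → K) (z : Fin d → K) : Prop :=
  ∀ F ∈ T, ∀ i, mixedSupport P x z (F i) ≠ 0

/-! ### The associahedron -/

/-- The pairs `i ≤ j` in `[n]`; the elements of `[n]` are numbered from `0` here. -/
abbrev IntervalIdx (n : ℕ) : Type := {p : Fin n × Fin n // p.1 ≤ p.2}

/-- The simplices `Δ_{[i,j]} = conv(e_i, …, e_j)`, the summands of the associahedron. -/
def lodaySimplex (n : ℕ) (p : IntervalIdx n) : Set (Fin n → ℝ) :=
  convexHull ℝ ((fun k : Fin n => Pi.single k (1 : ℝ)) '' Set.Icc p.1.1 p.1.2)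

/-! ### Plane binary trees

A plane binary tree with `n` nodes is a term of `BinaryTree Unit` with `n` nodes, where `nil` stands
for an absent child; `BinaryTree.treesOfNumNodesEq n` is the finite set of all of them. -/

/-- The search labelling of the nodes, with the consecutive labels `a, a + 1, …`: the labels in
the left branch of a node are smaller, those in its right branch are larger than its own label. -/
def searchLabel : BinaryTree Unit → ℕ → BinaryTree ℕ
  | .nil, _ => .nil
  | .node _ l r, a =>
      .node (a + l.numNodes) (searchLabel l a) (searchLabel r (a + l.numNodes + 1))

/-- The set of labels of the nodes of a tree. -/
def labelSet : BinaryTree ℕ → Finset ℕ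
  | .nil => ∅
  | .node k l r => insert k (labelSet l ∪ labelSet r)

/-- The edge between a node and its child `c` (no edge if the child is absent), represented by the
set of labels of the nodes at or below `c`. -/
def edgeTo : BinaryTree ℕ → List (Finset ℕ)
  | .nil => []
  | .node k l r => [labelSet (.node k l r)]

/-- The list of the sets `L_{B,e}`, for `e` running over the edges of `B`: the labels of the
component of `B - e` that does not contain the root. -/
def lowerSets : BinaryTree ℕ → List (Finset ℕ)
  | .nil => []
  | .node _ l r => edgeTo l ++ edgeTo r ++ lowerSets l ++ lowerSets r

/-- `∑_{i, j ∈ L} x_{ij}`, over the pairs `i ≤ j` in `L`. -/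
def pairSum {K : Type*} [Field K] {n : ℕ} (x : IntervalIdx n → K) (L : Finset ℕ) : K :=
  ∑ p : IntervalIdx n with (p.1.1 : ℕ) ∈ L ∧ (p.1.2 : ℕ) ∈ L, x p

/-- `∑_{B ∈ PB(n)} ∏_{e ∈ B} 1 / (∑_{i, j ∈ L_{B,e}} x_{ij})`. -/
def binaryTreeSum {K : Type*} [Field K] (n : ℕ) (x : IntervalIdx n → K) : K :=
  ∑ B ∈ BinaryTree.treesOfNumNodesEq n,
    ((lowerSets (searchLabel B 0)).map fun L => 1 / pairSum x L).prod

/-! ### Planar cubic trees and the planar `φ³` amplitude -/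

/-- Vertices of a cubic tree with `N` leaves: the labelled leaves (numbered from `0` here) and the
`N - 2` interior vertices. -/
abbrev CubicVertex (N : ℕ) : Type := Fin N ⊕ Fin (N - 2)

/-- `FirstLeaf rot u v i`: walking along the edge from `u` to `v` and then, at every interior vertex
`k` entered from `u'`, on to `rot k u'`, the first leaf that is reached is the leaf `i`. -/
inductive FirstLeaf {N : ℕ} (rot : Fin (N - 2) → CubicVertex N → CubicVertex N) :
    CubicVertex N → CubicVertex N → Fin N → Prop
  | atLeaf (u : CubicVertex N) (i : Fin N) : FirstLeaf rot u (Sum.inl i) i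
  | atInterior (u : CubicVertex N) (k : Fin (N - 2)) (i : Fin N)
      (h : FirstLeaf rot (Sum.inr k) (rot k u) i) : FirstLeaf rot u (Sum.inr k) i

/-- A cubic tree drawn in a disk with its `N` leaves on the boundary circle, labelled in
counterclockwise order. The drawing is recorded, as usual, by its rotation system: `rot k u` is the
neighbour of the interior vertex `k` that follows the neighbour `u` in counterclockwise order
around `k`. Thus the walk in `leaf_order` keeps the tree on its left, and the leaf that it reaches from the leaf `i`
is the next one in counterclockwise order on the circle. -/
structure PlanarCubicTree (N : ℕ) where
  graph : SimpleGraph (CubicVertex N)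
  isTree : graph.IsTree
  leaf_degree : ∀ i : Fin N, (graph.neighborSet (Sum.inl i)).ncard = 1
  interior_degree : ∀ k : Fin (N - 2), (graph.neighborSet (Sum.inr k)).ncard = 3
  rot : Fin (N - 2) → CubicVertex N → CubicVertex N
  rot_adj : ∀ k u, graph.Adj (Sum.inr k) u → graph.Adj (Sum.inr k) (rot k u)
  rot_cyclic : ∀ k u w, graph.Adj (Sum.inr k) u → graph.Adj (Sum.inr k) w →
    ∃ m : ℕ, (rot k)^[m] u = w
  leaf_order : ∀ i v, graph.Adj (Sum.inl i) v → FirstLeaf rot (Sum.inl i) v (finRotate N i)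

namespace PlanarCubicTree

variable {N : ℕ}

/-- Extension of a renaming of the interior vertices by the identity on the leaves. -/
def rename (e : Fin (N - 2) ≃ Fin (N - 2)) : CubicVertex N ≃ CubicVertex N :=
  Equiv.sumCongr (Equiv.refl _) e

/-- Two drawings are the same planar cubic tree if they differ by a renaming of the (unlabelled)
interior vertices. -/
def Same (T T' : PlanarCubicTree N) : Prop :=
  ∃ e : Fin (N - 2) ≃ Fin (N - 2),
    (∀ u v, T'.graph.Adj (rename e u) (rename e v) ↔ T.graph.Adj u v) ∧
    ∀ k u, T.graph.Adj (Sum.inr k) u → T'.rot (e k) (rename e u) = rename e (T.rot k u)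

theorem Same.refl (T : PlanarCubicTree N) : Same T T :=
  ⟨Equiv.refl _, by simp [rename], by simp [rename]⟩

theorem Same.symm {T T' : PlanarCubicTree N} (h : Same T T') : Same T' T := by
  obtain ⟨e, h1, h2⟩ := h
  have hr : ∀ u, rename e (rename e.symm u) = u := by
    rintro (u | u) <;> simp [rename]
  have hr' : ∀ u, rename e.symm (rename e u) = u := by
    rintro (u | u) <;> simp [rename]
  have hk : ∀ k, rename e (Sum.inr (e.symm k)) = (Sum.inr k : CubicVertex N) := by
    intro k; simp [rename]
  refine ⟨e.symm, fun u v => ?_, fun k u hu => ?_⟩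
  · rw [← h1, hr, hr]
  · have hu' : T.graph.Adj (Sum.inr (e.symm k)) (rename e.symm u) := by
      rw [← h1, hr, hk]; exact hu
    have := h2 _ _ hu'
    rw [hr, Equiv.apply_symm_apply] at this
    rw [this, hr']

theorem Same.trans {T T' T'' : PlanarCubicTree N} (h : Same T T') (h' : Same T' T'') :
    Same T T'' := by
  obtain ⟨e, h1, h2⟩ := h
  obtain ⟨f, g1, g2⟩ := h'
  have hr : ∀ u, rename (e.trans f) u = rename f (rename e u) := by
    rintro (u | u) <;> simp [rename]
  refine ⟨e.trans f, fun u v => ?_, fun k u hu => ?_⟩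
  · rw [hr, hr, g1, h1]
  · have hu' : T'.graph.Adj (Sum.inr (e k)) (rename e u) := by
      have := (h1 (Sum.inr k) u).2 hu
      simpa [rename] using this
    rw [hr, hr, ← h2 k u hu, ← g2 _ _ hu']
    rfl

instance setoid (N : ℕ) : Setoid (PlanarCubicTree N) where
  r := Same
  iseqv := ⟨Same.refl, Same.symm, Same.trans⟩

instance : Finite (PlanarCubicTree N) := by
  refine Finite.of_injective
    (β := SimpleGraph (CubicVertex N) × (Fin (N - 2) → CubicVertex N → CubicVertex N))
    (fun T => (T.graph, T.rot)) ?_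
  rintro ⟨g, _, _, _, r, _, _, _⟩ ⟨g', _, _, _, r', _, _, _⟩ h
  simp only [Prod.mk.injEq] at h
  obtain ⟨rfl, rfl⟩ := h
  rfl

open Classical in
/-- The edges that join two interior vertices. -/
def interiorEdges (T : PlanarCubicTree N) : Finset (Sym2 (CubicVertex N)) :=
  Finset.univ.filter fun e => e ∈ T.graph.edgeSet ∧ ∀ i : Fin N, Sum.inl i ∉ e

open Classical in
/-- The set `L_{T,e}` of the leaves in the component of `T - e` that does not contain the leaf with
the largest label. -/
def lowerLeaves (T : PlanarCubicTree N) (e : Sym2 (CubicVertex N)) : Finset (Fin N) :=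
  Finset.univ.filter fun i => ∀ j : Fin N, (j : ℕ) + 1 = N →
    ¬ (T.graph.deleteEdges {e}).Reachable (Sum.inl i) (Sum.inl j)

/-- `X_e = ∑_{i < j} s_{ij}`, over the leaves `i`, `j` in a component of `T - e`. (For Mandelstam
variables, both components give the same value.) -/
def edgeX {K : Type*} [Field K] (s : Fin N → Fin N → K) (T : PlanarCubicTree N)
    (e : Sym2 (CubicVertex N)) : K :=
  ∑ i ∈ T.lowerLeaves e, ∑ j ∈ T.lowerLeaves e with i < j, s i j

/-- The contribution `∏_e 1 / X_e` of a tree to the amplitude. -/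
def weight {K : Type*} [Field K] (s : Fin N → Fin N → K) (T : PlanarCubicTree N) : K :=
  ∏ e ∈ T.interiorEdges, 1 / edgeX s T e

theorem weight_eq_of_same {K : Type*} [Field K] (s : Fin N → Fin N → K)
    {T T' : PlanarCubicTree N} (h : Same T T') : weight s T = weight s T' := by
  obtain ⟨e, h1, -⟩ := h
  have hl : ∀ i : Fin N, rename e (Sum.inl i) = (Sum.inl i : CubicVertex N) := fun i => by
    simp [rename]
  have hmem : ∀ (a : Sym2 (CubicVertex N)),
      Sym2.map (rename e) a ∈ T'.graph.edgeSet ↔ a ∈ T.graph.edgeSet := by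
    intro a
    induction a using Sym2.ind with
    | _ u v => simpa using h1 u v
  have hleaf : ∀ (i : Fin N) (a : Sym2 (CubicVertex N)),
      Sum.inl i ∈ Sym2.map (rename e) a ↔ Sum.inl i ∈ a := by
    intro i a
    rw [Sym2.mem_map]
    constructor
    · rintro ⟨u, hu, hui⟩
      rw [← hl i] at hui
      rw [← (rename e).injective hui]; exact hu
    · intro hi; exact ⟨_, hi, hl i⟩
  have hL : ∀ a : Sym2 (CubicVertex N),
      T'.lowerLeaves (Sym2.map (rename e) a) = T.lowerLeaves a := by
    intro a
    let φ : T.graph.deleteEdges {a} ≃g T'.graph.deleteEdges {Sym2.map (rename e) a} :=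
      { rename e with
        map_rel_iff' := by
          intro u v
          have : (s(rename e u, rename e v) = Sym2.map (rename e) a) ↔ s(u, v) = a := by
            rw [← Sym2.map_mk, (Sym2.map.injective (rename e).injective).eq_iff]
          simp only [SimpleGraph.deleteEdges_adj, Set.mem_singleton_iff]
          exact and_congr (h1 u v) (not_congr this) }
    have hφ : ∀ i j : Fin N,
        (T'.graph.deleteEdges {Sym2.map (rename e) a}).Reachable (Sum.inl i) (Sum.inl j) ↔
          (T.graph.deleteEdges {a}).Reachable (Sum.inl i) (Sum.inl j) := by
      intro i j
      have := SimpleGraph.Iso.reachable_iff (φ := φ) (u := Sum.inl i) (v := Sum.inl j)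
      rw [← this]
      change _ ↔ (T'.graph.deleteEdges {Sym2.map (rename e) a}).Reachable
        (rename e (Sum.inl i)) (rename e (Sum.inl j))
      rw [hl, hl]
    ext i
    simp only [lowerLeaves, Finset.mem_filter, Finset.mem_univ, true_and, hφ]
  refine Finset.prod_bij (fun a _ => Sym2.map (rename e) a) ?_ ?_ ?_ ?_
  · intro a ha
    simp only [interiorEdges, Finset.mem_filter, Finset.mem_univ, true_and, hmem, hleaf] at ha ⊢
    exact ha
  · intro a _ b _ hab
    exact Sym2.map.injective (rename e).injective hab
  · intro b hb
    have hb' : Sym2.map (rename e) (Sym2.map (rename e).symm b) = b := by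
      rw [Sym2.map_map]; simp
    refine ⟨Sym2.map (rename e).symm b, ?_, hb'⟩
    rw [← hb'] at hb
    simp only [interiorEdges, Finset.mem_filter, Finset.mem_univ, true_and, hmem, hleaf] at hb ⊢
    exact hb
  · intro a _
    simp only [edgeX, hL]

end PlanarCubicTree

/-- The set `PC(N)` of planar cubic trees with `N` leaves. -/
abbrev PC (N : ℕ) : Type := Quotient (PlanarCubicTree.setoid N)

instance (N : ℕ) : Fintype (PC N) := Fintype.ofFinite _

/-- The contribution of a planar cubic tree to the amplitude. -/
def treeWeight {K : Type*} [Field K] {N : ℕ} (s : Fin N → Fin N → K) (T : PC N) : K :=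
  Quotient.lift (PlanarCubicTree.weight s)
    (fun _ _ h => PlanarCubicTree.weight_eq_of_same s h) T

/-- The planar `φ³` amplitude at tree level, `∑_{T ∈ PC(N)} ∏_{e ∈ E(T)} 1 / X_e`. -/
def phi3Amplitude {K : Type*} [Field K] {N : ℕ} (s : Fin N → Fin N → K) : K :=
  ∑ T : PC N, treeWeight s T

/-- The relations between the Mandelstam variables. -/
structure IsMandelstam {K : Type*} [Field K] {N : ℕ} (s : Fin N → Fin N → K) : Prop where
  diag : ∀ i, s i i = 0
  symm : ∀ i j, s i j = s j i
  sum_eq_zero : ∀ i, ∑ j, s i j = 0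

/-- The substitution `x_{ij} ↦ s_{i,j+1}`, for Mandelstam variables on `n + 2` particles. -/
def mandelstamSubst {K : Type*} {n : ℕ} (s : Fin (n + 2) → Fin (n + 2) → K) :
    IntervalIdx n → K :=
  fun p => s p.1.1.castSucc.castSucc p.1.2.succ.castSucc

end

open scoped NNReal Pointwise

noncomputable section

/-! Let M(v) (`totalMin`) be the sum of the minima of v over all intervals, let N be the number of
intervals, and let h_x be the mixed support function at z = 0. Then M = -h_P, the dual cone is {M ≥
0}, and M(v + c𝟏) = M(v) + Nc. Hence the boundary is {M = 0}, and every v with M(v) > 0 is uniquely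
a boundary point plus a positive multiple of 𝟏.

Part (1) evaluates one integral in two ways. Let x be real with sum zero and x_p < 0 for every p
except the full interval. Then h_x is invariant under adding constants and positive on nonzero
boundary points. Integrate exp(-(h_x + M)) over {M > 0}. For a triangulation T, each F in T together
with 𝟏 spans a full-dimensional simplicial cone. All interval minima are linear on it
(`IsConeTriangulation.intervalMin_sum`), because they are concave and their sum M vanishes
identically on the cone of F. So the cone contributes |det(F, 𝟏)| / (N ∏ h_x(v_i)), and these cones
tile {M > 0} up to a null set. The second tiling is the normal fan of the associahedron. The chamber
of a tree B consists of the v that increase from each node to its descendants. Its generators are 𝟏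
and, for each node other than the root, the indicator of the interval of descendants, shifted into
{M = 0}. This basis has determinant 1 (`det_chamberMatrix`), and h_x takes on such a ray the value
minus the sum of the x_ij inside the interval (`sum_mul_intervalMin_ray`). Cancelling 1/N gives the
identity for these x (`IsConeTriangulation.sum_eq_of_neg`), with n - 1 signs in each tree term.

After clearing denominators this is a polynomial identity on an orthant, hence valid over every
extension field (`sum_div_eq_zero_of_real`). The tree denominators are nonzero wherever those of T
are, because every ray of the fan is, up to scaling, a generator in T
(`IsConeTriangulation.exists_smul_ray`).

For part (2), a planar cubic tree is hung up at its last leaf; the rotation system then reads off a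
plane binary tree with n nodes (`PlanarCubicTree.exists_same`, `PlanarCubicTree.eq_of_same`).
Interior edges correspond to nodes other than the root. The nodes below an edge form [α, β) and the
leaves below it [α, β], so the pairs i < j of leaves match the pairs i ≤ j - 1 of nodes, which is
the substitution x_ij = s_{i,j+1}. -/

/-! ### Descendant intervals in a labelled plane binary tree -/

/-- The labels at or below the node `k` of `B`, labelled from `a` on, form the interval
`[lowEnd B a k, highEnd B a k)`. -/
def lowEnd : BinaryTree Unit → ℕ → ℕ → ℕ
  | .nil, a, _ => a
  | .node _ l r, a, k =>
      if k < a + l.numNodes then lowEnd l a k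
      else if k = a + l.numNodes then a
      else lowEnd r (a + l.numNodes + 1) k

/-- The upper end of the interval of labels at or below the node `k`. -/
def highEnd : BinaryTree Unit → ℕ → ℕ → ℕ
  | .nil, a, _ => a
  | .node _ l r, a, k =>
      if k < a + l.numNodes then highEnd l a k
      else if k = a + l.numNodes then a + l.numNodes + r.numNodes + 1
      else highEnd r (a + l.numNodes + 1) k

/-- The node `l` is at or below the node `k`. -/
def IsBelow (B : BinaryTree Unit) (a l k : ℕ) : Prop :=
  lowEnd B a k ≤ l ∧ l < highEnd B a k

instance (B : BinaryTree Unit) (a l k : ℕ) : Decidable (IsBelow B a l k) :=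
  inferInstanceAs (Decidable (_ ∧ _))

/-- The label of the root. -/
def rootLabel : BinaryTree Unit → ℕ → ℕ
  | .nil, a => a
  | .node _ l _, a => a + l.numNodes

theorem lowEnd_left {u : Unit} {l r : BinaryTree Unit} {a k : ℕ} (h : k < a + l.numNodes) :
    lowEnd (.node u l r) a k = lowEnd l a k := by simp [lowEnd, h]

theorem lowEnd_root (u : Unit) (l r : BinaryTree Unit) (a : ℕ) :
    lowEnd (.node u l r) a (a + l.numNodes) = a := by simp [lowEnd]

theorem lowEnd_right {u : Unit} {l r : BinaryTree Unit} {a k : ℕ} (h : a + l.numNodes < k) :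
    lowEnd (.node u l r) a k = lowEnd r (a + l.numNodes + 1) k := by
  simp [lowEnd, h.ne', not_lt.2 h.le]

theorem highEnd_left {u : Unit} {l r : BinaryTree Unit} {a k : ℕ} (h : k < a + l.numNodes) :
    highEnd (.node u l r) a k = highEnd l a k := by simp [highEnd, h]

theorem highEnd_root (u : Unit) (l r : BinaryTree Unit) (a : ℕ) :
    highEnd (.node u l r) a (a + l.numNodes) = a + l.numNodes + r.numNodes + 1 := by
  simp [highEnd]

theorem highEnd_right {u : Unit} {l r : BinaryTree Unit} {a k : ℕ} (h : a + l.numNodes < k) :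
    highEnd (.node u l r) a k = highEnd r (a + l.numNodes + 1) k := by
  simp [highEnd, h.ne', not_lt.2 h.le]

theorem isBelow_left {u : Unit} {l r : BinaryTree Unit} {a k j : ℕ} (h : k < a + l.numNodes) :
    IsBelow (.node u l r) a j k ↔ IsBelow l a j k := by
  simp only [IsBelow, lowEnd_left h, highEnd_left h]

theorem isBelow_right {u : Unit} {l r : BinaryTree Unit} {a k j : ℕ} (h : a + l.numNodes < k) :
    IsBelow (.node u l r) a j k ↔ IsBelow r (a + l.numNodes + 1) j k := by
  simp only [IsBelow, lowEnd_right h, highEnd_right h]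

theorem isBelow_root {u : Unit} {l r : BinaryTree Unit} {a j : ℕ} :
    IsBelow (.node u l r) a j (a + l.numNodes) ↔
      a ≤ j ∧ j < a + l.numNodes + r.numNodes + 1 := by
  simp only [IsBelow, lowEnd_root, highEnd_root]

theorem ends_bounds {B : BinaryTree Unit} {a k : ℕ} (h1 : a ≤ k) (h2 : k < a + B.numNodes) :
    a ≤ lowEnd B a k ∧ lowEnd B a k ≤ k ∧ k < highEnd B a k ∧
      highEnd B a k ≤ a + B.numNodes := by
  induction B generalizing a with
  | nil => simp at h2; omega
  | node u l r ihl ihr =>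
    simp only [BinaryTree.numNodes] at h2 ⊢
    rcases lt_trichotomy k (a + l.numNodes) with h | rfl | h
    · rw [lowEnd_left h, highEnd_left h]
      have := ihl h1 h; omega
    · rw [lowEnd_root, highEnd_root]; omega
    · rw [lowEnd_right h, highEnd_right h]
      have := @ihr (a + l.numNodes + 1) (by omega) (by omega); omega

theorem isBelow_self {B : BinaryTree Unit} {a k : ℕ} (h1 : a ≤ k) (h2 : k < a + B.numNodes) :
    IsBelow B a k k :=
  ⟨(ends_bounds h1 h2).2.1, (ends_bounds h1 h2).2.2.1⟩

theorem IsBelow.mem_range {B : BinaryTree Unit} {a j k : ℕ} (h1 : a ≤ k)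
    (h2 : k < a + B.numNodes) (h : IsBelow B a j k) : a ≤ j ∧ j < a + B.numNodes := by
  have := ends_bounds h1 h2
  unfold IsBelow at h; omega

theorem isBelow_rootLabel {B : BinaryTree Unit} {a j : ℕ} (h1 : a ≤ j)
    (h2 : j < a + B.numNodes) : IsBelow B a j (rootLabel B a) := by
  cases B with
  | nil => simp at h2; omega
  | node u l r =>
    simp only [BinaryTree.numNodes] at h2
    exact isBelow_root.2 ⟨h1, by omega⟩

theorem rootLabel_mem {B : BinaryTree Unit} {a : ℕ} (h : 0 < B.numNodes) :
    a ≤ rootLabel B a ∧ rootLabel B a < a + B.numNodes := by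
  cases B with
  | nil => simp at h
  | node u l r => simp only [BinaryTree.numNodes, rootLabel]; omega

theorem ends_rootLabel {B : BinaryTree Unit} {a : ℕ} :
    lowEnd B a (rootLabel B a) = a ∧ highEnd B a (rootLabel B a) = a + B.numNodes := by
  cases B with
  | nil => simp [lowEnd, highEnd]
  | node u l r =>
    simp only [rootLabel, lowEnd_root, highEnd_root, BinaryTree.numNodes, true_and]; omega

theorem IsBelow.ends_le {B : BinaryTree Unit} {a j k : ℕ} (h1 : a ≤ k) (h2 : k < a + B.numNodes)
    (h : IsBelow B a j k) : lowEnd B a k ≤ lowEnd B a j ∧ highEnd B a j ≤ highEnd B a k := by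
  induction B generalizing a with
  | nil => simp at h2; omega
  | node u l r ihl ihr =>
    have hj := h.mem_range h1 h2
    have hjb := ends_bounds hj.1 hj.2
    simp only [BinaryTree.numNodes] at h2 hj hjb
    rcases lt_trichotomy k (a + l.numNodes) with hk | rfl | hk
    · rw [isBelow_left hk] at h
      have := h.mem_range h1 hk
      rw [lowEnd_left hk, highEnd_left hk, lowEnd_left this.2, highEnd_left this.2]
      exact ihl h1 hk h
    · rw [lowEnd_root, highEnd_root]; omega
    · rw [isBelow_right hk] at h
      have := h.mem_range (by omega) (by omega)
      rw [lowEnd_right hk, highEnd_right hk, lowEnd_right (by omega), highEnd_right (by omega)]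
      exact ihr (by omega) (by omega) h

theorem IsBelow.trans {B : BinaryTree Unit} {a i j k : ℕ} (h1 : a ≤ k) (h2 : k < a + B.numNodes)
    (h : IsBelow B a i j) (h' : IsBelow B a j k) : IsBelow B a i k := by
  have := h'.ends_le h1 h2
  unfold IsBelow at *; omega

theorem IsBelow.antisymm {B : BinaryTree Unit} {a j k : ℕ} (h1 : a ≤ k)
    (h2 : k < a + B.numNodes) (h : IsBelow B a j k) (h' : IsBelow B a k j) : j = k := by
  induction B generalizing a with
  | nil => simp at h2; omega
  | node u l r ihl ihr =>
    have hj := h.mem_range h1 h2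
    simp only [BinaryTree.numNodes] at h2 hj
    rcases lt_trichotomy k (a + l.numNodes) with hk | rfl | hk
    · rw [isBelow_left hk] at h
      have := h.mem_range h1 hk
      rw [isBelow_left this.2] at h'
      exact ihl h1 hk h h'
    · rcases lt_trichotomy j (a + l.numNodes) with hj' | hj' | hj'
      · rw [isBelow_left hj'] at h'
        have := h'.mem_range hj.1 hj'; omega
      · exact hj'
      · rw [isBelow_right hj'] at h'
        have := h'.mem_range (by omega) (by omega); omega
    · rw [isBelow_right hk] at h
      have := h.mem_range (by omega) (by omega)
      rw [isBelow_right (by omega)] at h'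
      exact ihr (by omega) (by omega) h h'

/-- The lowest common ancestor of `i` and `j` is labelled between them: it is the first root met on
the way down that does not leave both on the same side. This makes interval minima linear on
chambers. -/
theorem exists_isBelow_interval {B : BinaryTree Unit} {a i j : ℕ} (h1 : a ≤ i) (h2 : i ≤ j)
    (h3 : j < a + B.numNodes) :
    ∃ k, i ≤ k ∧ k ≤ j ∧ IsBelow B a i k ∧ IsBelow B a j k := by
  induction B generalizing a with
  | nil => simp at h3; omega
  | node u l r ihl ihr =>
    simp only [BinaryTree.numNodes] at h3
    by_cases hj : j < a + l.numNodes
    · obtain ⟨k, hk1, hk2, hk⟩ := ihl h1 hj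
      refine ⟨k, hk1, hk2, ?_⟩
      rwa [isBelow_left (by omega), isBelow_left (by omega)]
    by_cases hi : a + l.numNodes < i
    · obtain ⟨k, hk1, hk2, hk⟩ := @ihr (a + l.numNodes + 1) (by omega) (by omega)
      refine ⟨k, hk1, hk2, ?_⟩
      rwa [isBelow_right (by omega), isBelow_right (by omega)]
    refine ⟨a + l.numNodes, by omega, by omega, ?_⟩
    rw [isBelow_root, isBelow_root]; omega

theorem IsBelow.between {B : BinaryTree Unit} {a i j k x : ℕ} (hi : IsBelow B a i k)
    (hj : IsBelow B a j k) (h1 : i ≤ x) (h2 : x ≤ j) : IsBelow B a x k := by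
  unfold IsBelow at *; omega

/-! ### Monotone functions on a labelled tree -/

/-- A function on the labels that increases towards the leaves. -/
def MonoOn (B : BinaryTree Unit) (a : ℕ) (v : ℕ → ℝ) : Prop :=
  ∀ k j, a ≤ k → k < a + B.numNodes → IsBelow B a j k → v k ≤ v j

/-- A function on the labels that increases strictly towards the leaves. -/
def StrictOn (B : BinaryTree Unit) (a : ℕ) (v : ℕ → ℝ) : Prop :=
  ∀ k j, a ≤ k → k < a + B.numNodes → IsBelow B a j k → j ≠ k → v k < v j

/-- The root is the place of the strict minimum, so two different roots would each have the smaller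
value. The branches are compared recursively. -/
theorem StrictOn.unique {B B' : BinaryTree Unit} {a : ℕ} {v : ℕ → ℝ}
    (hn : B.numNodes = B'.numNodes) (h : StrictOn B a v) (h' : StrictOn B' a v) : B = B' := by
  induction B generalizing B' a with
  | nil =>
    cases B' with
    | nil => rfl
    | node u l r => simp [BinaryTree.numNodes] at hn
  | node u l r ihl ihr =>
    cases B' with
    | nil => simp [BinaryTree.numNodes] at hn
    | node u' l' r' =>
      simp only [BinaryTree.numNodes] at hn
      have hl : l.numNodes = l'.numNodes := by
        by_contra hne
        have e1 := h (a + l.numNodes) (a + l'.numNodes) (by omega)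
          (by simp only [BinaryTree.numNodes]; omega) (isBelow_root.2 (by omega)) (by omega)
        have e2 := h' (a + l'.numNodes) (a + l.numNodes) (by omega)
          (by simp only [BinaryTree.numNodes]; omega) (isBelow_root.2 (by omega)) (by omega)
        exact lt_asymm e1 e2
      have el : l = l' := by
        refine ihl (a := a) hl (fun k j h1 h2 hb hne => ?_) (fun k j h1 h2 hb hne => ?_)
        · exact h k j h1 (by simp only [BinaryTree.numNodes]; omega) ((isBelow_left h2).2 hb) hne
        · exact h' k j h1 (by simp only [BinaryTree.numNodes]; omega) ((isBelow_left h2).2 hb) hne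
      have er : r = r' := by
        refine ihr (a := a + l.numNodes + 1) (by omega) (fun k j h1 h2 hb hne => ?_)
          (fun k j h1 h2 hb hne => ?_)
        · exact h k j (by omega) (by simp only [BinaryTree.numNodes]; omega)
            ((isBelow_right (by omega)).2 hb) hne
        · refine h' k j (by omega) (by simp only [BinaryTree.numNodes]; omega)
            ((isBelow_right (by omega)).2 ?_) hne
          rwa [← hl]
      rw [el, er]

/-- The Cartesian tree of `v`: a minimum becomes the root, and the two sides are treated
recursively. -/
theorem exists_monoOn (m a : ℕ) (v : ℕ → ℝ) :
    ∃ B : BinaryTree Unit, B.numNodes = m ∧ MonoOn B a v := by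
  induction m using Nat.strong_induction_on generalizing a with
  | _ m ih =>
    rcases Nat.eq_zero_or_pos m with rfl | hm
    · exact ⟨.nil, rfl, fun k j h1 h2 => by simp at h2; omega⟩
    obtain ⟨c, hc, hmin⟩ := Finset.exists_min_image (Finset.Ico a (a + m)) v
      ⟨a, by simp; omega⟩
    rw [Finset.mem_Ico] at hc
    obtain ⟨l, hl, hl'⟩ := ih (c - a) (by omega) a
    obtain ⟨r, hr, hr'⟩ := ih (a + m - c - 1) (by omega) (c + 1)
    have hac : a + l.numNodes = c := by omega
    refine ⟨.node () l r, by simp only [BinaryTree.numNodes]; omega, fun k j h1 h2 hb => ?_⟩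
    have hj := hb.mem_range h1 h2
    simp only [BinaryTree.numNodes] at h2 hj
    rcases lt_trichotomy k (a + l.numNodes) with hk | hk | hk
    · exact hl' k j h1 hk ((isBelow_left hk).1 hb)
    · rw [hk, hac]
      exact hmin j (by rw [Finset.mem_Ico]; omega)
    · rw [isBelow_right hk, hac] at hb
      exact hr' k j (by omega) (by omega) hb

/-- The expansion of `v - c` in the indicator functions of the descendant intervals. -/
theorem exists_coeff (B : BinaryTree Unit) (a : ℕ) (v : ℕ → ℝ) (c : ℝ) :
    ∃ t : ℕ → ℝ,
      (∀ k, a ≤ k → k < a + B.numNodes → (k = rootLabel B a ∧ t k = v k - c) ∨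
        ∃ k', a ≤ k' ∧ k' < a + B.numNodes ∧ IsBelow B a k k' ∧ k ≠ k' ∧ t k = v k - v k') ∧
      ∀ j, a ≤ j → j < a + B.numNodes →
        v j = c + ∑ k ∈ Finset.Ico a (a + B.numNodes), if IsBelow B a j k then t k else 0 := by
  induction B generalizing a c with
  | nil => exact ⟨0, fun k h1 h2 => by simp at h2; omega, fun k h1 h2 => by simp at h2; omega⟩
  | node u l r ihl ihr =>
    set d := a + l.numNodes with hd
    -- Both branches are expanded relative to the value at the root, so each coefficient is the
    -- value at a node minus the value at its parent.
    obtain ⟨tl, hl1, hl2⟩ := ihl a (v d)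
    obtain ⟨tr, hr1, hr2⟩ := ihr (d + 1) (v d)
    refine ⟨fun k => if k < d then tl k else if k = d then v d - c else tr k, ?_, ?_⟩
    · intro k h1 h2
      simp only [BinaryTree.numNodes] at h2 ⊢
      rcases lt_trichotomy k d with hk | hk | hk
      · right
        simp only [hk, if_true]
        rcases hl1 k h1 hk with ⟨-, h⟩ | ⟨k', h3, h4, h5, h6, h7⟩
        · exact ⟨d, by omega, by omega, isBelow_root.2 (by omega), by omega, h⟩
        · exact ⟨k', h3, by omega, (isBelow_left h4).2 h5, h6, h7⟩
      · left
        subst hk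
        simp [rootLabel, hd]
      · right
        simp only [not_lt.2 hk.le, hk.ne', if_false]
        rcases hr1 k hk (by omega) with ⟨-, h⟩ | ⟨k', h3, h4, h5, h6, h7⟩
        · exact ⟨d, by omega, by omega, isBelow_root.2 (by omega), by omega, h⟩
        · exact ⟨k', by omega, by omega, (isBelow_right (by omega)).2 h5, h6, h7⟩
    · intro j h1 h2
      have hsplit : ∀ f : ℕ → ℝ, ∑ k ∈ Finset.Ico a (a + (BinaryTree.node u l r).numNodes), f k =
          ∑ k ∈ Finset.Ico a d, f k + (f d + ∑ k ∈ Finset.Ico (d + 1) (d + 1 + r.numNodes), f k) := by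
        intro f
        have e : a + (BinaryTree.node u l r).numNodes = d + 1 + r.numNodes := by
          simp only [BinaryTree.numNodes]; omega
        rw [e, ← Finset.sum_Ico_consecutive f (show a ≤ d by omega)
          (show d ≤ d + 1 + r.numNodes by omega),
          Finset.sum_eq_sum_Ico_succ_bot (show d < d + 1 + r.numNodes by omega)]
      rw [hsplit]
      have eL : ∑ k ∈ Finset.Ico a d, (if IsBelow (.node u l r) a j k then
            (if k < d then tl k else if k = d then v d - c else tr k) else 0) =
          ∑ k ∈ Finset.Ico a d, if IsBelow l a j k then tl k else 0 := by
        refine Finset.sum_congr rfl fun k hk => ?_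
        rw [Finset.mem_Ico] at hk
        simp only [isBelow_left hk.2, hk.2, if_true]
      have eR : ∑ k ∈ Finset.Ico (d + 1) (d + 1 + r.numNodes),
            (if IsBelow (.node u l r) a j k then
              (if k < d then tl k else if k = d then v d - c else tr k) else 0) =
          ∑ k ∈ Finset.Ico (d + 1) (d + 1 + r.numNodes),
            if IsBelow r (d + 1) j k then tr k else 0 := by
        refine Finset.sum_congr rfl fun k hk => ?_
        rw [Finset.mem_Ico] at hk
        simp only [isBelow_right (show a + l.numNodes < k by omega), ← hd,
          show ¬ k < d by omega, show k ≠ d by omega, if_false]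
      simp only [BinaryTree.numNodes] at h2
      have eM : IsBelow (.node u l r) a j d := isBelow_root.2 (by omega)
      have zL : ¬ j < d → ∑ k ∈ Finset.Ico a d, (if IsBelow l a j k then tl k else 0) = 0 := by
        intro hj
        refine Finset.sum_eq_zero fun k hk => if_neg fun hb => ?_
        rw [Finset.mem_Ico] at hk
        exact hj (hb.mem_range hk.1 hk.2).2
      have zR : ¬ d < j → ∑ k ∈ Finset.Ico (d + 1) (d + 1 + r.numNodes),
          (if IsBelow r (d + 1) j k then tr k else 0) = 0 := by
        intro hj
        refine Finset.sum_eq_zero fun k hk => if_neg fun hb => ?_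
        rw [Finset.mem_Ico] at hk
        exact hj (hb.mem_range hk.1 hk.2).1
      rw [eL, eR]
      simp only [eM, lt_irrefl, if_true, if_false]
      rcases lt_trichotomy j d with hj | rfl | hj
      · rw [zR (by omega), hl2 j h1 hj]; ring
      · rw [zR (by omega), zL (by omega)]; ring
      · rw [zL (by omega), hr2 j hj (by omega)]; ring

/-! ### The edges of a labelled tree -/

theorem labelSet_searchLabel (B : BinaryTree Unit) (a : ℕ) :
    labelSet (searchLabel B a) = Finset.Ico a (a + B.numNodes) := by
  induction B generalizing a with
  | nil => simp [searchLabel, labelSet]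
  | node u l r ihl ihr =>
    simp only [searchLabel, labelSet, ihl, ihr, BinaryTree.numNodes]
    ext x
    simp only [Finset.mem_insert, Finset.mem_union, Finset.mem_Ico]
    omega

/-- Including the edge that enters `B` from above supplies the factor of the root of `B`. With it
every node contributes exactly once, and the induction passes to the branches. -/
theorem prod_edgeTo_lowerSets {K : Type*} [CommMonoid K] (f : Finset ℕ → K)
    (B : BinaryTree Unit) (a : ℕ) :
    ((edgeTo (searchLabel B a)).map f).prod * ((lowerSets (searchLabel B a)).map f).prod =
      ∏ k ∈ Finset.Ico a (a + B.numNodes), f (Finset.Ico (lowEnd B a k) (highEnd B a k)) := by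
  induction B generalizing a with
  | nil => simp [searchLabel, edgeTo, lowerSets]
  | node u l r ihl ihr =>
    have e : a + (BinaryTree.node u l r).numNodes = a + l.numNodes + 1 + r.numNodes := by
      simp only [BinaryTree.numNodes]; omega
    have hlab := labelSet_searchLabel (.node u l r) a
    rw [e, ← Finset.prod_Ico_consecutive _ (show a ≤ a + l.numNodes by omega)
      (show a + l.numNodes ≤ a + l.numNodes + 1 + r.numNodes by omega),
      Finset.prod_eq_prod_Ico_succ_bot
        (show a + l.numNodes < a + l.numNodes + 1 + r.numNodes by omega)]
    have eL : ∏ k ∈ Finset.Ico a (a + l.numNodes), f (Finset.Ico (lowEnd (.node u l r) a k)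
        (highEnd (.node u l r) a k)) = ∏ k ∈ Finset.Ico a (a + l.numNodes),
          f (Finset.Ico (lowEnd l a k) (highEnd l a k)) := by
      refine Finset.prod_congr rfl fun k hk => ?_
      rw [Finset.mem_Ico] at hk
      rw [lowEnd_left hk.2, highEnd_left hk.2]
    have eR : ∏ k ∈ Finset.Ico (a + l.numNodes + 1) (a + l.numNodes + 1 + r.numNodes),
        f (Finset.Ico (lowEnd (.node u l r) a k) (highEnd (.node u l r) a k)) =
        ∏ k ∈ Finset.Ico (a + l.numNodes + 1) (a + l.numNodes + 1 + r.numNodes),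
          f (Finset.Ico (lowEnd r (a + l.numNodes + 1) k)
            (highEnd r (a + l.numNodes + 1) k)) := by
      refine Finset.prod_congr rfl fun k hk => ?_
      rw [Finset.mem_Ico] at hk
      rw [lowEnd_right (by omega), highEnd_right (by omega)]
    rw [eL, eR, ← ihl, ← ihr, lowEnd_root, highEnd_root]
    rw [e] at hlab
    simp only [searchLabel] at hlab ⊢
    simp only [edgeTo, lowerSets, List.map_append, List.prod_append, List.map_cons, List.map_nil,
      List.prod_cons, List.prod_nil, hlab, mul_one]
    have e2 : a + l.numNodes + r.numNodes + 1 = a + l.numNodes + 1 + r.numNodes := by omega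
    rw [e2]
    simp only [mul_comm, mul_left_comm, mul_assoc]

/-- The product over the edges is the product over the nodes other than the root. -/
theorem prod_lowerSets {K : Type*} [CommMonoid K] (f : Finset ℕ → K)
    (B : BinaryTree Unit) (a : ℕ) :
    ((lowerSets (searchLabel B a)).map f).prod =
      ∏ k ∈ (Finset.Ico a (a + B.numNodes)).erase (rootLabel B a),
        f (Finset.Ico (lowEnd B a k) (highEnd B a k)) := by
  cases B with
  | nil => simp [searchLabel, lowerSets]
  | node u l r =>
    have e : a + (BinaryTree.node u l r).numNodes = a + l.numNodes + 1 + r.numNodes := by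
      simp only [BinaryTree.numNodes]; omega
    have h1 := prod_edgeTo_lowerSets f l a
    have h2 := prod_edgeTo_lowerSets f r (a + l.numNodes + 1)
    have hset : (Finset.Ico a (a + (BinaryTree.node u l r).numNodes)).erase
        (rootLabel (.node u l r) a) = Finset.Ico a (a + l.numNodes) ∪
          Finset.Ico (a + l.numNodes + 1) (a + l.numNodes + 1 + r.numNodes) := by
      ext x
      simp only [rootLabel, e, Finset.mem_erase, Finset.mem_union, Finset.mem_Ico]
      omega
    rw [hset, Finset.prod_union]
    · have eL : ∏ k ∈ Finset.Ico a (a + l.numNodes), f (Finset.Ico (lowEnd (.node u l r) a k)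
          (highEnd (.node u l r) a k)) = ∏ k ∈ Finset.Ico a (a + l.numNodes),
            f (Finset.Ico (lowEnd l a k) (highEnd l a k)) := by
        refine Finset.prod_congr rfl fun k hk => ?_
        rw [Finset.mem_Ico] at hk
        rw [lowEnd_left hk.2, highEnd_left hk.2]
      have eR : ∏ k ∈ Finset.Ico (a + l.numNodes + 1) (a + l.numNodes + 1 + r.numNodes),
          f (Finset.Ico (lowEnd (.node u l r) a k) (highEnd (.node u l r) a k)) =
          ∏ k ∈ Finset.Ico (a + l.numNodes + 1) (a + l.numNodes + 1 + r.numNodes),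
            f (Finset.Ico (lowEnd r (a + l.numNodes + 1) k)
              (highEnd r (a + l.numNodes + 1) k)) := by
        refine Finset.prod_congr rfl fun k hk => ?_
        rw [Finset.mem_Ico] at hk
        rw [lowEnd_right (by omega), highEnd_right (by omega)]
      rw [eL, eR, ← h1, ← h2]
      simp only [searchLabel, lowerSets, List.map_append, List.prod_append]
      simp only [mul_assoc, mul_left_comm]
    · rw [Finset.disjoint_left]
      intro x
      simp only [Finset.mem_Ico]
      omega

/-! ### Exponential integrals over simplicial cones -/

section ConeIntegral

open MeasureTheory Set

variable {ι : Type*} [Fintype ι]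

theorem lintegral_orthant_exp (w : ι → ℝ) (hw : ∀ i, 0 < w i) :
    ∫⁻ t in {t : ι → ℝ | ∀ i, 0 < t i}, ENNReal.ofReal (Real.exp (-∑ i, t i * w i)) =
      ENNReal.ofReal (∏ i, (w i)⁻¹) := by
  have hset : {t : ι → ℝ | ∀ i, 0 < t i} = Set.univ.pi fun _ => Ioi 0 := by
    ext t; simp
  have hexp : ∀ t : ι → ℝ, Real.exp (-∑ i, t i * w i) = ∏ i, Real.exp (-w i * t i) := by
    intro t
    rw [← Real.exp_sum, ← Finset.sum_neg_distrib]
    congr 1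
    exact Finset.sum_congr rfl fun i _ => by ring
  have hint : ∀ i, Integrable (fun s : ℝ => Real.exp (-w i * s)) (volume.restrict (Ioi 0)) :=
    fun i => integrableOn_exp_mul_Ioi (neg_lt_zero.2 (hw i)) 0
  simp_rw [hexp]
  rw [hset, volume_pi, Measure.restrict_pi_pi, ← ofReal_integral_eq_lintegral_ofReal
    (Integrable.fintype_prod hint) (Filter.Eventually.of_forall fun t =>
      Finset.prod_nonneg fun i _ => (Real.exp_pos _).le),
    integral_fintype_prod_eq_prod (f := fun i s => Real.exp (-w i * s))]
  congr 1
  refine Finset.prod_congr rfl fun i _ => ?_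
  rw [integral_exp_mul_Ioi (neg_lt_zero.2 (hw i))]
  simp [neg_div_neg_eq]

/-- The open simplicial cone generated by the rows of `M`. -/
def openCone (M : Matrix ι ι ℝ) : Set (ι → ℝ) :=
  (fun t => Matrix.vecMul t M) '' {t | ∀ i, 0 < t i}

theorem isOpen_orthant : IsOpen {t : ι → ℝ | ∀ i, 0 < t i} := by
  have : {t : ι → ℝ | ∀ i, 0 < t i} = Set.univ.pi fun _ => Ioi 0 := by
    ext t; simp
  rw [this]
  exact isOpen_set_pi finite_univ fun _ _ => isOpen_Ioi

theorem hasFDerivAt_vecMul (M : Matrix ι ι ℝ) (t : ι → ℝ) :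
    HasFDerivAt (fun t => Matrix.vecMul t M)
      (LinearMap.toContinuousLinearMap M.vecMulLinear) t :=
  (LinearMap.toContinuousLinearMap M.vecMulLinear).hasFDerivAt

/-- Proper subspaces are Lebesgue null; this discards the walls between cones. -/
theorem ae_ne_zero_of_linearMap (f : (ι → ℝ) →ₗ[ℝ] ℝ) (hf : f ≠ 0) :
    ∀ᵐ v : ι → ℝ, f v ≠ 0 := by
  have h := Measure.addHaar_submodule (volume : Measure (ι → ℝ)) (LinearMap.ker f)
    (by rwa [Ne, LinearMap.ker_eq_top])
  rw [ae_iff]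
  convert h using 2
  ext v
  simp

variable [DecidableEq ι]

theorem vecMul_injective_of_det_ne_zero {M : Matrix ι ι ℝ} (hM : M.det ≠ 0) :
    Function.Injective fun t : ι → ℝ => Matrix.vecMul t M :=
  Matrix.vecMul_injective_of_isUnit ((Matrix.isUnit_iff_isUnit_det M).2 hM.isUnit)

theorem det_vecMulLinear (M : Matrix ι ι ℝ) :
    (LinearMap.toContinuousLinearMap M.vecMulLinear).det = M.det := by
  have : M.vecMulLinear = Matrix.toLin' M.transpose := by
    rw [Matrix.toLin'_apply', Matrix.mulVecLin_transpose]
  rw [ContinuousLinearMap.det, LinearMap.coe_toContinuousLinearMap, this, LinearMap.det_toLin',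
    Matrix.det_transpose]

theorem measurableSet_openCone {M : Matrix ι ι ℝ} (hM : M.det ≠ 0) :
    MeasurableSet (openCone M) :=
  measurable_image_of_fderivWithin isOpen_orthant.measurableSet
    (fun t _ => (hasFDerivAt_vecMul M t).hasFDerivWithinAt)
    (vecMul_injective_of_det_ne_zero hM).injOn

/-- The substitution t ↦ tM has constant Jacobian |det M| and turns the integrand into a product of
one-variable exponentials on the orthant. -/
theorem lintegral_openCone {M : Matrix ι ι ℝ} (hM : M.det ≠ 0) (w : ι → ℝ) (hw : ∀ i, 0 < w i)
    (ψ : (ι → ℝ) → ℝ)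
    (hψ : ∀ t : ι → ℝ, (∀ i, 0 < t i) → ψ (Matrix.vecMul t M) = ∑ i, t i * w i) :
    ∫⁻ v in openCone M, ENNReal.ofReal (Real.exp (-ψ v)) =
      ENNReal.ofReal (|M.det| / ∏ i, w i) := by
  rw [openCone, lintegral_image_eq_lintegral_abs_det_fderiv_mul volume
    isOpen_orthant.measurableSet
    (fun t _ => (hasFDerivAt_vecMul M t).hasFDerivWithinAt)
    (vecMul_injective_of_det_ne_zero hM).injOn]
  simp_rw [det_vecMulLinear]
  rw [lintegral_const_mul' _ _ ENNReal.ofReal_ne_top,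
    setLIntegral_congr_fun isOpen_orthant.measurableSet
      (g := fun t => ENNReal.ofReal (Real.exp (-∑ i, t i * w i)))
      (fun t ht => by simp only; rw [hψ t ht]),
    lintegral_orthant_exp w hw, ← ENNReal.ofReal_mul (abs_nonneg _), Finset.prod_inv_distrib,
    div_eq_mul_inv]

/-- An exponential integral over a region that is, up to a null set, a disjoint union of
open simplicial cones. -/
theorem lintegral_eq_sum_openCone {κ : Type*} (S : Finset κ) (M : κ → Matrix ι ι ℝ)
    (w : κ → ι → ℝ) (ψ : (ι → ℝ) → ℝ) (A : Set (ι → ℝ))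
    (hdet : ∀ k ∈ S, (M k).det ≠ 0) (hw : ∀ k ∈ S, ∀ i, 0 < w k i)
    (hψ : ∀ k ∈ S, ∀ t : ι → ℝ, (∀ i, 0 < t i) → ψ (Matrix.vecMul t (M k)) = ∑ i, t i * w k i)
    (hdisj : ∀ k ∈ S, ∀ k' ∈ S, ∀ v ∈ openCone (M k), v ∈ openCone (M k') → k = k')
    (hcover : ∀ᵐ v, v ∈ A ↔ ∃ k ∈ S, v ∈ openCone (M k)) :
    ∫⁻ v in A, ENNReal.ofReal (Real.exp (-ψ v)) =
      ENNReal.ofReal (∑ k ∈ S, |(M k).det| / ∏ i, w k i) := by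
  have hA : A =ᵐ[volume] ⋃ k ∈ S, openCone (M k) := by
    filter_upwards [hcover] with v hv
    apply propext
    change v ∈ A ↔ v ∈ ⋃ k ∈ S, openCone (M k)
    simpa using hv
  rw [setLIntegral_congr hA, lintegral_biUnion_finset
    (fun k hk k' hk' hne => Set.disjoint_left.2 fun v hv hv' =>
      hne (hdisj k hk k' hk' v hv hv'))
    (fun k hk => measurableSet_openCone (hdet k hk)),
    ENNReal.ofReal_sum_of_nonneg fun k hk =>
      div_nonneg (abs_nonneg _) (Finset.prod_nonneg fun i _ => (hw k hk i).le)]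
  exact Finset.sum_congr rfl fun k hk =>
    lintegral_openCone (hdet k hk) (w k) (hw k hk) ψ (hψ k hk)

end ConeIntegral

/-! ### Minima over intervals -/

section IntervalMin

variable {n : ℕ}

/-- The minimum of `v` over the interval `p`. -/
def intervalMin (p : IntervalIdx n) (v : Fin n → ℝ) : ℝ :=
  (Finset.Icc p.1.1 p.1.2).inf' ⟨p.1.1, Finset.mem_Icc.2 ⟨le_rfl, p.2⟩⟩ v

theorem intervalMin_le {p : IntervalIdx n} {k : Fin n} (h1 : p.1.1 ≤ k) (h2 : k ≤ p.1.2)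
    (v : Fin n → ℝ) : intervalMin p v ≤ v k :=
  Finset.inf'_le _ (Finset.mem_Icc.2 ⟨h1, h2⟩)

theorem le_intervalMin {p : IntervalIdx n} {v : Fin n → ℝ} {c : ℝ}
    (h : ∀ k, p.1.1 ≤ k → k ≤ p.1.2 → c ≤ v k) : c ≤ intervalMin p v :=
  Finset.le_inf' _ _ fun k hk => h k (Finset.mem_Icc.1 hk).1 (Finset.mem_Icc.1 hk).2

theorem exists_intervalMin_eq (p : IntervalIdx n) (v : Fin n → ℝ) :
    ∃ k, p.1.1 ≤ k ∧ k ≤ p.1.2 ∧ intervalMin p v = v k := by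
  obtain ⟨k, hk, h⟩ := Finset.exists_mem_eq_inf' (s := Finset.Icc p.1.1 p.1.2)
    ⟨p.1.1, Finset.mem_Icc.2 ⟨le_rfl, p.2⟩⟩ v
  exact ⟨k, (Finset.mem_Icc.1 hk).1, (Finset.mem_Icc.1 hk).2, h⟩

theorem intervalMin_add_const (p : IntervalIdx n) (v : Fin n → ℝ) (c : ℝ) :
    intervalMin p (fun k => v k + c) = intervalMin p v + c := by
  apply le_antisymm
  · obtain ⟨k, h1, h2, h3⟩ := exists_intervalMin_eq p v
    rw [h3]
    exact intervalMin_le h1 h2 _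
  · exact le_intervalMin fun k h1 h2 => by gcongr; exact intervalMin_le h1 h2 v

theorem intervalMin_smul (p : IntervalIdx n) (v : Fin n → ℝ) {c : ℝ} (hc : 0 ≤ c) :
    intervalMin p (c • v) = c * intervalMin p v := by
  apply le_antisymm
  · obtain ⟨k, h1, h2, h3⟩ := exists_intervalMin_eq p v
    rw [h3]
    exact intervalMin_le h1 h2 _
  · exact le_intervalMin fun k h1 h2 => mul_le_mul_of_nonneg_left (intervalMin_le h1 h2 v) hc

/-- Concavity of the interval minima. Equality after summation over `p` will force equality for each
`p`. -/
theorem sum_intervalMin_le {κ : Type*} (S : Finset κ) (p : IntervalIdx n) (a : κ → ℝ)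
    (ha : ∀ i ∈ S, 0 ≤ a i) (u : κ → Fin n → ℝ) :
    ∑ i ∈ S, a i * intervalMin p (u i) ≤ intervalMin p (∑ i ∈ S, a i • u i) := by
  refine le_intervalMin fun k h1 h2 => ?_
  rw [Finset.sum_apply]
  exact Finset.sum_le_sum fun i hi => mul_le_mul_of_nonneg_left (intervalMin_le h1 h2 _) (ha i hi)

theorem continuous_intervalMin (p : IntervalIdx n) : Continuous (intervalMin p) := by
  unfold intervalMin
  exact Continuous.finset_inf'_apply _ fun i _ => continuous_apply i

theorem supportFn_lodaySimplex (p : IntervalIdx n) (v : Fin n → ℝ) :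
    supportFn (lodaySimplex n p) v = -intervalMin p v := by
  unfold supportFn
  congr 1
  apply IsLeast.csInf_eq
  constructor
  · obtain ⟨k, h1, h2, h3⟩ := exists_intervalMin_eq p v
    refine ⟨Pi.single k 1, subset_convexHull ℝ _ ⟨k, ⟨h1, h2⟩, rfl⟩, ?_⟩
    simp [h3]
  · rintro _ ⟨y, hy, rfl⟩
    have hconv : Convex ℝ {y : Fin n → ℝ | intervalMin p v ≤ dotProduct v y} := by
      have : {y : Fin n → ℝ | intervalMin p v ≤ dotProduct v y} =
          (dotProductBilin ℝ ℝ v : (Fin n → ℝ) →ₗ[ℝ] ℝ) ⁻¹' Set.Ici (intervalMin p v) := rfl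
      rw [this]
      exact (convex_Ici _).linear_preimage _
    refine convexHull_min ?_ hconv hy
    rintro _ ⟨k, hk, rfl⟩
    simpa using intervalMin_le hk.1 hk.2 v

/-- The sum of all interval minima, `- h_P` for the Minkowski sum `P` of all simplices. -/
def totalMin (v : Fin n → ℝ) : ℝ := ∑ p, intervalMin p v

theorem continuous_totalMin : Continuous (totalMin (n := n)) :=
  continuous_finsetSum _ fun p _ => continuous_intervalMin p

theorem totalMin_add_const (v : Fin n → ℝ) (c : ℝ) :
    totalMin (fun k => v k + c) = totalMin v + Fintype.card (IntervalIdx n) * c := by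
  simp [totalMin, intervalMin_add_const, Finset.sum_add_distrib]

theorem mixedSupport_eq {K : Type*} [Field K] [Algebra ℝ K] (x : IntervalIdx n → K)
    (v : Fin n → ℝ) :
    mixedSupport (lodaySimplex n) x 0 v = -∑ p, x p * algebraMap ℝ K (intervalMin p v) := by
  simp [mixedSupport, supportFn_lodaySimplex]

/-- `totalMin v` is the minimum of ⟨v, ·⟩ on the Minkowski sum: it is a lower bound summand by
summand, and a minimizing vertex chosen in each simplex attains it. -/
theorem mem_dualCone_iff (v : Fin n → ℝ) :
    v ∈ dualCone (coneOver (∑ p, lodaySimplex n p)) ↔ 0 ≤ totalMin v := by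
  have hmin : ∀ p, ∀ y ∈ lodaySimplex n p, intervalMin p v ≤ dotProduct v y := by
    intro p y hy
    have h := supportFn_lodaySimplex p v
    unfold supportFn at h
    rw [← neg_inj.1 h]
    refine csInf_le ?_ ⟨y, hy, rfl⟩
    have hc : IsCompact (lodaySimplex n p) :=
      (Set.toFinite _).isCompact_convexHull ℝ
    exact (hc.image (show Continuous fun y => dotProduct v y by fun_prop)).bddBelow
  constructor
  · intro h
    choose k h1 h2 h3 using fun p => exists_intervalMin_eq p v
    have := h (∑ p, Pi.single (k p) 1) ⟨_, Set.finsetSum_mem_finsetSum _ _ _ fun p _ =>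
      subset_convexHull ℝ _ ⟨k p, ⟨h1 p, h2 p⟩, rfl⟩, 1, zero_le_one, (one_smul _ _).symm⟩
    rw [dotProduct_sum] at this
    simpa [totalMin, h3] using this
  · rintro h _ ⟨y, hy, t, ht, rfl⟩
    rw [Set.mem_fintype_sum] at hy
    obtain ⟨g, hg, rfl⟩ := hy
    rw [dotProduct_smul, dotProduct_sum]
    exact mul_nonneg ht (h.trans (Finset.sum_le_sum fun p _ => hmin p _ (hg p)))

theorem card_intervalIdx_pos (hn : 1 ≤ n) : (0 : ℝ) < Fintype.card (IntervalIdx n) := by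
  have : Nonempty (IntervalIdx n) := ⟨⟨(⟨0, hn⟩, ⟨0, hn⟩), le_rfl⟩⟩
  exact_mod_cast Fintype.card_pos

/-- Since `totalMin` strictly increases along 𝟏, a zero has arbitrarily close points with negative
value and is not interior. The other inclusion is continuity. -/
theorem frontier_dualCone (hn : 1 ≤ n) :
    frontier (dualCone (coneOver (∑ p, lodaySimplex n p))) = {v | totalMin v = 0} := by
  have h : dualCone (coneOver (∑ p, lodaySimplex n p)) = {v | 0 ≤ totalMin v} := by
    ext v; exact mem_dualCone_iff v
  rw [h]
  apply subset_antisymm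
  · intro v hv
    exact (frontier_le_subset_eq continuous_const continuous_totalMin hv).symm
  · intro v hv
    have hv : totalMin v = 0 := hv
    refine ⟨subset_closure hv.ge, fun hint => ?_⟩
    have hc : Continuous fun c : ℝ => fun k => v k + c := by fun_prop
    have hmem : (fun c : ℝ => fun k => v k + c) ⁻¹' (interior {v | 0 ≤ totalMin v}) ∈ nhds 0 := by
      refine hc.continuousAt.preimage_mem_nhds (isOpen_interior.mem_nhds ?_)
      simpa using hint
    obtain ⟨ε, hε, hball⟩ := Metric.mem_nhds_iff.1 hmem
    have h2 := interior_subset (hball (show -(ε / 2) ∈ Metric.ball (0 : ℝ) ε by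
      rw [Metric.mem_ball, dist_zero_right, norm_neg, Real.norm_of_nonneg (by positivity)]
      linarith))
    have h3 : 0 ≤ totalMin fun k => v k + -(ε / 2) := h2
    rw [totalMin_add_const, hv] at h3
    have := card_intervalIdx_pos hn
    nlinarith

/-- The indicator function of the interval `[α, β)`. -/
def ivl (n α β : ℕ) : Fin n → ℝ := fun j => if α ≤ (j : ℕ) ∧ (j : ℕ) < β then 1 else 0

/-- The vector `ivl n α β`, shifted into the zero set of `totalMin`. -/
def ray (n α β : ℕ) : Fin n → ℝ :=
  fun j => ivl n α β j + -(totalMin (ivl n α β) / Fintype.card (IntervalIdx n))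

theorem intervalMin_ivl (p : IntervalIdx n) (α β : ℕ) :
    intervalMin p (ivl n α β) = if (p.1.1 : ℕ) ∈ Finset.Ico α β ∧ (p.1.2 : ℕ) ∈ Finset.Ico α β
      then 1 else 0 := by
  have hp : (p.1.1 : ℕ) ≤ p.1.2 := p.2
  simp only [Finset.mem_Ico]
  split_ifs with h
  · obtain ⟨k, h1, h2, h3⟩ := exists_intervalMin_eq p (ivl n α β)
    have h1' : (p.1.1 : ℕ) ≤ k := h1
    have h2' : (k : ℕ) ≤ p.1.2 := h2
    rw [h3, ivl, if_pos (by omega)]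
  · apply le_antisymm
    · by_cases h' : α ≤ (p.1.1 : ℕ) ∧ (p.1.1 : ℕ) < β
      · refine (intervalMin_le p.2 le_rfl _).trans ?_
        rw [ivl, if_neg (by omega)]
      · refine (intervalMin_le le_rfl p.2 _).trans ?_
        rw [ivl, if_neg h']
    · exact le_intervalMin fun k _ _ => by unfold ivl; split_ifs <;> norm_num

theorem intervalMin_ray (p : IntervalIdx n) (α β : ℕ) :
    intervalMin p (ray n α β) = intervalMin p (ivl n α β) +
      -(totalMin (ivl n α β) / Fintype.card (IntervalIdx n)) :=
  intervalMin_add_const p _ _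

theorem totalMin_ray (hn : 1 ≤ n) (α β : ℕ) : totalMin (ray n α β) = 0 := by
  unfold ray
  rw [totalMin_add_const]
  field_simp [(card_intervalIdx_pos hn).ne']
  ring

/-- The shift in `ray` contributes a multiple of ∑ x = 0, and the indicator has minimum 1 exactly
over the intervals inside its support. Here the denominators of the dual mixed volume become those
of the tree sum. -/
theorem sum_mul_intervalMin_ray {K : Type*} [Field K] [Algebra ℝ K] (x : IntervalIdx n → K)
    (hx : ∑ p, x p = 0) (α β : ℕ) :
    ∑ p, x p * algebraMap ℝ K (intervalMin p (ray n α β)) = pairSum x (Finset.Ico α β) := by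
  simp only [intervalMin_ray, map_add, mul_add, Finset.sum_add_distrib, ← Finset.sum_mul, hx,
    zero_mul, add_zero, pairSum, intervalMin_ivl, Finset.sum_filter]
  refine Finset.sum_congr rfl fun p _ => ?_
  split_ifs <;> simp

theorem totalMin_const (c : ℝ) :
    totalMin (fun _ : Fin n => c) = Fintype.card (IntervalIdx n) * c := by
  have h := totalMin_add_const (0 : Fin n → ℝ) c
  have h0 : totalMin (0 : Fin n → ℝ) = 0 := by
    refine Finset.sum_eq_zero fun p _ => ?_
    obtain ⟨k, -, -, h3⟩ := exists_intervalMin_eq p (0 : Fin n → ℝ)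
    simpa using h3
  simpa [h0] using h

theorem intervalMin_const (p : IntervalIdx n) (c : ℝ) : intervalMin p (fun _ : Fin n => c) = c := by
  obtain ⟨k, -, -, h3⟩ := exists_intervalMin_eq p (fun _ : Fin n => c)
  exact h3

end IntervalMin

/-! ### The chambers of plane binary trees -/

section Chamber

variable {n : ℕ}

/-- Extension by zero of a vector to the natural numbers. -/
def natExtend (v : Fin n → ℝ) (k : ℕ) : ℝ := if h : k < n then v ⟨k, h⟩ else 0

@[simp] theorem natExtend_val (v : Fin n → ℝ) (k : Fin n) : natExtend v k = v k := by
  simp [natExtend]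

/-- The normal cone of the associahedron at the vertex of the tree `B`. -/
def chamber (n : ℕ) (B : BinaryTree Unit) : Set (Fin n → ℝ) :=
  {v | ∀ k j : Fin n, IsBelow B 0 j k → v k ≤ v j}

/-- The interior of `chamber n B`. -/
def openChamber (n : ℕ) (B : BinaryTree Unit) : Set (Fin n → ℝ) :=
  {v | ∀ k j : Fin n, IsBelow B 0 j k → j ≠ k → v k < v j}

theorem exists_mem_chamber (v : Fin n → ℝ) :
    ∃ B ∈ BinaryTree.treesOfNumNodesEq n, v ∈ chamber n B := by
  obtain ⟨B, hB, h⟩ := exists_monoOn n 0 (natExtend v)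
  refine ⟨B, BinaryTree.mem_treesOfNumNodesEq.2 hB, fun k j hb => ?_⟩
  simpa using h k j (Nat.zero_le _) (by omega) hb

theorem openChamber_unique {B B' : BinaryTree Unit} (hB : B.numNodes = n)
    (hB' : B'.numNodes = n) {v : Fin n → ℝ} (h : v ∈ openChamber n B)
    (h' : v ∈ openChamber n B') : B = B' := by
  have key : ∀ B : BinaryTree Unit, B.numNodes = n → v ∈ openChamber n B →
      StrictOn B 0 (natExtend v) := by
    intro B hB h k j h1 h2 hb hne
    have hj := hb.mem_range h1 h2
    have := h ⟨k, by omega⟩ ⟨j, by omega⟩ hb (by simpa [Fin.ext_iff] using hne)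
    have e1 := natExtend_val v ⟨k, by omega⟩
    have e2 := natExtend_val v ⟨j, by omega⟩
    simp only at e1 e2
    rwa [e1, e2]
  exact StrictOn.unique (hB.trans hB'.symm) (key B hB h) (key B' hB' h')

/-- The lowest common ancestor of the two ends lies in the interval and above all of it. It depends
on `B` only, so the minimum is a fixed coordinate on the whole chamber. -/
theorem intervalMin_eq_on_chamber {B : BinaryTree Unit} (hB : B.numNodes = n) (p : IntervalIdx n) :
    ∃ k : Fin n, IsBelow B 0 p.1.1 k ∧ IsBelow B 0 p.1.2 k ∧
      ∀ v ∈ chamber n B, intervalMin p v = v k := by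
  have hp : (p.1.1 : ℕ) ≤ p.1.2 := p.2
  obtain ⟨k, h1, h2, h3, h4⟩ := exists_isBelow_interval (B := B) (Nat.zero_le p.1.1) hp
    (by omega)
  refine ⟨⟨k, by omega⟩, h3, h4, fun v hv => le_antisymm (intervalMin_le h1 h2 v) ?_⟩
  exact le_intervalMin fun j hj1 hj2 => hv ⟨k, by omega⟩ j (h3.between h4 hj1 hj2)

theorem intervalMin_sum_of_mem_chamber {B : BinaryTree Unit} (hB : B.numNodes = n) {κ : Type*}
    (S : Finset κ) (t : κ → ℝ) (u : κ → Fin n → ℝ) (hu : ∀ i ∈ S, u i ∈ chamber n B)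
    (hv : ∑ i ∈ S, t i • u i ∈ chamber n B) (p : IntervalIdx n) :
    intervalMin p (∑ i ∈ S, t i • u i) = ∑ i ∈ S, t i * intervalMin p (u i) := by
  obtain ⟨k, -, -, h⟩ := intervalMin_eq_on_chamber hB p
  rw [h _ hv, Finset.sum_apply]
  exact Finset.sum_congr rfl fun i hi => by rw [h _ (hu i hi), Pi.smul_apply, smul_eq_mul]

/-- A descendant of a descendant of `k` is again one, so the indicator of the descendants of `k` can
only grow downwards. -/
theorem ray_mem_chamber {B : BinaryTree Unit} (hB : B.numNodes = n) (k : Fin n) :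
    ray n (lowEnd B 0 k) (highEnd B 0 k) ∈ chamber n B := by
  intro i j hb
  unfold ray
  gcongr
  have hij : IsBelow B 0 i k → IsBelow B 0 j k := fun h =>
    hb.trans (Nat.zero_le _) (by omega) h
  unfold IsBelow at hij
  unfold ivl
  split_ifs <;> first | exact absurd (hij ‹_›) ‹_› | norm_num

theorem const_mem_chamber (B : BinaryTree Unit) (c : ℝ) : (fun _ => c) ∈ chamber n B :=
  fun _ _ _ => le_rfl

theorem mem_openChamber_of_injective {B : BinaryTree Unit} {v : Fin n → ℝ}
    (hv : v ∈ chamber n B) (hinj : Function.Injective v) : v ∈ openChamber n B :=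
  fun k j hb hne => lt_of_le_of_ne (hv k j hb) fun h => hne (hinj h.symm)

end Chamber

/-! ### Generators of the chambers -/

section ChamberMatrix

variable {m : ℕ} {B : BinaryTree Unit}

/-- The label of the root, as an element of `Fin (m + 1)`. -/
def rootFin (m : ℕ) (B : BinaryTree Unit) : Fin (m + 1) := Fin.ofNat (m + 1) (rootLabel B 0)

theorem rootFin_val (hB : B.numNodes = m + 1) : (rootFin m B : ℕ) = rootLabel B 0 := by
  have := rootLabel_mem (B := B) (a := 0) (by omega)
  simp only [rootFin, Fin.ofNat]
  exact Nat.mod_eq_of_lt (by omega)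

/-- The generators of the cone `chamber n B ∩ {v | 0 ≤ totalMin v}`: the vector `(1, …, 1)` at the
root, and a ray of the normal fan at every other node. -/
def chamberRow (m : ℕ) (B : BinaryTree Unit) (k : Fin (m + 1)) : Fin (m + 1) → ℝ :=
  if k = rootFin m B then fun _ => 1 else ray (m + 1) (lowEnd B 0 k) (highEnd B 0 k)

/-- The matrix with rows `chamberRow m B`. -/
def chamberMatrix (m : ℕ) (B : BinaryTree Unit) : Matrix (Fin (m + 1)) (Fin (m + 1)) ℝ :=
  Matrix.of (chamberRow m B)

theorem isBelow_rootFin (hB : B.numNodes = m + 1) (j : Fin (m + 1)) :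
    IsBelow B 0 j (rootFin m B) := by
  rw [rootFin_val hB]
  exact isBelow_rootLabel (Nat.zero_le _) (by omega)

theorem isBelow_fin_antisymm (hB : B.numNodes = m + 1) {j k : Fin (m + 1)}
    (h : IsBelow B 0 j k) (h' : IsBelow B 0 k j) : j = k :=
  Fin.ext (h.antisymm (Nat.zero_le _) (by omega) h')

/-- Sorting the nodes by decreasing size of the descendant interval makes the matrix block
triangular. Nested intervals of equal size belong to the same node, so the diagonal blocks are
identities. -/
theorem det_isBelow (hB : B.numNodes = m + 1) :
    (Matrix.of fun k j : Fin (m + 1) => if IsBelow B 0 j k then (1 : ℝ) else 0).det = 1 := by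
  set M : Matrix (Fin (m + 1)) (Fin (m + 1)) ℝ :=
    Matrix.of fun k j => if IsBelow B 0 j k then (1 : ℝ) else 0 with hM
  let b : Fin (m + 1) → ℕ := fun k => (m + 1) - (highEnd B 0 k - lowEnd B 0 k)
  have hends : ∀ k : Fin (m + 1), lowEnd B 0 k ≤ k ∧ (k : ℕ) < highEnd B 0 k ∧
      highEnd B 0 k ≤ m + 1 := fun k => by
    have := ends_bounds (B := B) (Nat.zero_le (k : ℕ)) (by omega)
    omega
  have hle : ∀ i j : Fin (m + 1), IsBelow B 0 j i →
      lowEnd B 0 i ≤ lowEnd B 0 j ∧ highEnd B 0 j ≤ highEnd B 0 i := fun i j h =>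
    h.ends_le (Nat.zero_le _) (by omega)
  have htri : M.BlockTriangular b := by
    intro i j hij
    simp only [hM, Matrix.of_apply]
    refine if_neg fun h => ?_
    have := hle i j h
    have := hends i
    have := hends j
    simp only [b] at hij
    omega
  rw [htri.det]
  refine Finset.prod_eq_one fun a _ => ?_
  suffices h1 : M.toSquareBlock b a = 1 by rw [h1, Matrix.det_one]
  ext ⟨i, hi⟩ ⟨j, hj⟩
  simp only [hM, Matrix.toSquareBlock_def, Matrix.of_apply, Matrix.one_apply, Subtype.mk.injEq]
  refine if_congr ⟨fun h => ?_, ?_⟩ rfl rfl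
  · refine (isBelow_fin_antisymm hB h ?_).symm
    have := hle i j h
    have := hends i
    have := hends j
    simp only [b] at hi hj
    unfold IsBelow
    omega
  · rintro rfl
    exact isBelow_self (Nat.zero_le _) (by omega)

theorem ray_ends_apply (k j : Fin (m + 1)) :
    ray (m + 1) (lowEnd B 0 k) (highEnd B 0 k) j = (if IsBelow B 0 j k then 1 else 0) +
      -(totalMin (ivl (m + 1) (lowEnd B 0 k) (highEnd B 0 k)) /
        Fintype.card (IntervalIdx (m + 1))) := by
  rfl

/-- The shifts are multiples of 𝟏, which is the row of the root in both matrices, so they are row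
operations. -/
theorem det_chamberMatrix (hB : B.numNodes = m + 1) : (chamberMatrix m B).det = 1 := by
  rw [← det_isBelow hB]
  refine Matrix.det_eq_of_forall_row_eq_smul_add_const
    (fun k => if k = rootFin m B then 0 else
      -(totalMin (ivl (m + 1) (lowEnd B 0 k) (highEnd B 0 k)) /
        Fintype.card (IntervalIdx (m + 1)))) (rootFin m B) (if_pos rfl) fun i j => ?_
  simp only [chamberMatrix, Matrix.of_apply, chamberRow, if_pos (isBelow_rootFin hB j)]
  split_ifs with h h' h'
  · simp
  · subst h
    exact absurd (isBelow_rootFin hB j) h'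
  · rw [ray_ends_apply, if_pos h', mul_one]
  · rw [ray_ends_apply, if_neg h', mul_one]

theorem chamberRow_mem (hB : B.numNodes = m + 1) (k : Fin (m + 1)) :
    chamberRow m B k ∈ chamber (m + 1) B := by
  unfold chamberRow
  split_ifs
  · exact const_mem_chamber B 1
  · exact ray_mem_chamber hB k

theorem totalMin_chamberRow (k : Fin (m + 1)) : totalMin (chamberRow m B k) =
    if k = rootFin m B then (Fintype.card (IntervalIdx (m + 1)) : ℝ) else 0 := by
  unfold chamberRow
  split_ifs
  · rw [totalMin_const, mul_one]
  · exact totalMin_ray (by omega) _ _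

theorem intervalMin_combination (hB : B.numNodes = m + 1) {t : Fin (m + 1) → ℝ}
    (hv : ∑ k, t k • chamberRow m B k ∈ chamber (m + 1) B) (p : IntervalIdx (m + 1)) :
    intervalMin p (∑ k, t k • chamberRow m B k) =
      ∑ k, t k * intervalMin p (chamberRow m B k) :=
  intervalMin_sum_of_mem_chamber hB _ _ _ (fun k _ => chamberRow_mem hB k) hv p

/-- `totalMin` is linear on the chamber and vanishes at all generators but 𝟏, so it reads off the
coefficient of the root. -/
theorem totalMin_combination (hB : B.numNodes = m + 1) {t : Fin (m + 1) → ℝ}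
    (hv : ∑ k, t k • chamberRow m B k ∈ chamber (m + 1) B) :
    totalMin (∑ k, t k • chamberRow m B k) =
      t (rootFin m B) * Fintype.card (IntervalIdx (m + 1)) := by
  simp only [totalMin, intervalMin_combination hB hv]
  rw [Finset.sum_comm]
  simp only [← Finset.mul_sum]
  have := fun k : Fin (m + 1) => totalMin_chamberRow (B := B) k
  simp only [totalMin] at this
  simp [this]

/-- The expansion of a vector in the generators of the cone of `B`. -/
theorem exists_combination (hB : B.numNodes = m + 1) (v : Fin (m + 1) → ℝ) :
    ∃ t : Fin (m + 1) → ℝ, v = ∑ k, t k • chamberRow m B k ∧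
      ∀ k, k ≠ rootFin m B → ∃ k' : Fin (m + 1), IsBelow B 0 k k' ∧ k ≠ k' ∧ t k = v k - v k' := by
  obtain ⟨s, hs1, hs2⟩ := exists_coeff B 0 (natExtend v) 0
  simp only [Nat.zero_le, true_imp_iff, zero_add, true_and, hB, ← Finset.range_eq_Ico] at hs1 hs2
  let c : Fin (m + 1) → ℝ := fun k =>
    if k = rootFin m B then 0 else
      totalMin (ivl (m + 1) (lowEnd B 0 k) (highEnd B 0 k)) /
        Fintype.card (IntervalIdx (m + 1))
  -- Replacing indicators by rays subtracts constants; the coefficient of the row 𝟏 at the root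
  -- absorbs their total.
  let t : Fin (m + 1) → ℝ := fun k => if k = rootFin m B then s k + ∑ k' : Fin (m + 1), s k' * c k' else s k
  refine ⟨t, ?_, fun k hk => ?_⟩
  · funext j
    have h1 := hs2 j j.2
    rw [natExtend_val, Finset.sum_range] at h1
    have h2 : ∀ k, (t k • chamberRow m B k) j = (if IsBelow B 0 j k then s k else 0) - s k * c k +
        if k = rootFin m B then ∑ k' : Fin (m + 1), s k' * c k' else 0 := by
      intro k
      simp only [t, c, chamberRow, Pi.smul_apply, smul_eq_mul]
      split_ifs with h h' h'
      · simp
      · subst h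
        exact absurd (isBelow_rootFin hB j) h'
      · rw [ray_ends_apply, if_pos (by assumption)]; ring
      · rw [ray_ends_apply, if_neg (by assumption)]; ring
    rw [h1, Finset.sum_apply, Finset.sum_congr rfl fun k _ => h2 k]
    simp [Finset.sum_add_distrib, Finset.sum_sub_distrib]
  · have hk' : (k : ℕ) ≠ rootLabel B 0 := by
      rw [← rootFin_val hB]
      exact fun h => hk (Fin.ext h)
    rcases hs1 k k.2 with ⟨h, -⟩ | ⟨k', h1, h2, h3, h4⟩
    · exact absurd h hk'
    · refine ⟨⟨k', h1⟩, h2, fun h => h3 (by rw [h]), ?_⟩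
      simp only [t, if_neg hk, h4, natExtend_val]
      rw [← natExtend_val v ⟨k', h1⟩]

theorem combination_mem_openChamber (hB : B.numNodes = m + 1) {t : Fin (m + 1) → ℝ}
    (ht : ∀ k, k ≠ rootFin m B → 0 < t k) :
    ∑ k, t k • chamberRow m B k ∈ openChamber (m + 1) B := by
  intro k j hb hne
  rw [Finset.sum_apply, Finset.sum_apply]
  have hj : j ≠ rootFin m B := by
    rintro rfl
    exact hne (isBelow_fin_antisymm hB hb (isBelow_rootFin hB k))
  -- The strict term is the ray of `j`, which separates `j` from its proper ancestor `k`.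
  refine Finset.sum_lt_sum (fun i _ => ?_) ⟨j, Finset.mem_univ _, ?_⟩
  · by_cases hi : i = rootFin m B
    · simp [chamberRow, hi]
    · exact mul_le_mul_of_nonneg_left (chamberRow_mem hB i k j hb) (ht i hi).le
  · refine mul_lt_mul_of_pos_left ?_ (ht j hj)
    have h1 : IsBelow B 0 j j := isBelow_self (Nat.zero_le _) (by omega)
    have h2 : ¬ IsBelow B 0 k j := fun h => hne (isBelow_fin_antisymm hB hb h)
    simp only [chamberRow, if_neg hj, ray, ivl]
    unfold IsBelow at h1 h2
    rw [if_pos h1, if_neg h2]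
    linarith

theorem combination_mem_chamber (hB : B.numNodes = m + 1) {t : Fin (m + 1) → ℝ}
    (ht : ∀ k, k ≠ rootFin m B → 0 ≤ t k) :
    ∑ k, t k • chamberRow m B k ∈ chamber (m + 1) B := by
  intro k j hb
  rw [Finset.sum_apply, Finset.sum_apply]
  refine Finset.sum_le_sum fun i _ => ?_
  by_cases hi : i = rootFin m B
  · simp [chamberRow, hi]
  · exact mul_le_mul_of_nonneg_left (chamberRow_mem hB i k j hb) (ht i hi)

theorem exists_combination_of_mem_chamber (hB : B.numNodes = m + 1) {v : Fin (m + 1) → ℝ}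
    (hv : v ∈ chamber (m + 1) B) :
    ∃ t : Fin (m + 1) → ℝ, v = ∑ k, t k • chamberRow m B k ∧
      (∀ k, k ≠ rootFin m B → 0 ≤ t k) ∧
      t (rootFin m B) = totalMin v / Fintype.card (IntervalIdx (m + 1)) := by
  obtain ⟨t, h1, h2⟩ := exists_combination hB v
  refine ⟨t, h1, fun k hk => ?_, ?_⟩
  · obtain ⟨k', h3, -, h4⟩ := h2 k hk
    rw [h4]
    exact sub_nonneg.2 (hv k' k h3)
  · have := card_intervalIdx_pos (n := m + 1) (by omega)
    rw [eq_div_iff this.ne', ← totalMin_combination hB (h1 ▸ hv), ← h1]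

theorem vecMul_chamberMatrix (t : Fin (m + 1) → ℝ) :
    Matrix.vecMul t (chamberMatrix m B) = ∑ k, t k • chamberRow m B k := by
  rw [Matrix.vecMul_eq_sum]; rfl

/-- The coordinates of `v` off the root are differences between the values at a node and at a proper
ancestor, and the root coordinate is `totalMin v` divided by the number of intervals. The two
conditions are the positivity of these coordinates. -/
theorem mem_openCone_chamberMatrix (hB : B.numNodes = m + 1) (v : Fin (m + 1) → ℝ) :
    v ∈ openCone (chamberMatrix m B) ↔ v ∈ openChamber (m + 1) B ∧ 0 < totalMin v := by
  have hN := card_intervalIdx_pos (n := m + 1) (by omega)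
  constructor
  · rintro ⟨t, ht, rfl⟩
    simp only [vecMul_chamberMatrix]
    refine ⟨combination_mem_openChamber hB fun k _ => ht k, ?_⟩
    rw [totalMin_combination hB (combination_mem_chamber hB fun k _ => (ht k).le)]
    exact mul_pos (ht _) hN
  · rintro ⟨h1, h2⟩
    obtain ⟨t, h3, h4⟩ := exists_combination hB v
    have hpos : ∀ k, k ≠ rootFin m B → 0 < t k := fun k hk => by
      obtain ⟨k', h5, h6, h7⟩ := h4 k hk
      rw [h7]
      exact sub_pos.2 (h1 k' k h5 h6)
    refine ⟨t, fun k => ?_, by simp only [vecMul_chamberMatrix, h3.symm]⟩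
    by_cases hk : k = rootFin m B
    · rw [hk]
      rw [h3, totalMin_combination hB
        (combination_mem_chamber hB fun k hk => (hpos k hk).le)] at h2
      exact pos_of_mul_pos_left h2 hN.le
    · exact hpos k hk

end ChamberMatrix

/-! ### The triangulation by the chambers -/

theorem mem_posSpan_range {d r : ℕ} {F : Fin r → Fin d → ℝ} {v : Fin d → ℝ} :
    v ∈ posSpan (Set.range F) ↔ ∃ a : Fin r → ℝ, (∀ i, 0 ≤ a i) ∧ ∑ i, a i • F i = v := by
  unfold posSpan
  rw [SetLike.mem_coe, Submodule.mem_span_range_iff_exists_fun]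
  constructor
  · rintro ⟨c, rfl⟩
    exact ⟨fun i => c i, fun i => (c i).2, rfl⟩
  · rintro ⟨a, ha, rfl⟩
    exact ⟨fun i => ⟨a i, ha i⟩, rfl⟩

section ChamberTriangulation

variable {m : ℕ} {B B' : BinaryTree Unit}

/-- The rays of the chamber of `B`. -/
def chamberTuple (m : ℕ) (B : BinaryTree Unit) (i : Fin m) : Fin (m + 1) → ℝ :=
  chamberRow m B ((rootFin m B).succAbove i)

theorem sum_chamberTuple (a : Fin m → ℝ) :
    ∑ i, a i • chamberTuple m B i =
      ∑ k, (rootFin m B).insertNth (α := fun _ => ℝ) 0 a k • chamberRow m B k := by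
  rw [Fin.sum_univ_succAbove _ (rootFin m B)]
  simp [chamberTuple]

theorem insertNth_nonneg {r : Fin (m + 1)} {a : Fin m → ℝ} (ha : ∀ i, 0 ≤ a i) (k : Fin (m + 1)) :
    0 ≤ r.insertNth (α := fun _ => ℝ) 0 a k := by
  refine Fin.succAboveCases r ?_ (fun i => ?_) k <;> simp [ha]

theorem sum_chamberTuple_mem (hB : B.numNodes = m + 1) {a : Fin m → ℝ} (ha : ∀ i, 0 ≤ a i) :
    ∑ i, a i • chamberTuple m B i ∈ chamber (m + 1) B := by
  rw [sum_chamberTuple]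
  exact combination_mem_chamber hB fun k _ => insertNth_nonneg ha k

theorem totalMin_sum_chamberTuple (hB : B.numNodes = m + 1) {a : Fin m → ℝ}
    (ha : ∀ i, 0 ≤ a i) : totalMin (∑ i, a i • chamberTuple m B i) = 0 := by
  have h := sum_chamberTuple_mem hB ha
  rw [sum_chamberTuple] at h ⊢
  rw [totalMin_combination hB h]
  simp

theorem mem_posSpan_chamberTuple (hB : B.numNodes = m + 1) {v : Fin (m + 1) → ℝ}
    (hv : v ∈ chamber (m + 1) B) (h0 : totalMin v = 0) :
    v ∈ posSpan (Set.range (chamberTuple m B)) := by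
  obtain ⟨t, h1, h2, h3⟩ := exists_combination_of_mem_chamber hB hv
  refine mem_posSpan_range.2 ⟨fun i => t ((rootFin m B).succAbove i),
    fun i => h2 _ (Fin.succAbove_ne _ _), ?_⟩
  rw [h0, zero_div] at h3
  rw [h1, Fin.sum_univ_succAbove _ (rootFin m B), h3]
  simp [chamberTuple]

theorem linearIndependent_chamberTuple (hB : B.numNodes = m + 1) :
    LinearIndependent ℝ (chamberTuple m B) := by
  have h : LinearIndependent ℝ (chamberMatrix m B).row := by
    rw [Matrix.linearIndependent_rows_iff_isUnit, Matrix.isUnit_iff_isUnit_det,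
      det_chamberMatrix hB]
    exact isUnit_one
  exact h.comp _ Fin.succAbove_right_injective

theorem ends_eq_root (hB : B.numNodes = m + 1) {k : Fin (m + 1)} :
    (lowEnd B 0 k = 0 ∧ highEnd B 0 k = m + 1) ↔ k = rootFin m B := by
  constructor
  · rintro ⟨h1, h2⟩
    refine isBelow_fin_antisymm hB (isBelow_rootFin hB k) ?_
    unfold IsBelow
    omega
  · rintro rfl
    have := ends_rootLabel (B := B) (a := 0)
    rw [rootFin_val hB]
    omega

theorem ends_fin_bounds (hB : B.numNodes = m + 1) (k : Fin (m + 1)) :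
    lowEnd B 0 k ≤ k ∧ (k : ℕ) < highEnd B 0 k ∧ highEnd B 0 k ≤ m + 1 := by
  have := ends_bounds (B := B) (Nat.zero_le (k : ℕ)) (by omega)
  omega

/-- Two chambers that contain a vector have the rays of its expansion in common. -/
theorem exists_same_ends (hB : B.numNodes = m + 1) (hB' : B'.numNodes = m + 1)
    {t : Fin (m + 1) → ℝ} (ht : ∀ k, k ≠ rootFin m B → 0 ≤ t k)
    (hv : ∑ k, t k • chamberRow m B k ∈ chamber (m + 1) B') {k : Fin (m + 1)}
    (hk : k ≠ rootFin m B) (hpos : 0 < t k) :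
    ∃ k' : Fin (m + 1), lowEnd B' 0 k' = lowEnd B 0 k ∧ highEnd B' 0 k' = highEnd B 0 k := by
  have hb := ends_fin_bounds hB k
  have hmem := combination_mem_chamber hB ht
  let p : IntervalIdx (m + 1) := ⟨(⟨lowEnd B 0 k, by omega⟩, ⟨highEnd B 0 k - 1, by omega⟩), by
    rw [Fin.mk_le_mk]; omega⟩
  -- Here `p` is the support of the ray at `k`. Enlarging `p` lowers the minimum of this ray
  -- strictly and raises that of no other generator.
  have key : ∀ q : IntervalIdx (m + 1), q.1.1 ≤ p.1.1 → p.1.2 ≤ q.1.2 → q ≠ p →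
      intervalMin q (∑ k, t k • chamberRow m B k) <
        intervalMin p (∑ k, t k • chamberRow m B k) := by
    intro q h1 h2 hne
    have hle : ∀ u : Fin (m + 1) → ℝ, intervalMin q u ≤ intervalMin p u := fun u =>
      le_intervalMin fun j hj1 hj2 => intervalMin_le (h1.trans hj1) (hj2.trans h2) u
    rw [intervalMin_combination hB hmem, intervalMin_combination hB hmem]
    refine Finset.sum_lt_sum (fun i _ => ?_) ⟨k, Finset.mem_univ _, ?_⟩
    · by_cases hi : i = rootFin m B
      · simp [chamberRow, hi, intervalMin_const]
      · exact mul_le_mul_of_nonneg_left (hle _) (ht i hi)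
    · refine mul_lt_mul_of_pos_left ?_ hpos
      simp only [chamberRow, if_neg hk, intervalMin_ray, intervalMin_ivl,
        Finset.mem_Ico]
      have h1' : (q.1.1 : ℕ) ≤ lowEnd B 0 k := h1
      have h2' : highEnd B 0 k - 1 ≤ (q.1.2 : ℕ) := h2
      have hne' : ¬ ((q.1.1 : ℕ) = lowEnd B 0 k ∧ (q.1.2 : ℕ) = highEnd B 0 k - 1) := fun h =>
        hne (Subtype.ext (Prod.ext (Fin.ext h.1) (Fin.ext h.2)))
      have hp1 : (p.1.1 : ℕ) = lowEnd B 0 k := rfl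
      have hp2 : (p.1.2 : ℕ) = highEnd B 0 k - 1 := rfl
      rw [if_neg (by omega), if_pos (by omega)]
      linarith
  -- In the second chamber the minimum over `p` is attained at a node `k'` whose descendant interval
  -- `q` contains `p`. All values on `q` are at least that at `k'`, so enlarging `p` to `q` does not
  -- lower the minimum, which forces `q = p`.
  obtain ⟨k', h1, h2, h3⟩ := intervalMin_eq_on_chamber hB' p
  have hb' := ends_fin_bounds hB' k'
  let q : IntervalIdx (m + 1) :=
    ⟨(⟨lowEnd B' 0 k', by omega⟩, ⟨highEnd B' 0 k' - 1, by omega⟩), by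
      rw [Fin.mk_le_mk]; omega⟩
  have hqp : q = p := by
    by_contra hne
    have h2' : ((p.1.2 : Fin (m + 1)) : ℕ) < highEnd B' 0 k' := h2.2
    refine absurd (key q h1.1 (Nat.le_sub_one_of_lt h2') hne) (not_lt.2 ?_)
    rw [h3 _ hv]
    refine le_intervalMin fun j hj1 hj2 => hv k' j ⟨hj1, ?_⟩
    have : (j : ℕ) ≤ highEnd B' 0 k' - 1 := hj2
    omega
  have e1 : lowEnd B' 0 k' = lowEnd B 0 k := congrArg (fun q => (q.1.1 : ℕ)) hqp
  have e2 : highEnd B' 0 k' - 1 = highEnd B 0 k - 1 := congrArg (fun q => (q.1.2 : ℕ)) hqp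
  exact ⟨k', e1, by omega⟩

/-- Every ray with a positive coefficient in the expansion over `B` is also a ray of `B'`, by
`exists_same_ends`; the remaining terms vanish. -/
theorem posSpan_inter_le (hB : B.numNodes = m + 1) (hB' : B'.numNodes = m + 1) :
    posSpan (Set.range (chamberTuple m B)) ∩ posSpan (Set.range (chamberTuple m B')) ⊆
      posSpan (Set.range (chamberTuple m B) ∩ Set.range (chamberTuple m B')) := by
  rintro v ⟨h1, h2⟩
  obtain ⟨a, ha, rfl⟩ := mem_posSpan_range.1 h1
  obtain ⟨a', ha', h3⟩ := mem_posSpan_range.1 h2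
  have hv := sum_chamberTuple_mem hB' ha'
  rw [h3, sum_chamberTuple] at hv
  refine Submodule.sum_mem _ fun i _ => ?_
  rcases (ha i).eq_or_lt with h0 | h0
  · rw [← h0, zero_smul]
    exact Submodule.zero_mem _
  have hi : (rootFin m B).succAbove i ≠ rootFin m B := Fin.succAbove_ne _ _
  obtain ⟨k', e1, e2⟩ := exists_same_ends hB hB' (fun k _ => insertNth_nonneg ha k) hv hi
    (by simpa using h0)
  have hk' : k' ≠ rootFin m B' := fun h => hi ((ends_eq_root hB).1 (by
    rw [← e1, ← e2]; exact (ends_eq_root hB').2 h))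
  obtain ⟨i', rfl⟩ := Fin.exists_succAbove_eq hk'
  have hmem : chamberTuple m B i ∈ Set.range (chamberTuple m B) ∩
      Set.range (chamberTuple m B') := by
    refine ⟨⟨i, rfl⟩, i', ?_⟩
    simp only [chamberTuple, chamberRow, if_neg hi, if_neg hk', e1, e2]
  have : a i • chamberTuple m B i = (⟨a i, ha i⟩ : ℝ≥0) • chamberTuple m B i := rfl
  rw [this]
  exact Submodule.smul_mem _ _ (Submodule.subset_span hmem)

/-- The sum of the rays depends on their set only and lies in the open chamber, and an open chamber
determines its tree. -/
theorem eq_of_range_chamberTuple_eq (hB : B.numNodes = m + 1) (hB' : B'.numNodes = m + 1)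
    (h : Set.range (chamberTuple m B) = Set.range (chamberTuple m B')) : B = B' := by
  have hsum : ∀ B : BinaryTree Unit, B.numNodes = m + 1 → ∑ i, chamberTuple m B i =
      ∑ x ∈ Set.toFinset (Set.range (chamberTuple m B)), x := by
    intro B hB
    rw [Set.toFinset_range, Finset.sum_image fun i _ j _ hij =>
      (linearIndependent_chamberTuple hB).injective hij]
  have hopen : ∀ B : BinaryTree Unit, B.numNodes = m + 1 →
      ∑ i, chamberTuple m B i ∈ openChamber (m + 1) B := by
    intro B hB
    have e : ∑ i, chamberTuple m B i = ∑ i, (1 : ℝ) • chamberTuple m B i := by simp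
    rw [e, sum_chamberTuple (fun _ => 1)]
    refine combination_mem_openChamber hB fun k hk => ?_
    obtain ⟨i, rfl⟩ := Fin.exists_succAbove_eq hk
    simp
  have e : ∑ i, chamberTuple m B i = ∑ i, chamberTuple m B' i := by
    rw [hsum B hB, hsum B' hB']
    congr 1
    ext x
    simp [h]
  exact openChamber_unique hB hB' (hopen B hB) (e ▸ hopen B' hB')

theorem exists_isBoundaryTriangulation (m : ℕ) :
    ∃ T, IsBoundaryTriangulation (lodaySimplex (m + 1)) T := by
  classical
  refine ⟨(BinaryTree.treesOfNumNodesEq (m + 1)).image (chamberTuple m), ?_⟩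
  unfold IsBoundaryTriangulation
  rw [frontier_dualCone (by omega)]
  constructor
  · intro F hF
    obtain ⟨B, hB, rfl⟩ := Finset.mem_image.1 hF
    exact linearIndependent_chamberTuple (BinaryTree.mem_treesOfNumNodesEq.1 hB)
  · ext v
    simp only [Finset.mem_image, Set.mem_iUnion, Set.mem_ofPred_eq, exists_prop]
    constructor
    · rintro ⟨F, ⟨B, hB, rfl⟩, h⟩
      obtain ⟨a, ha, rfl⟩ := mem_posSpan_range.1 h
      exact totalMin_sum_chamberTuple (BinaryTree.mem_treesOfNumNodesEq.1 hB) ha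
    · intro h0
      obtain ⟨B, hB, hv⟩ := exists_mem_chamber v
      exact ⟨_, ⟨B, hB, rfl⟩,
        mem_posSpan_chamberTuple (BinaryTree.mem_treesOfNumNodesEq.1 hB) hv h0⟩
  · intro F hF G hG
    obtain ⟨B, hB, rfl⟩ := Finset.mem_image.1 hF
    obtain ⟨B', hB', rfl⟩ := Finset.mem_image.1 hG
    refine subset_antisymm (posSpan_inter_le (BinaryTree.mem_treesOfNumNodesEq.1 hB)
      (BinaryTree.mem_treesOfNumNodesEq.1 hB')) (Set.subset_inter ?_ ?_)
    · exact Submodule.span_mono Set.inter_subset_left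
    · exact Submodule.span_mono Set.inter_subset_right
  · intro F hF G hG h
    obtain ⟨B, hB, rfl⟩ := Finset.mem_image.1 hF
    obtain ⟨B', hB', rfl⟩ := Finset.mem_image.1 hG
    rw [eq_of_range_chamberTuple_eq (BinaryTree.mem_treesOfNumNodesEq.1 hB)
      (BinaryTree.mem_treesOfNumNodesEq.1 hB') h]

end ChamberTriangulation

/-! ### Arbitrary triangulations of the boundary -/

section BoundaryTriangulation

variable {m : ℕ} {T : Finset (Fin m → Fin (m + 1) → ℝ)}

theorem isConeTriangulation_of_boundary
    (hT : IsBoundaryTriangulation (d := m + 1) (lodaySimplex (m + 1)) T) :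
    IsConeTriangulation {v | totalMin v = 0} T := by
  have h := hT
  unfold IsBoundaryTriangulation at h
  rwa [frontier_dualCone (by omega)] at h

variable (hT : IsConeTriangulation {v : Fin (m + 1) → ℝ | totalMin v = 0} T)
include hT

theorem IsConeTriangulation.totalMin_sum {F : Fin m → Fin (m + 1) → ℝ} (hF : F ∈ T)
    {a : Fin m → ℝ} (ha : ∀ i, 0 ≤ a i) : totalMin (∑ i, a i • F i) = 0 := by
  have h : ∑ i, a i • F i ∈ ⋃ F ∈ T, posSpan (Set.range F) :=
    Set.mem_biUnion hF (mem_posSpan_range.2 ⟨a, ha, rfl⟩)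
  rwa [hT.union_eq] at h

theorem IsConeTriangulation.totalMin_generator {F : Fin m → Fin (m + 1) → ℝ} (hF : F ∈ T)
    (i : Fin m) : totalMin (F i) = 0 := by
  have h : F i ∈ ⋃ F ∈ T, posSpan (Set.range F) :=
    Set.mem_biUnion hF (Submodule.subset_span ⟨i, rfl⟩)
  rwa [hT.union_eq] at h

/-- Each interval minimum is superadditive on the cone, while their sum `totalMin` is zero at the
generators and at the combination. So no single inequality can be strict: every triangulation of the
boundary refines the normal fan. -/
theorem IsConeTriangulation.intervalMin_sum {F : Fin m → Fin (m + 1) → ℝ} (hF : F ∈ T)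
    {a : Fin m → ℝ} (ha : ∀ i, 0 ≤ a i) (p : IntervalIdx (m + 1)) :
    intervalMin p (∑ i, a i • F i) = ∑ i, a i * intervalMin p (F i) := by
  have hle : ∀ p ∈ (Finset.univ : Finset (IntervalIdx (m + 1))),
      ∑ i, a i * intervalMin p (F i) ≤ intervalMin p (∑ i, a i • F i) := fun p _ =>
    sum_intervalMin_le _ p a (fun i _ => ha i) F
  refine ((Finset.sum_eq_sum_iff_of_le hle).1 ?_ p (Finset.mem_univ p)).symm
  have h0 := hT.totalMin_sum hF ha
  unfold totalMin at h0
  rw [h0, Finset.sum_comm]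
  refine Finset.sum_eq_zero fun i _ => ?_
  rw [← Finset.mul_sum]
  have := hT.totalMin_generator hF i
  unfold totalMin at this
  rw [this, mul_zero]

/-- The ray lies in some cone of `T`. A generator used there with positive weight must be constant
on [α, β) and on its complement, hence is a multiple of the ray plus a constant, and `totalMin`
kills the constant. -/
theorem IsConeTriangulation.exists_smul_ray {α β : ℕ} (hαβ : α < β) (hβ : β ≤ m + 1)
    (hne : ¬ (α = 0 ∧ β = m + 1)) :
    ∃ F ∈ T, ∃ i, ∃ c : ℝ, 0 < c ∧ F i = c • ray (m + 1) α β := by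
  set R := ray (m + 1) α β with hR
  have h0 : totalMin R = 0 := totalMin_ray (by omega) α β
  have hmem : R ∈ ⋃ F ∈ T, posSpan (Set.range F) := by rw [hT.union_eq]; exact h0
  simp only [Set.mem_iUnion, exists_prop] at hmem
  obtain ⟨F, hF, hRF⟩ := hmem
  obtain ⟨a, ha, haR⟩ := mem_posSpan_range.1 hRF
  set C := -(totalMin (ivl (m + 1) α β) / Fintype.card (IntervalIdx (m + 1))) with hC
  let p : IntervalIdx (m + 1) := ⟨(⟨α, by omega⟩, ⟨β - 1, by omega⟩), by
    rw [Fin.mk_le_mk]; omega⟩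
  let q : IntervalIdx (m + 1) := ⟨(⟨0, by omega⟩, ⟨m, by omega⟩), by rw [Fin.mk_le_mk]; omega⟩
  have hRk : ∀ k : Fin (m + 1), R k = (if α ≤ (k : ℕ) ∧ (k : ℕ) < β then 1 else 0) + C :=
    fun k => rfl
  have hp : intervalMin p R = 1 + C := by
    rw [hR, intervalMin_ray, intervalMin_ivl, if_pos]
    simp only [p, Finset.mem_Ico]
    omega
  have hq : intervalMin q R = C := by
    rw [hR, intervalMin_ray, intervalMin_ivl, if_neg, zero_add]
    simp only [q, Finset.mem_Ico]
    omega
  have hRne : R ≠ 0 := by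
    intro h
    rw [h] at hp hq
    have e : ∀ r : IntervalIdx (m + 1), intervalMin r (0 : Fin (m + 1) → ℝ) = 0 := fun r =>
      intervalMin_const r 0
    rw [e] at hp hq
    linarith
  obtain ⟨i, hi⟩ : ∃ i, a i ≠ 0 := by
    by_contra h
    push Not at h
    exact hRne (by rw [← haR]; simp [h])
  have hpos : 0 < a i := lt_of_le_of_ne (ha i) (Ne.symm hi)
  -- Where the combination attains its minimum over an interval, every summand of positive weight
  -- does too, because the minimum is additive on the cone.
  have hmin : ∀ (r : IntervalIdx (m + 1)) (k : Fin (m + 1)), r.1.1 ≤ k → k ≤ r.1.2 →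
      R k = intervalMin r R → F i k = intervalMin r (F i) := by
    intro r k h1 h2 h3
    rw [← haR, hT.intervalMin_sum hF ha, Finset.sum_apply] at h3
    have hle : ∀ j ∈ (Finset.univ : Finset (Fin m)),
        a j * intervalMin r (F j) ≤ (a j • F j) k := fun j _ =>
      mul_le_mul_of_nonneg_left (intervalMin_le h1 h2 _) (ha j)
    have := (Finset.sum_eq_sum_iff_of_le hle).1 h3.symm i (Finset.mem_univ i)
    exact (mul_left_cancel₀ hi this).symm
  set A := intervalMin p (F i) - intervalMin q (F i) with hA
  have hA0 : 0 ≤ A := by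
    refine sub_nonneg.2 (le_intervalMin fun k _ _ => intervalMin_le ?_ ?_ _)
    · exact Fin.mk_le_of_le_val (Nat.zero_le _)
    · exact Fin.le_def.2 (by simp only [q]; omega)
  -- Points of [α, β) minimize `R` over `p`, and the other points minimize it over the full interval
  -- `q`, so `F i` takes just two values.
  have hFi : F i = fun k => (A • R) k + (intervalMin q (F i) - A * C) := by
    funext k
    simp only [Pi.smul_apply, smul_eq_mul, hRk]
    split_ifs with hk
    · rw [hmin p k (Fin.le_def.2 hk.1) (Fin.le_def.2 (by simp only [p]; omega))
        (by rw [hp, hRk, if_pos hk])]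
      rw [hA]; ring
    · rw [hmin q k (Fin.mk_le_of_le_val (Nat.zero_le _)) (Fin.le_def.2 (by simp only [q]; omega))
        (by rw [hq, hRk, if_neg hk, zero_add])]
      ring
  have hFt := hT.totalMin_generator hF i
  have hAR : totalMin (A • R) = 0 := by
    unfold totalMin at h0 ⊢
    simp only [intervalMin_smul _ _ hA0, ← Finset.mul_sum, h0, mul_zero]
  rw [hFi, totalMin_add_const, hAR, zero_add] at hFt
  have hc : intervalMin q (F i) - A * C = 0 :=
    (mul_eq_zero.1 hFt).resolve_left (card_intervalIdx_pos (by omega)).ne'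
  rw [hc] at hFi
  simp only [add_zero] at hFi
  refine ⟨F, hF, i, A, lt_of_le_of_ne hA0 fun h => ?_, hFi⟩
  refine (hT.linearIndependent F hF).ne_zero i ?_
  rw [hFi, ← h]
  funext k
  simp

/-! ### The simplicial cones over the triangulation -/

omit hT in
theorem vecMul_bordered (F : Fin m → Fin (m + 1) → ℝ) (t : Fin (m + 1) → ℝ) :
    Matrix.vecMul t (bordered (d := m + 1) F) =
      fun k => (∑ i : Fin m, t i.castSucc • F i) k + t (Fin.last m) := by
  rw [Matrix.vecMul_eq_sum, Fin.sum_univ_castSucc]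
  funext k
  rw [Pi.add_apply, Finset.sum_apply, Finset.sum_apply]
  congr 1
  · refine Finset.sum_congr rfl fun i _ => ?_
    simp [bordered]
  · simp [bordered]

/-- If 𝟏 were in the span of `F`, separating positive and negative coefficients would give two
points of the cone that differ by 𝟏. `totalMin` vanishes at both, but adding 𝟏 increases it. -/
theorem IsConeTriangulation.det_bordered_ne_zero {F : Fin m → Fin (m + 1) → ℝ} (hF : F ∈ T) :
    (bordered (d := m + 1) F).det ≠ 0 := by
  have hrow : (bordered (d := m + 1) F).row = Fin.snoc (α := fun _ => Fin (m + 1) → ℝ) F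
      (fun _ => 1) := by
    funext i
    refine Fin.lastCases ?_ (fun j => ?_) i
    · funext k; simp [Matrix.row, bordered]
    · funext k; simp [Matrix.row, bordered]
  rw [← isUnit_iff_ne_zero, ← Matrix.isUnit_iff_isUnit_det,
    ← Matrix.linearIndependent_rows_iff_isUnit, hrow, linearIndependent_finSnoc]
  refine ⟨hT.linearIndependent F hF, fun hmem => ?_⟩
  obtain ⟨c, hc⟩ := (Submodule.mem_span_range_iff_exists_fun ℝ).1 hmem
  have h1 := hT.totalMin_sum hF (a := fun i => max (c i) 0) fun i => le_max_right _ _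
  have h2 := hT.totalMin_sum hF (a := fun i => max (-c i) 0) fun i => le_max_right _ _
  have e : ∑ i, max (c i) 0 • F i = fun k => (∑ i, max (-c i) 0 • F i) k + 1 := by
    funext k
    have hck := congrFun hc k
    rw [Finset.sum_apply] at hck ⊢
    rw [Finset.sum_apply, ← sub_eq_iff_eq_add', ← Finset.sum_sub_distrib, ← hck]
    refine Finset.sum_congr rfl fun i _ => ?_
    simp only [Pi.smul_apply, smul_eq_mul, ← sub_mul]
    congr 1
    rcases le_total (c i) 0 with h | h
    · rw [max_eq_right h, max_eq_left (by linarith)]; ring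
    · rw [max_eq_left h, max_eq_right (by linarith)]; ring
  rw [e, totalMin_add_const, h2] at h1
  have := card_intervalIdx_pos (n := m + 1) (by omega)
  linarith

theorem IsConeTriangulation.intervalMin_vecMul {F : Fin m → Fin (m + 1) → ℝ} (hF : F ∈ T)
    {t : Fin (m + 1) → ℝ} (ht : ∀ i, 0 ≤ t i) (p : IntervalIdx (m + 1)) :
    intervalMin p (Matrix.vecMul t (bordered (d := m + 1) F)) =
      ∑ i : Fin m, t i.castSucc * intervalMin p (F i) + t (Fin.last m) := by
  rw [vecMul_bordered, intervalMin_add_const, hT.intervalMin_sum hF fun i => ht _]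

theorem IsConeTriangulation.totalMin_vecMul {F : Fin m → Fin (m + 1) → ℝ} (hF : F ∈ T)
    {t : Fin (m + 1) → ℝ} (ht : ∀ i, 0 ≤ t i) :
    totalMin (Matrix.vecMul t (bordered (d := m + 1) F)) =
      Fintype.card (IntervalIdx (m + 1)) * t (Fin.last m) := by
  rw [vecMul_bordered, totalMin_add_const, hT.totalMin_sum hF fun i => ht _, zero_add]

/-- `totalMin` determines the coefficient of 𝟏. Removing this multiple leaves a common point of the
two boundary cones that is interior to both. -/
theorem IsConeTriangulation.eq_of_mem_openCone {F G : Fin m → Fin (m + 1) → ℝ} (hF : F ∈ T)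
    (hG : G ∈ T) {v : Fin (m + 1) → ℝ} (hvF : v ∈ openCone (bordered (d := m + 1) F))
    (hvG : v ∈ openCone (bordered (d := m + 1) G)) : F = G := by
  have hN := card_intervalIdx_pos (n := m + 1) (by omega)
  obtain ⟨t, ht, rfl⟩ := hvF
  obtain ⟨s, hs, hst⟩ := hvG
  simp only [Set.mem_ofPred_eq] at ht hs hst
  have hlast : t (Fin.last m) = s (Fin.last m) := by
    have h := congrArg totalMin hst
    rw [hT.totalMin_vecMul hF fun i => (ht i).le, hT.totalMin_vecMul hG fun i => (hs i).le] at h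
    exact (mul_left_cancel₀ hN.ne' h).symm
  have hsum : ∑ i : Fin m, t i.castSucc • F i = ∑ i : Fin m, s i.castSucc • G i := by
    funext k
    have h := congrFun hst k
    rw [vecMul_bordered, vecMul_bordered] at h
    simp only at h
    linarith
  -- `inter_eq` puts the point into the face of the shared generators. All its coefficients over `F`
  -- are positive, so by linear independence no generator of `F` can be missing there.
  have hsub : ∀ (F G : Fin m → Fin (m + 1) → ℝ), F ∈ T → G ∈ T → ∀ t : Fin (m + 1) → ℝ,
      (∀ i, 0 < t i) → ∑ i : Fin m, t i.castSucc • F i ∈ posSpan (Set.range G) →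
      Set.range F ⊆ Set.range G := by
    intro F G hF hG t ht hmem
    have h1 : ∑ i : Fin m, t i.castSucc • F i ∈ posSpan (Set.range F ∩ Set.range G) := by
      rw [← hT.inter_eq F hF G hG]
      exact ⟨mem_posSpan_range.2 ⟨fun i => t i.castSucc, fun i => (ht _).le, rfl⟩, hmem⟩
    rintro _ ⟨i, rfl⟩
    by_contra hi
    have hle : posSpan (Set.range F ∩ Set.range G) ⊆
        (Submodule.span ℝ (F '' {i}ᶜ) : Set (Fin (m + 1) → ℝ)) := by
      intro x hx
      refine Submodule.span_le_restrictScalars ℝ≥0 ℝ _ (Submodule.span_mono ?_ hx)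
      rintro _ ⟨⟨j, rfl⟩, hj⟩
      exact ⟨j, fun h => hi (by rw [← Set.mem_singleton_iff.1 h]; exact hj), rfl⟩
    have h2 := hle h1
    have hli := hT.linearIndependent F hF
    rw [Finset.sum_eq_add_sum_sdiff_singleton_of_mem (Finset.mem_univ i)] at h2
    have h3 : ∑ j ∈ Finset.univ \ {i}, t j.castSucc • F j ∈ Submodule.span ℝ (F '' {i}ᶜ) := by
      refine Submodule.sum_mem _ fun j hj => Submodule.smul_mem _ _
        (Submodule.subset_span ⟨j, ?_, rfl⟩)
      simpa using hj
    have h4 := (Submodule.add_mem_iff_left _ h3).1 h2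
    have h5 := (Submodule.smul_mem_iff _ (ht i.castSucc).ne').1 h4
    exact hli.notMem_span_image (s := {i}ᶜ) (by simp) h5
  refine hT.listed_once F hF G hG (subset_antisymm (hsub F G hF hG t ht ?_)
    (hsub G F hG hF s hs ?_))
  · rw [hsum]
    exact mem_posSpan_range.2 ⟨fun i => s i.castSucc, fun i => (hs _).le, rfl⟩
  · rw [← hsum]
    exact mem_posSpan_range.2 ⟨fun i => t i.castSucc, fun i => (ht _).le, rfl⟩

/-- Subtracting the right multiple of 𝟏 moves a point with positive `totalMin` to the boundary, into
some cone of `T`. The exceptional points have a vanishing coordinate with respect to some bordered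
matrix. -/
theorem IsConeTriangulation.ae_cover :
    ∀ᵐ v : Fin (m + 1) → ℝ, v ∈ {v | 0 < totalMin v} ↔
      ∃ F ∈ T, v ∈ openCone (bordered (d := m + 1) F) := by
  have hN := card_intervalIdx_pos (n := m + 1) (by omega)
  have hae : ∀ᵐ v : Fin (m + 1) → ℝ, ∀ F ∈ T, ∀ i,
      Matrix.vecMul v (bordered (d := m + 1) F)⁻¹ i ≠ 0 := by
    rw [Filter.eventually_all_finset]
    intro F hF
    rw [Filter.eventually_all]
    intro i
    refine ae_ne_zero_of_linearMap
      (LinearMap.proj i ∘ₗ (bordered (d := m + 1) F)⁻¹.vecMulLinear) fun h => ?_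
    have h1 := LinearMap.congr_fun h (Matrix.vecMul (Pi.single i 1) (bordered (d := m + 1) F))
    simp only [LinearMap.comp_apply, Matrix.vecMulLinear_apply, LinearMap.proj_apply,
      LinearMap.zero_apply] at h1
    rw [Matrix.vecMul_vecMul, Matrix.mul_nonsing_inv _ (hT.det_bordered_ne_zero hF).isUnit,
      Matrix.vecMul_one] at h1
    simp at h1
  filter_upwards [hae] with v hv
  constructor
  · intro h0
    have h0 : 0 < totalMin v := h0
    set s := totalMin v / Fintype.card (IntervalIdx (m + 1)) with hs
    have hmem : (fun k => v k + -s) ∈ ⋃ F ∈ T, posSpan (Set.range F) := by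
      rw [hT.union_eq]
      change totalMin _ = 0
      rw [totalMin_add_const, hs]
      field_simp
      ring
    simp only [Set.mem_iUnion, exists_prop] at hmem
    obtain ⟨F, hF, hvF⟩ := hmem
    obtain ⟨a, ha, hav⟩ := mem_posSpan_range.1 hvF
    refine ⟨F, hF, Fin.snoc (α := fun _ => ℝ) a s, ?_, ?_⟩
    all_goals
      have hvec : Matrix.vecMul (Fin.snoc (α := fun _ => ℝ) a s) (bordered (d := m + 1) F) = v := by
        rw [vecMul_bordered]
        simp only [Fin.snoc_castSucc, Fin.snoc_last, hav]
        funext k; ring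
    · intro i
      have h1 := hv F hF i
      rw [← hvec, Matrix.vecMul_vecMul,
        Matrix.mul_nonsing_inv _ (hT.det_bordered_ne_zero hF).isUnit, Matrix.vecMul_one] at h1
      refine lt_of_le_of_ne ?_ (Ne.symm h1)
      refine Fin.lastCases ?_ (fun j => ?_) i
      · rw [Fin.snoc_last, hs]; positivity
      · rw [Fin.snoc_castSucc]; exact ha j
    · exact hvec
  · rintro ⟨F, hF, t, ht, rfl⟩
    change 0 < totalMin (Matrix.vecMul t (bordered (d := m + 1) F))
    rw [hT.totalMin_vecMul hF fun i => (ht i).le]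
    exact mul_pos hN (ht _)

end BoundaryTriangulation

/-! ### Identities of rational functions -/

theorem sum_div_mul_prod {κ K : Type*} [Field K] [DecidableEq κ] (S : Finset κ) (c d : κ → K)
    (hd : ∀ k ∈ S, d k ≠ 0) :
    (∑ k ∈ S, c k / d k) * ∏ k ∈ S, d k = ∑ k ∈ S, c k * ∏ j ∈ S.erase k, d j := by
  rw [Finset.sum_mul]
  refine Finset.sum_congr rfl fun k hk => ?_
  rw [← Finset.mul_prod_erase S d hk, ← mul_assoc, div_mul_cancel₀ _ (hd k hk)]

/-- An identity between rational functions holds over every field extension if it holds for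
negative real values of the variables. -/
theorem sum_div_eq_zero_of_real {κ σ : Type*} (S : Finset κ) (c : κ → ℝ)
    (D : κ → MvPolynomial σ ℝ)
    (h : ∀ y : σ → ℝ, (∀ i, y i < 0) → (∀ k ∈ S, MvPolynomial.aeval y (D k) ≠ 0) ∧
      ∑ k ∈ S, c k / MvPolynomial.aeval y (D k) = 0)
    {K : Type*} [Field K] [Algebra ℝ K] (x : σ → K)
    (hx : ∀ k ∈ S, MvPolynomial.aeval x (D k) ≠ 0) :
    ∑ k ∈ S, algebraMap ℝ K (c k) / MvPolynomial.aeval x (D k) = 0 := by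
  classical
  have hpoly : ∑ k ∈ S, MvPolynomial.C (c k) * ∏ j ∈ S.erase k, D j = 0 := by
    -- No denominator vanishes on the negative orthant, so the cleared identity holds there, and a
    -- polynomial that vanishes on a product of infinite sets is zero.
    refine MvPolynomial.funext_set (fun _ => Set.Iio (0 : ℝ)) (fun _ => Set.Iio_infinite 0)
      fun y hy => ?_
    obtain ⟨h1, h2⟩ := h y fun i => hy i (Set.mem_univ i)
    simp only [MvPolynomial.aeval_eq_eval] at h1 h2
    have h3 := sum_div_mul_prod S c (fun k => MvPolynomial.eval y (D k)) h1
    rw [h2, zero_mul] at h3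
    simpa using h3.symm
  have h4 := congrArg (MvPolynomial.aeval x) hpoly
  simp only [map_sum, map_mul, map_prod, MvPolynomial.aeval_C, map_zero] at h4
  rw [← sum_div_mul_prod S (fun k => algebraMap ℝ K (c k)) _ hx] at h4
  exact (mul_eq_zero.1 h4).resolve_right (Finset.prod_ne_zero_iff.2 hx)

/-! ### The identity on the hyperplane ∑ x = 0 -/

section RationalIdentity

variable {m : ℕ}

/-- The full interval. -/
def fullIdx (m : ℕ) : IntervalIdx (m + 1) := ⟨(0, Fin.last m), Fin.zero_le _⟩

/-- A proper subinterval does not involve the coordinate of the full interval, the only one that may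
be nonnegative. -/
theorem pairSum_neg {x : IntervalIdx (m + 1) → ℝ} (hx : ∀ p, p ≠ fullIdx m → x p < 0) {α β : ℕ}
    (hαβ : α < β) (hβ : β ≤ m + 1) (hne : ¬ (α = 0 ∧ β = m + 1)) :
    pairSum x (Finset.Ico α β) < 0 := by
  refine Finset.sum_neg (fun p hp => hx p ?_) ⟨⟨(⟨α, by omega⟩, ⟨α, by omega⟩), le_rfl⟩, ?_⟩
  · rintro rfl
    simp only [fullIdx, Finset.mem_filter, Finset.mem_Ico, Fin.val_last, Fin.val_zero] at hp
    omega
  · simp only [Finset.mem_filter, Finset.mem_Ico, Finset.mem_univ, true_and]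
    omega

variable {B : BinaryTree Unit}

theorem pairSum_ends_neg (hB : B.numNodes = m + 1) {x : IntervalIdx (m + 1) → ℝ}
    (hx : ∀ p, p ≠ fullIdx m → x p < 0) {k : Fin (m + 1)} (hk : k ≠ rootFin m B) :
    pairSum x (Finset.Ico (lowEnd B 0 k) (highEnd B 0 k)) < 0 := by
  have hb := ends_fin_bounds hB k
  exact pairSum_neg hx (by omega) (by omega) fun h => hk ((ends_eq_root hB).1 h)

theorem sum_mul_intervalMin_chamberRow (x : IntervalIdx (m + 1) → ℝ)
    (hx : ∑ p, x p = 0) (k : Fin (m + 1)) :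
    ∑ p, x p * intervalMin p (chamberRow m B k) =
      if k = rootFin m B then 0
      else pairSum x (Finset.Ico (lowEnd B 0 k) (highEnd B 0 k)) := by
  unfold chamberRow
  split_ifs
  · simp only [intervalMin_const, ← Finset.sum_mul, hx, zero_mul]
  · exact sum_mul_intervalMin_ray x hx _ _

theorem mixedSupport_combination (hB : B.numNodes = m + 1) (x : IntervalIdx (m + 1) → ℝ)
    (hx : ∑ p, x p = 0) {t : Fin (m + 1) → ℝ}
    (hv : ∑ k, t k • chamberRow m B k ∈ chamber (m + 1) B) :
    mixedSupport (lodaySimplex (m + 1)) x 0 (∑ k, t k • chamberRow m B k) =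
      ∑ k, t k * if k = rootFin m B then 0
        else -pairSum x (Finset.Ico (lowEnd B 0 k) (highEnd B 0 k)) := by
  rw [mixedSupport_eq]
  simp only [intervalMin_combination hB hv, Algebra.algebraMap_self, RingHom.id_apply,
    Finset.mul_sum]
  rw [Finset.sum_comm, ← Finset.sum_neg_distrib]
  refine Finset.sum_congr rfl fun k _ => ?_
  have h := sum_mul_intervalMin_chamberRow (B := B) x hx k
  simp only [mul_left_comm (x _), ← Finset.mul_sum, h]
  split_ifs <;> ring

/-- In its chamber a boundary point is a nonnegative combination of rays, at which the mixed support
takes the positive values `-pairSum`. This gives convergence of the integrals. -/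
theorem mixedSupport_pos {x : IntervalIdx (m + 1) → ℝ} (hx : ∑ p, x p = 0)
    (hneg : ∀ p, p ≠ fullIdx m → x p < 0) {v : Fin (m + 1) → ℝ} (h0 : totalMin v = 0)
    (hv : v ≠ 0) : 0 < mixedSupport (lodaySimplex (m + 1)) x 0 v := by
  obtain ⟨B, hB, hvB⟩ := exists_mem_chamber v
  rw [BinaryTree.mem_treesOfNumNodesEq] at hB
  obtain ⟨t, h1, h2, h3⟩ := exists_combination_of_mem_chamber hB hvB
  rw [h0, zero_div] at h3
  obtain ⟨k, hk⟩ : ∃ k, t k ≠ 0 := by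
    by_contra h
    push Not at h
    exact hv (by rw [h1]; simp [h])
  have hkr : k ≠ rootFin m B := fun h => hk (h ▸ h3)
  rw [h1] at hvB ⊢
  rw [mixedSupport_combination hB x hx hvB]
  refine Finset.sum_pos' (fun i _ => ?_) ⟨k, Finset.mem_univ _, ?_⟩
  · split_ifs with hi
    · simp
    · exact mul_nonneg (h2 i hi) (neg_nonneg.2 (pairSum_ends_neg hB hneg hi).le)
  · rw [if_neg hkr]
    exact mul_pos (lt_of_le_of_ne (h2 k hkr) (Ne.symm hk))
      (neg_pos.2 (pairSum_ends_neg hB hneg hkr))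

variable {T : Finset (Fin m → Fin (m + 1) → ℝ)}

theorem IsConeTriangulation.mixedSupport_generator_pos
    (hT : IsConeTriangulation {v : Fin (m + 1) → ℝ | totalMin v = 0} T)
    {x : IntervalIdx (m + 1) → ℝ} (hx : ∑ p, x p = 0)
    (hneg : ∀ p, p ≠ fullIdx m → x p < 0) {F : Fin m → Fin (m + 1) → ℝ} (hF : F ∈ T)
    (i : Fin m) : 0 < mixedSupport (lodaySimplex (m + 1)) x 0 (F i) :=
  mixedSupport_pos hx hneg (hT.totalMin_generator hF i) ((hT.linearIndependent F hF).ne_zero i)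

/-- Up to a null set all coordinates are distinct, and then the weak inequalities of a chamber are
strict. -/
theorem ae_cover_chambers :
    ∀ᵐ v : Fin (m + 1) → ℝ, v ∈ {v | 0 < totalMin v} ↔
      ∃ B ∈ BinaryTree.treesOfNumNodesEq (m + 1), v ∈ openCone (chamberMatrix m B) := by
  have hae : ∀ᵐ v : Fin (m + 1) → ℝ, ∀ i j, i ≠ j → v i ≠ v j := by
    rw [Filter.eventually_all]
    intro i
    rw [Filter.eventually_all]
    intro j
    by_cases hij : i = j
    · simp [hij]
    have h := ae_ne_zero_of_linearMap
      ((LinearMap.proj i : (Fin (m + 1) → ℝ) →ₗ[ℝ] ℝ) - LinearMap.proj j) fun h => by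
        have := LinearMap.congr_fun h (Pi.single i 1)
        simp [Ne.symm hij] at this
    filter_upwards [h] with v hv _
    simpa [sub_eq_zero] using hv
  filter_upwards [hae] with v hv
  have hinj : Function.Injective v := fun i j hij => by
    by_contra hne
    exact hv i j hne hij
  constructor
  · intro h0
    obtain ⟨B, hB, hvB⟩ := exists_mem_chamber v
    exact ⟨B, hB, (mem_openCone_chamberMatrix (BinaryTree.mem_treesOfNumNodesEq.1 hB) v).2
      ⟨mem_openChamber_of_injective hvB hinj, h0⟩⟩
  · rintro ⟨B, hB, hvB⟩
    exact ((mem_openCone_chamberMatrix (BinaryTree.mem_treesOfNumNodesEq.1 hB) v).1 hvB).2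

/-- The identity for real coefficients in the domain where the integrals converge. -/
theorem IsConeTriangulation.sum_eq_of_neg
    (hT : IsConeTriangulation {v : Fin (m + 1) → ℝ | totalMin v = 0} T)
    {x : IntervalIdx (m + 1) → ℝ} (hx : ∑ p, x p = 0)
    (hneg : ∀ p, p ≠ fullIdx m → x p < 0) :
    ∑ F ∈ T, |(bordered (d := m + 1) F).det| /
        ∏ i, mixedSupport (lodaySimplex (m + 1)) x 0 (F i) =
      ∑ B ∈ BinaryTree.treesOfNumNodesEq (m + 1), 1 / ∏ k ∈ Finset.univ.erase (rootFin m B),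
        -pairSum x (Finset.Ico (lowEnd B 0 k) (highEnd B 0 k)) := by
  have hN := card_intervalIdx_pos (n := m + 1) (by omega)
  set N : ℝ := (Fintype.card (IntervalIdx (m + 1)) : ℝ) with hNdef
  set H := mixedSupport (lodaySimplex (m + 1)) x 0 with hH
  -- `H` is blind to multiples of 𝟏 because ∑ x = 0. Adding `totalMin`, which vanishes on the
  -- boundary, gives that direction the weight `N` and makes the integral converge.
  let ψ : (Fin (m + 1) → ℝ) → ℝ := fun v => H v + totalMin v
  let wF : (Fin m → Fin (m + 1) → ℝ) → Fin (m + 1) → ℝ := fun F =>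
    Fin.snoc (α := fun _ => ℝ) (fun i => H (F i)) N
  let wB : BinaryTree Unit → Fin (m + 1) → ℝ := fun B k =>
    if k = rootFin m B then N else -pairSum x (Finset.Ico (lowEnd B 0 k) (highEnd B 0 k))
  have hwF : ∀ F ∈ T, ∀ i, 0 < wF F i := by
    intro F hF i
    refine Fin.lastCases ?_ (fun j => ?_) i
    · simpa only [wF, Fin.snoc_last] using hN
    · simpa only [wF, Fin.snoc_castSucc] using hT.mixedSupport_generator_pos hx hneg hF j
  have hwB : ∀ B ∈ BinaryTree.treesOfNumNodesEq (m + 1), ∀ k, 0 < wB B k := by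
    intro B hB k
    rw [BinaryTree.mem_treesOfNumNodesEq] at hB
    simp only [wB]
    split_ifs with h
    · exact hN
    · exact neg_pos.2 (pairSum_ends_neg hB hneg h)
  have hψF : ∀ F ∈ T, ∀ t : Fin (m + 1) → ℝ, (∀ i, 0 < t i) →
      ψ (Matrix.vecMul t (bordered (d := m + 1) F)) = ∑ i, t i * wF F i := by
    intro F hF t ht
    simp only [ψ, wF]
    rw [hT.totalMin_vecMul hF fun i => (ht i).le, Fin.sum_univ_castSucc]
    simp only [Fin.snoc_castSucc, Fin.snoc_last, hH, mixedSupport_eq, Algebra.algebraMap_self,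
      RingHom.id_apply, hT.intervalMin_vecMul hF fun i => (ht i).le, mul_add,
      Finset.sum_add_distrib, ← Finset.sum_mul, hx, zero_mul, add_zero, Finset.mul_sum]
    rw [Finset.sum_comm, mul_comm N, ← Finset.sum_neg_distrib]
    congr 1
    refine Finset.sum_congr rfl fun i _ => ?_
    rw [mul_neg, Finset.mul_sum]
    congr 1
    exact Finset.sum_congr rfl fun p _ => by ring
  have hψB : ∀ B ∈ BinaryTree.treesOfNumNodesEq (m + 1), ∀ t : Fin (m + 1) → ℝ,
      (∀ i, 0 < t i) → ψ (Matrix.vecMul t (chamberMatrix m B)) = ∑ k, t k * wB B k := by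
    intro B hB t ht
    rw [BinaryTree.mem_treesOfNumNodesEq] at hB
    have hmem := combination_mem_chamber hB fun k _ => (ht k).le
    simp only [ψ, wB]
    rw [vecMul_chamberMatrix, hH, mixedSupport_combination hB x hx hmem,
      totalMin_combination hB hmem, ← Finset.add_sum_erase _ _ (Finset.mem_univ (rootFin m B)),
      ← Finset.add_sum_erase _ _ (Finset.mem_univ (rootFin m B))]
    simp only [if_true, mul_zero, zero_add]
    rw [add_comm]
    congr 1
    refine Finset.sum_congr rfl fun k hk => ?_
    rw [if_neg (Finset.ne_of_mem_erase hk), if_neg (Finset.ne_of_mem_erase hk)]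
  have h1 := lintegral_eq_sum_openCone T (fun F => bordered (d := m + 1) F) wF ψ
    {v | 0 < totalMin v} (fun F hF => hT.det_bordered_ne_zero hF) hwF hψF
    (fun F hF G hG v hvF hvG => hT.eq_of_mem_openCone hF hG hvF hvG) hT.ae_cover
  have h2 := lintegral_eq_sum_openCone (BinaryTree.treesOfNumNodesEq (m + 1))
    (fun B => chamberMatrix m B) wB ψ {v | 0 < totalMin v}
    (fun B hB => by
      rw [det_chamberMatrix (BinaryTree.mem_treesOfNumNodesEq.1 hB)]; exact one_ne_zero)
    hwB hψB
    (fun B hB B' hB' v hv hv' => by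
      rw [BinaryTree.mem_treesOfNumNodesEq] at hB hB'
      exact openChamber_unique hB hB' ((mem_openCone_chamberMatrix hB v).1 hv).1
        ((mem_openCone_chamberMatrix hB' v).1 hv').1)
    ae_cover_chambers
  rw [h1, ENNReal.ofReal_eq_ofReal_iff] at h2
  rotate_left
  · exact Finset.sum_nonneg fun F hF => div_nonneg (abs_nonneg _)
      (Finset.prod_nonneg fun i _ => (hwF F hF i).le)
  · exact Finset.sum_nonneg fun B hB => div_nonneg (abs_nonneg _)
      (Finset.prod_nonneg fun i _ => (hwB B hB i).le)
  -- The direction 𝟏 contributes the same factor 1/N to every cone of both tilings, so it cancels.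
  have e1 : ∀ F ∈ T, |(bordered (d := m + 1) F).det| / ∏ i, wF F i =
      |(bordered (d := m + 1) F).det| / (∏ i, H (F i)) * N⁻¹ := by
    intro F _
    rw [Fin.prod_univ_castSucc]
    simp only [wF, Fin.snoc_castSucc, Fin.snoc_last]
    rw [div_mul_eq_div_div, div_eq_mul_inv _ N]
  have e2 : ∀ B ∈ BinaryTree.treesOfNumNodesEq (m + 1),
      |(chamberMatrix m B).det| / ∏ k, wB B k =
      1 / (∏ k ∈ Finset.univ.erase (rootFin m B),
        -pairSum x (Finset.Ico (lowEnd B 0 k) (highEnd B 0 k))) * N⁻¹ := by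
    intro B hB
    rw [BinaryTree.mem_treesOfNumNodesEq] at hB
    rw [det_chamberMatrix hB, abs_one, ← Finset.mul_prod_erase _ _ (Finset.mem_univ (rootFin m B))]
    simp only [wB, if_true]
    rw [mul_comm N, div_mul_eq_div_div, div_eq_mul_inv _ N]
    have e : ∀ k ∈ Finset.univ.erase (rootFin m B), (if k = rootFin m B then N else
        -pairSum x (Finset.Ico (lowEnd B 0 k) (highEnd B 0 k))) =
        -pairSum x (Finset.Ico (lowEnd B 0 k) (highEnd B 0 k)) := fun k hk =>
      if_neg (Finset.ne_of_mem_erase hk)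
    rw [Finset.prod_congr rfl e]
  rw [Finset.sum_congr rfl e1, Finset.sum_congr rfl e2, ← Finset.sum_mul, ← Finset.sum_mul] at h2
  exact mul_right_cancel₀ (inv_ne_zero hN.ne') h2

/-- The sum is, up to sign and a positive factor, the denominator at a generator of `T` proportional
to the ray of [α, β). -/
theorem IsConeTriangulation.pairSum_ne_zero
    (hT : IsConeTriangulation {v : Fin (m + 1) → ℝ | totalMin v = 0} T)
    {K : Type*} [Field K] [Algebra ℝ K] {x : IntervalIdx (m + 1) → K} (hx : ∑ p, x p = 0)
    (hreg : RegularAt (d := m + 1) (lodaySimplex (m + 1)) T x 0) {α β : ℕ} (hαβ : α < β)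
    (hβ : β ≤ m + 1) (hne : ¬ (α = 0 ∧ β = m + 1)) : pairSum x (Finset.Ico α β) ≠ 0 := by
  intro h0
  obtain ⟨F, hF, i, c, hc, hFi⟩ := hT.exists_smul_ray hαβ hβ hne
  refine hreg F hF i ?_
  rw [mixedSupport_eq, hFi]
  simp only [intervalMin_smul _ _ hc.le, map_mul, mul_left_comm (x _), ← Finset.mul_sum]
  rw [sum_mul_intervalMin_ray x hx, h0, mul_zero, neg_zero]

/-- The coordinates on the hyperplane `∑ p, x p = 0`, as linear forms in the coordinates other
than the one of the full interval. -/
def hyperplaneCoord (m : ℕ) (p : IntervalIdx (m + 1)) : MvPolynomial (IntervalIdx (m + 1)) ℝ :=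
  if p = fullIdx m then -∑ q ∈ Finset.univ.erase (fullIdx m), MvPolynomial.X q
  else MvPolynomial.X p

theorem aeval_hyperplaneCoord {K : Type*} [Field K] [Algebra ℝ K] {x : IntervalIdx (m + 1) → K}
    (hx : ∑ p, x p = 0) (p : IntervalIdx (m + 1)) :
    MvPolynomial.aeval x (hyperplaneCoord m p) = x p := by
  unfold hyperplaneCoord
  split_ifs with h
  · rw [← Finset.add_sum_erase _ _ (Finset.mem_univ (fullIdx m))] at hx
    simp only [map_neg, map_sum, MvPolynomial.aeval_X, h]
    exact (eq_neg_of_add_eq_zero_left hx).symm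
  · simp

theorem sum_hyperplaneCoord : ∑ p, hyperplaneCoord m p = 0 := by
  have h : ∀ p ∈ Finset.univ.erase (fullIdx m), hyperplaneCoord m p = MvPolynomial.X p :=
    fun p hp => if_neg (Finset.ne_of_mem_erase hp)
  rw [← Finset.add_sum_erase _ _ (Finset.mem_univ (fullIdx m)), Finset.sum_congr rfl h,
    hyperplaneCoord, if_pos rfl, neg_add_cancel]

/-- The point of the hyperplane `∑ p, x p = 0` with given coordinates. -/
def hyperplanePoint {K : Type*} [Field K] [Algebra ℝ K] (y : IntervalIdx (m + 1) → K) :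
    IntervalIdx (m + 1) → K :=
  fun p => MvPolynomial.aeval y (hyperplaneCoord m p)

theorem hyperplanePoint_eq {K : Type*} [Field K] [Algebra ℝ K] {x : IntervalIdx (m + 1) → K}
    (hx : ∑ p, x p = 0) : hyperplanePoint x = x :=
  funext fun p => aeval_hyperplaneCoord hx p

theorem sum_hyperplanePoint {K : Type*} [Field K] [Algebra ℝ K] (y : IntervalIdx (m + 1) → K) :
    ∑ p, hyperplanePoint y p = 0 := by
  unfold hyperplanePoint
  rw [← map_sum, sum_hyperplaneCoord, map_zero]

theorem hyperplanePoint_of_ne {K : Type*} [Field K] [Algebra ℝ K] (y : IntervalIdx (m + 1) → K)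
    {p : IntervalIdx (m + 1)} (hp : p ≠ fullIdx m) : hyperplanePoint y p = y p := by
  simp [hyperplanePoint, hyperplaneCoord, hp]

/-- The denominator of the cone of `F`, as a polynomial on the hyperplane. -/
def conePoly (F : Fin m → Fin (m + 1) → ℝ) : MvPolynomial (IntervalIdx (m + 1)) ℝ :=
  ∏ i, -∑ p, hyperplaneCoord m p * MvPolynomial.C (intervalMin p (F i))

/-- The denominator of the tree `B`, up to sign, as a polynomial on the hyperplane. -/
def treePoly (m : ℕ) (B : BinaryTree Unit) : MvPolynomial (IntervalIdx (m + 1)) ℝ :=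
  ∏ k ∈ Finset.univ.erase (rootFin m B), -∑ p : IntervalIdx (m + 1) with
    (p.1.1 : ℕ) ∈ Finset.Ico (lowEnd B 0 k) (highEnd B 0 k) ∧
    (p.1.2 : ℕ) ∈ Finset.Ico (lowEnd B 0 k) (highEnd B 0 k), hyperplaneCoord m p

theorem aeval_conePoly {K : Type*} [Field K] [Algebra ℝ K] (y : IntervalIdx (m + 1) → K)
    (F : Fin m → Fin (m + 1) → ℝ) : MvPolynomial.aeval y (conePoly F) =
      ∏ i, mixedSupport (lodaySimplex (m + 1)) (hyperplanePoint y) 0 (F i) := by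
  simp only [conePoly, mixedSupport_eq, map_prod, map_neg, map_sum, map_mul,
    MvPolynomial.aeval_C, hyperplanePoint]

theorem aeval_treePoly {K : Type*} [Field K] [Algebra ℝ K] (y : IntervalIdx (m + 1) → K)
    (B : BinaryTree Unit) : MvPolynomial.aeval y (treePoly m B) =
      ∏ k ∈ Finset.univ.erase (rootFin m B),
        -pairSum (hyperplanePoint y) (Finset.Ico (lowEnd B 0 k) (highEnd B 0 k)) := by
  simp only [treePoly, pairSum, map_prod, map_neg, map_sum, hyperplanePoint]

theorem prod_pairSum_eq (hB : B.numNodes = m + 1) {K : Type*} [Field K]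
    (x : IntervalIdx (m + 1) → K) :
    ((lowerSets (searchLabel B 0)).map fun L => 1 / pairSum x L).prod =
      ∏ k ∈ Finset.univ.erase (rootFin m B),
        1 / pairSum x (Finset.Ico (lowEnd B 0 k) (highEnd B 0 k)) := by
  rw [prod_lowerSets, hB, zero_add]
  symm
  refine Finset.prod_bij (fun k _ => (k : ℕ)) (fun k hk => ?_) (fun _ _ _ _ h => Fin.ext h)
    (fun k hk => ?_) (fun _ _ => rfl)
  · rw [Finset.mem_erase] at hk ⊢
    rw [← rootFin_val hB, Finset.mem_Ico]
    exact ⟨fun h => hk.1 (Fin.ext h), Nat.zero_le _, k.2⟩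
  · rw [Finset.mem_erase, Finset.mem_Ico, ← rootFin_val hB] at hk
    exact ⟨⟨k, hk.2.2⟩, Finset.mem_erase.2 ⟨fun h => hk.1 (by rw [← h]), Finset.mem_univ _⟩, rfl⟩

theorem hyperplaneDualMixedVolume_eq_binaryTreeSum
    (hT : IsBoundaryTriangulation (d := m + 1) (lodaySimplex (m + 1)) T) {K : Type*} [Field K]
    [Algebra ℝ K] {x : IntervalIdx (m + 1) → K} (hx : ∑ p, x p = 0)
    (hreg : RegularAt (d := m + 1) (lodaySimplex (m + 1)) T x 0) :
    hyperplaneDualMixedVolume (d := m + 1) (lodaySimplex (m + 1)) T x 0 =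
      (-1) ^ m * binaryTreeSum (m + 1) x := by
  classical
  have hT' := isConeTriangulation_of_boundary hT
  -- Cones and trees are merged into one index set, the trees with coefficient -1, so that the claim
  -- is the vanishing of a single sum of fractions.
  let c : (Fin m → Fin (m + 1) → ℝ) ⊕ BinaryTree Unit → ℝ :=
    Sum.elim (fun F => |(bordered (d := m + 1) F).det|) fun _ => -1
  let D : (Fin m → Fin (m + 1) → ℝ) ⊕ BinaryTree Unit → MvPolynomial (IntervalIdx (m + 1)) ℝ :=
    Sum.elim conePoly (treePoly m)
  have hpoint := hyperplanePoint_eq hx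
  have hD : ∀ k ∈ T.disjSum (BinaryTree.treesOfNumNodesEq (m + 1)),
      MvPolynomial.aeval x (D k) ≠ 0 := by
    rintro (F | B) hk
    · simp only [D, Sum.elim_inl, aeval_conePoly, hpoint]
      exact Finset.prod_ne_zero_iff.2 fun i _ => hreg F (Finset.inl_mem_disjSum.1 hk) i
    · have hB := BinaryTree.mem_treesOfNumNodesEq.1 (Finset.inr_mem_disjSum.1 hk)
      simp only [D, Sum.elim_inr, aeval_treePoly, hpoint]
      refine Finset.prod_ne_zero_iff.2 fun k hk => neg_ne_zero.2 ?_
      have hb := ends_fin_bounds hB k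
      exact hT'.pairSum_ne_zero hx hreg (by omega) (by omega) fun h =>
        Finset.ne_of_mem_erase hk ((ends_eq_root hB).1 h)
  have key := sum_div_eq_zero_of_real (T.disjSum (BinaryTree.treesOfNumNodesEq (m + 1))) c D
    (fun y hy => ?_) x hD
  · rw [Finset.sum_disjSum, ← eq_neg_iff_add_eq_zero, ← Finset.sum_neg_distrib] at key
    simp only [c, D, Sum.elim_inl, Sum.elim_inr, aeval_conePoly, aeval_treePoly, hpoint] at key
    unfold hyperplaneDualMixedVolume binaryTreeSum
    rw [Finset.mul_sum]
    refine key.trans (Finset.sum_congr rfl fun B hB => ?_)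
    rw [BinaryTree.mem_treesOfNumNodesEq] at hB
    -- Each of the `m` nodes other than the root contributes one sign.
    rw [prod_pairSum_eq hB, Finset.prod_neg, Finset.card_erase_of_mem (Finset.mem_univ _),
      Finset.card_univ, Fintype.card_fin, Nat.add_sub_cancel]
    simp only [one_div, Finset.prod_inv_distrib, map_neg, map_one, neg_div, neg_neg, mul_inv,
      ← inv_pow, inv_neg, inv_one]
  · have hy' : ∀ p, p ≠ fullIdx m → hyperplanePoint y p < 0 := fun p hp => by
      rw [hyperplanePoint_of_ne y hp]
      exact hy p
    constructor
    · rintro (F | B) hk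
      · simp only [D, Sum.elim_inl, aeval_conePoly]
        exact Finset.prod_ne_zero_iff.2 fun i _ => (hT'.mixedSupport_generator_pos
          (sum_hyperplanePoint y) hy' (Finset.inl_mem_disjSum.1 hk) i).ne'
      · have hB := BinaryTree.mem_treesOfNumNodesEq.1 (Finset.inr_mem_disjSum.1 hk)
        simp only [D, Sum.elim_inr, aeval_treePoly]
        exact Finset.prod_ne_zero_iff.2 fun k hk =>
          (neg_pos.2 (pairSum_ends_neg hB hy' (Finset.ne_of_mem_erase hk))).ne'
    · rw [Finset.sum_disjSum]
      simp only [c, D, Sum.elim_inl, Sum.elim_inr, aeval_conePoly, aeval_treePoly]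
      rw [hT'.sum_eq_of_neg (sum_hyperplanePoint y) hy', ← Finset.sum_add_distrib]
      exact Finset.sum_eq_zero fun B _ => by rw [neg_div, add_neg_cancel]

theorem regularAt_of_neg (hT : IsBoundaryTriangulation (d := m + 1) (lodaySimplex (m + 1)) T)
    {x : IntervalIdx (m + 1) → ℝ} (hx : ∑ p, x p = 0) (hneg : ∀ p, p ≠ fullIdx m → x p < 0) :
    RegularAt (d := m + 1) (lodaySimplex (m + 1)) T x 0 :=
  fun _ hF i =>
    ((isConeTriangulation_of_boundary hT).mixedSupport_generator_pos hx hneg hF i).ne'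

end RationalIdentity

/-! ### Positions in a plane binary tree

The leaf `i` of the full binary tree of `B` sits at the position `2 * i`, the node `k` at the
position `2 * k + 1`. -/

/-- The position of the topmost vertex. -/
def topPos : BinaryTree Unit → ℕ → ℕ
  | .nil, a => 2 * a
  | .node _ l _, a => 2 * (a + l.numNodes) + 1

/-- The position of the parent of the vertex at the position `x`, where `p` is the parent of the
topmost vertex. -/
def parPos : BinaryTree Unit → ℕ → ℕ → ℕ → ℕ
  | .nil, _, p, _ => p
  | .node _ l r, a, p, x =>
      if x < 2 * (a + l.numNodes) + 1 then parPos l a (2 * (a + l.numNodes) + 1) x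
      else if x = 2 * (a + l.numNodes) + 1 then p
      else parPos r (a + l.numNodes + 1) (2 * (a + l.numNodes) + 1) x

/-- The position of the left child of the node `k`. -/
def leftPos : BinaryTree Unit → ℕ → ℕ → ℕ
  | .nil, _, _ => 0
  | .node _ l r, a, k =>
      if k < a + l.numNodes then leftPos l a k
      else if k = a + l.numNodes then topPos l a
      else leftPos r (a + l.numNodes + 1) k

/-- The position of the right child of the node `k`. -/
def rightPos : BinaryTree Unit → ℕ → ℕ → ℕ
  | .nil, _, _ => 0
  | .node _ l r, a, k =>
      if k < a + l.numNodes then rightPos l a k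
      else if k = a + l.numNodes then topPos r (a + l.numNodes + 1)
      else rightPos r (a + l.numNodes + 1) k

section Positions

variable {u : Unit} {l r B : BinaryTree Unit} {a p x k : ℕ}

theorem parPos_left (h : x < 2 * (a + l.numNodes) + 1) :
    parPos (.node u l r) a p x = parPos l a (2 * (a + l.numNodes) + 1) x := by
  simp [parPos, h]

theorem parPos_root : parPos (.node u l r) a p (2 * (a + l.numNodes) + 1) = p := by
  simp [parPos]

theorem parPos_right (h : 2 * (a + l.numNodes) + 1 < x) :
    parPos (.node u l r) a p x = parPos r (a + l.numNodes + 1) (2 * (a + l.numNodes) + 1) x := by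
  simp [parPos, h.ne', not_lt.2 h.le]

theorem leftPos_left (h : k < a + l.numNodes) :
    leftPos (.node u l r) a k = leftPos l a k := by simp [leftPos, h]

theorem leftPos_root : leftPos (.node u l r) a (a + l.numNodes) = topPos l a := by
  simp [leftPos]

theorem leftPos_right (h : a + l.numNodes < k) :
    leftPos (.node u l r) a k = leftPos r (a + l.numNodes + 1) k := by
  simp [leftPos, h.ne', not_lt.2 h.le]

theorem rightPos_left (h : k < a + l.numNodes) :
    rightPos (.node u l r) a k = rightPos l a k := by simp [rightPos, h]

theorem rightPos_root :
    rightPos (.node u l r) a (a + l.numNodes) = topPos r (a + l.numNodes + 1) := by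
  simp [rightPos]

theorem rightPos_right (h : a + l.numNodes < k) :
    rightPos (.node u l r) a k = rightPos r (a + l.numNodes + 1) k := by
  simp [rightPos, h.ne', not_lt.2 h.le]

theorem topPos_mem : 2 * a ≤ topPos B a ∧ topPos B a ≤ 2 * (a + B.numNodes) := by
  cases B with
  | nil => simp [topPos]
  | node u l r => simp only [topPos, BinaryTree.numNodes]; omega

theorem parPos_topPos : parPos B a p (topPos B a) = p := by
  cases B with
  | nil => rfl
  | node u l r => exact parPos_root

theorem leftPos_mem (h1 : a ≤ k) (h2 : k < a + B.numNodes) :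
    2 * a ≤ leftPos B a k ∧ leftPos B a k < 2 * k + 1 := by
  induction B generalizing a with
  | nil => simp at h2; omega
  | node u l r ihl ihr =>
    simp only [BinaryTree.numNodes] at h2
    rcases lt_trichotomy k (a + l.numNodes) with h | rfl | h
    · rw [leftPos_left h]; exact ihl h1 h
    · rw [leftPos_root]; have := @topPos_mem l a; omega
    · rw [leftPos_right h]; have := @ihr (a + l.numNodes + 1) (by omega) (by omega); omega

theorem rightPos_mem (h1 : a ≤ k) (h2 : k < a + B.numNodes) :
    2 * k + 1 < rightPos B a k ∧ rightPos B a k ≤ 2 * (a + B.numNodes) := by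
  induction B generalizing a with
  | nil => simp at h2; omega
  | node u l r ihl ihr =>
    simp only [BinaryTree.numNodes] at h2 ⊢
    rcases lt_trichotomy k (a + l.numNodes) with h | rfl | h
    · rw [rightPos_left h]; have := ihl h1 h; omega
    · rw [rightPos_root]; have := @topPos_mem r (a + l.numNodes + 1); omega
    · rw [rightPos_right h]; have := @ihr (a + l.numNodes + 1) (by omega) (by omega); omega

theorem parPos_leftPos (h1 : a ≤ k) (h2 : k < a + B.numNodes) :
    parPos B a p (leftPos B a k) = 2 * k + 1 := by
  induction B generalizing a p with
  | nil => simp at h2; omega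
  | node u l r ihl ihr =>
    simp only [BinaryTree.numNodes] at h2
    rcases lt_trichotomy k (a + l.numNodes) with h | rfl | h
    · have := leftPos_mem h1 h
      rw [leftPos_left h, parPos_left (by omega)]; exact ihl h1 h
    · have := @topPos_mem l a
      rw [leftPos_root, parPos_left (by omega), parPos_topPos]
    · have := leftPos_mem (B := r) (a := a + l.numNodes + 1) (k := k) (by omega) (by omega)
      rw [leftPos_right h, parPos_right (by omega)]; exact ihr (by omega) (by omega)

theorem parPos_rightPos (h1 : a ≤ k) (h2 : k < a + B.numNodes) :
    parPos B a p (rightPos B a k) = 2 * k + 1 := by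
  induction B generalizing a p with
  | nil => simp at h2; omega
  | node u l r ihl ihr =>
    simp only [BinaryTree.numNodes] at h2
    rcases lt_trichotomy k (a + l.numNodes) with h | rfl | h
    · have := rightPos_mem h1 h
      rw [rightPos_left h, parPos_left (by omega)]; exact ihl h1 h
    · have := @topPos_mem r (a + l.numNodes + 1)
      rw [rightPos_root, parPos_right (by omega), parPos_topPos]
    · have := rightPos_mem (B := r) (a := a + l.numNodes + 1) (k := k) (by omega) (by omega)
      rw [rightPos_right h, parPos_right (by omega)]; exact ihr (by omega) (by omega)

/-- Every vertex other than the topmost one is a child of a node. -/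
theorem eq_topPos_or_child (h1 : 2 * a ≤ x) (h2 : x ≤ 2 * (a + B.numNodes)) :
    x = topPos B a ∨ ∃ k, a ≤ k ∧ k < a + B.numNodes ∧
      (x = leftPos B a k ∨ x = rightPos B a k) := by
  induction B generalizing a with
  | nil => left; simp at h2; simp only [topPos]; omega
  | node u l r ihl ihr =>
    simp only [BinaryTree.numNodes] at h2 ⊢
    rcases lt_trichotomy x (2 * (a + l.numNodes) + 1) with h | h | h
    · right
      rcases ihl h1 (by omega) with rfl | ⟨k, h3, h4, h5⟩
      · exact ⟨a + l.numNodes, by omega, by omega, Or.inl leftPos_root.symm⟩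
      · exact ⟨k, h3, by omega, by rwa [leftPos_left h4, rightPos_left h4]⟩
    · exact Or.inl h
    · right
      rcases @ihr (a + l.numNodes + 1) (by omega) (by omega) with rfl | ⟨k, h3, h4, h5⟩
      · exact ⟨a + l.numNodes, by omega, by omega, Or.inr rightPos_root.symm⟩
      · refine ⟨k, by omega, by omega, ?_⟩
        rwa [leftPos_right (by omega), rightPos_right (by omega)]

/-- Induction from the topmost vertex downwards. -/
theorem position_induction {S : ℕ → Prop} (htop : S (topPos B a))
    (hstep : ∀ k, a ≤ k → k < a + B.numNodes → S (2 * k + 1) →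
      S (leftPos B a k) ∧ S (rightPos B a k)) :
    ∀ x, 2 * a ≤ x → x ≤ 2 * (a + B.numNodes) → S x := by
  induction B generalizing a with
  | nil =>
    intro x h1 h2
    have : x = 2 * a := by simp at h2; omega
    exact this ▸ htop
  | node u l r ihl ihr =>
    intro x h1 h2
    simp only [BinaryTree.numNodes] at h2 hstep
    have hroot := hstep (a + l.numNodes) (by omega) (by omega) htop
    rw [leftPos_root, rightPos_root] at hroot
    rcases lt_trichotomy x (2 * (a + l.numNodes) + 1) with h | h | h
    · refine ihl hroot.1 (fun k h3 h4 hk => ?_) x h1 (by omega)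
      have := hstep k h3 (by omega) hk
      rwa [leftPos_left h4, rightPos_left h4] at this
    · exact h ▸ htop
    · refine ihr hroot.2 (fun k h3 h4 hk => ?_) x (by omega) (by omega)
      have := hstep k (by omega) (by omega) hk
      rwa [leftPos_right (by omega), rightPos_right (by omega)] at this

theorem parPos_cases (h1 : 2 * a ≤ x) (h2 : x ≤ 2 * (a + B.numNodes)) :
    (x = topPos B a ∧ parPos B a p x = p) ∨ ∃ k, a ≤ k ∧ k < a + B.numNodes ∧
      parPos B a p x = 2 * k + 1 ∧ (x = leftPos B a k ∨ x = rightPos B a k) := by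
  rcases eq_topPos_or_child h1 h2 with rfl | ⟨k, h3, h4, h5⟩
  · exact Or.inl ⟨rfl, parPos_topPos⟩
  · refine Or.inr ⟨k, h3, h4, ?_, h5⟩
    rcases h5 with rfl | rfl
    · exact parPos_leftPos h3 h4
    · exact parPos_rightPos h3 h4

/-- The position `x` is at or below the node `k`. -/
def PosBelow (B : BinaryTree Unit) (a x k : ℕ) : Prop :=
  2 * lowEnd B a k ≤ x ∧ x ≤ 2 * highEnd B a k

theorem parPos_below (h1 : a ≤ k) (h2 : k < a + B.numNodes) (h : PosBelow B a x k)
    (hx : x ≠ 2 * k + 1) : PosBelow B a (parPos B a p x) k := by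
  induction B generalizing a p with
  | nil => simp at h2; omega
  | node u l r ihl ihr =>
    have hb := ends_bounds h1 h2
    unfold PosBelow at h ⊢
    simp only [BinaryTree.numNodes] at h2 hb
    rcases lt_trichotomy k (a + l.numNodes) with hk | rfl | hk
    · rw [lowEnd_left hk, highEnd_left hk] at h ⊢
      have := ends_bounds h1 hk
      rw [parPos_left (by omega)]
      exact ihl h1 hk h
    · rw [lowEnd_root, highEnd_root] at h ⊢
      rcases @parPos_cases (.node u l r) a p x (by omega)
        (by simp only [BinaryTree.numNodes]; omega) with ⟨h3, -⟩ | ⟨k, h3, h4, h5, -⟩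
      · exact absurd h3 hx
      · rw [h5]; simp only [BinaryTree.numNodes] at h4; omega
    · rw [lowEnd_right hk, highEnd_right hk] at h ⊢
      have := ends_bounds (B := r) (a := a + l.numNodes + 1) (k := k) (by omega) (by omega)
      rw [parPos_right (by omega)]
      exact ihr (by omega) (by omega) h

/-- Climbing from outside the subtree of `k`, or from `k` itself, never leads into that subtree. The
parent `p` of the top has to lie outside the range of positions. This is how cycles are excluded
later. -/
theorem parPos_not_below (hp : p < 2 * a ∨ 2 * (a + B.numNodes) < p) (h1 : a ≤ k)
    (h2 : k < a + B.numNodes) (hx1 : 2 * a ≤ x) (hx2 : x ≤ 2 * (a + B.numNodes))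
    (h : ¬ PosBelow B a x k ∨ x = 2 * k + 1) : ¬ PosBelow B a (parPos B a p x) k := by
  induction B generalizing a p with
  | nil => simp at h2; omega
  | node u l r ihl ihr =>
    have hb := ends_bounds h1 h2
    unfold PosBelow at h ⊢
    simp only [BinaryTree.numNodes] at h2 hb hp hx2
    rcases lt_trichotomy k (a + l.numNodes) with hk | rfl | hk
    · rw [lowEnd_left hk, highEnd_left hk] at h ⊢
      have := ends_bounds h1 hk
      rcases lt_trichotomy x (2 * (a + l.numNodes) + 1) with hx | rfl | hx
      · rw [parPos_left hx]
        exact ihl (by omega) h1 hk hx1 (by omega) h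
      · rw [parPos_root]; omega
      · rw [parPos_right hx]
        rcases @parPos_cases r (a + l.numNodes + 1) (2 * (a + l.numNodes) + 1) x (by omega)
          (by omega) with ⟨-, h3⟩ | ⟨k', h3, h4, h5, -⟩ <;> omega
    · rw [lowEnd_root, highEnd_root] at h ⊢
      have hx : x = 2 * (a + l.numNodes) + 1 := by omega
      rw [hx, parPos_root]; omega
    · rw [lowEnd_right hk, highEnd_right hk] at h ⊢
      have := ends_bounds (B := r) (a := a + l.numNodes + 1) (k := k) (by omega) (by omega)
      rcases lt_trichotomy x (2 * (a + l.numNodes) + 1) with hx | rfl | hx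
      · rw [parPos_left hx]
        rcases @parPos_cases l a (2 * (a + l.numNodes) + 1) x (by omega)
          (by omega) with ⟨-, h3⟩ | ⟨k', h3, h4, h5, -⟩ <;> omega
      · rw [parPos_root]; omega
      · rw [parPos_right hx]
        exact ihr (by omega) (by omega) (by omega) (by omega) (by omega) h

theorem posBelow_self (h1 : a ≤ k) (h2 : k < a + B.numNodes) : PosBelow B a (2 * k + 1) k := by
  have := ends_bounds h1 h2
  unfold PosBelow; omega

theorem topPos_eq_iff (h1 : a ≤ k) (h2 : k < a + B.numNodes) :
    2 * k + 1 = topPos B a ↔ k = rootLabel B a := by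
  cases B with
  | nil => simp at h2; omega
  | node u l r => simp only [topPos, rootLabel]; omega

end Positions

/-! ### Drawings of plane binary trees -/

section Drawing

variable {n : ℕ} {rot : Fin (n + 2 - 2) → CubicVertex (n + 2) → CubicVertex (n + 2)}
  {Φ : ℕ → CubicVertex (n + 2)} {u : Unit} {l r B : BinaryTree Unit} {a p : ℕ}

/-- `Φ` maps the positions of the tree `B` to the vertices of a rotation system. -/
structure IsDrawing (rot : Fin (n + 2 - 2) → CubicVertex (n + 2) → CubicVertex (n + 2))
    (Φ : ℕ → CubicVertex (n + 2)) (B : BinaryTree Unit) (a p : ℕ) : Prop where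
  leaf : ∀ i, a ≤ i → i ≤ a + B.numNodes → Φ (2 * i) = Sum.inl (Fin.ofNat (n + 2) i)
  node : ∀ k, a ≤ k → k < a + B.numNodes → ∃ κ, Φ (2 * k + 1) = Sum.inr κ ∧
    rot κ (Φ (parPos B a p (2 * k + 1))) = Φ (leftPos B a k) ∧
    rot κ (Φ (leftPos B a k)) = Φ (rightPos B a k) ∧
    rot κ (Φ (rightPos B a k)) = Φ (parPos B a p (2 * k + 1))

theorem IsDrawing.left (h : IsDrawing rot Φ (.node u l r) a p) :
    IsDrawing rot Φ l a (2 * (a + l.numNodes) + 1) where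
  leaf i h1 h2 := h.leaf i h1 (by simp only [BinaryTree.numNodes]; omega)
  node k h1 h2 := by
    have := h.node k h1 (by simp only [BinaryTree.numNodes]; omega)
    rwa [leftPos_left h2, rightPos_left h2, parPos_left (by omega)] at this

theorem IsDrawing.right (h : IsDrawing rot Φ (.node u l r) a p) :
    IsDrawing rot Φ r (a + l.numNodes + 1) (2 * (a + l.numNodes) + 1) where
  leaf i h1 h2 := h.leaf i (by omega) (by simp only [BinaryTree.numNodes]; omega)
  node k h1 h2 := by
    have := h.node k (by omega) (by simp only [BinaryTree.numNodes]; omega)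
    rwa [leftPos_right (by omega), rightPos_right (by omega), parPos_right (by omega)] at this

theorem IsDrawing.root (h : IsDrawing rot Φ (.node u l r) a p) :
    ∃ κ, Φ (2 * (a + l.numNodes) + 1) = Sum.inr κ ∧ rot κ (Φ p) = Φ (topPos l a) ∧
      rot κ (Φ (topPos l a)) = Φ (topPos r (a + l.numNodes + 1)) ∧
      rot κ (Φ (topPos r (a + l.numNodes + 1))) = Φ p := by
  have := h.node (a + l.numNodes) (by omega) (by simp only [BinaryTree.numNodes]; omega)
  rwa [leftPos_root, rightPos_root, parPos_root] at this

/-- A walk that enters from above turns to the left child at every node. -/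
theorem IsDrawing.firstLeaf_top (h : IsDrawing rot Φ B a p) :
    FirstLeaf rot (Φ p) (Φ (topPos B a)) (Fin.ofNat (n + 2) a) := by
  induction B generalizing a p with
  | nil =>
    rw [topPos, h.leaf a le_rfl (by simp)]
    exact .atLeaf _ _
  | node u l r ihl ihr =>
    obtain ⟨κ, h1, h2, h3, h4⟩ := h.root
    have := ihl h.left
    rw [h1, ← h2] at this
    rw [topPos, h1]
    exact .atInterior _ _ _ this

/-- The walk from a leaf of `B` other than the last one leads to the next leaf, and the walk
from the last one leaves the tree. -/
theorem IsDrawing.firstLeaf_leaf (h : IsDrawing rot Φ B a p) :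
    (∀ i, a ≤ i → i < a + B.numNodes →
      FirstLeaf rot (Φ (2 * i)) (Φ (parPos B a p (2 * i))) (Fin.ofNat (n + 2) (i + 1))) ∧
    ∀ j, FirstLeaf rot (Φ (topPos B a)) (Φ p) j →
      FirstLeaf rot (Φ (2 * (a + B.numNodes))) (Φ (parPos B a p (2 * (a + B.numNodes)))) j := by
  induction B generalizing a p with
  | nil => exact ⟨fun i h1 h2 => by simp at h2; omega, fun j hj => hj⟩
  | node u l r ihl ihr =>
    obtain ⟨κ, h1, h2, h3, h4⟩ := h.root
    have hl := ihl h.left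
    have hr := ihr h.right
    have hlast : a + (BinaryTree.node u l r).numNodes = a + l.numNodes + 1 + r.numNodes := by
      simp only [BinaryTree.numNodes]; omega
    rw [hlast]
    refine ⟨fun i hi1 hi2 => ?_, fun j hj => ?_⟩
    · rcases lt_trichotomy i (a + l.numNodes) with hi | rfl | hi
      · rw [parPos_left (by omega)]
        exact hl.1 i hi1 hi
      · rw [parPos_left (by omega)]
        -- The last leaf of the left branch: the walk leaves that branch at its top and turns into
        -- the right branch, whose first leaf is the next one.
        refine hl.2 _ ?_
        have := h.right.firstLeaf_top
        rw [h1, ← h3] at this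
        rw [h1]
        exact .atInterior _ _ _ this
      · rw [parPos_right (by omega)]
        exact hr.1 i hi hi2
    · rw [parPos_right (by omega)]
      refine hr.2 _ ?_
      rw [topPos, h1, ← h4] at hj
      rw [h1]
      exact .atInterior _ _ _ hj

/-- The subtree entered from `u` through `v` in a rotation system is a drawing of `B` with the
leaves `a, a + 1, …`. -/
def Matches (rot : Fin (n + 2 - 2) → CubicVertex (n + 2) → CubicVertex (n + 2)) :
    BinaryTree Unit → ℕ → CubicVertex (n + 2) → CubicVertex (n + 2) → Prop
  | .nil, a, _, v => v = Sum.inl (Fin.ofNat (n + 2) a)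
  | .node _ l r, a, u, v => ∃ κ, v = Sum.inr κ ∧ rot κ (rot κ (rot κ u)) = u ∧
      Matches rot l a v (rot κ u) ∧
      Matches rot r (a + l.numNodes + 1) v (rot κ (rot κ u))

/-- A leaf can match only `nil` and an interior vertex only a node; the rotation then fixes the
edges through which the two branches are entered. -/
theorem Matches.unique {B' : BinaryTree Unit} {v w : CubicVertex (n + 2)}
    (h : Matches rot B a v w) (h' : Matches rot B' a v w) : B = B' := by
  induction B generalizing B' a v w with
  | nil =>
    cases B' with
    | nil => rfl
    | node u' l' r' =>
      obtain ⟨κ, h1, -⟩ := h'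
      unfold Matches at h
      rw [h] at h1
      cases h1
  | node u l r ihl ihr =>
    obtain ⟨κ, h1, -, h2, h3⟩ := h
    cases B' with
    | nil =>
      unfold Matches at h'
      rw [h'] at h1
      cases h1
    | node u' l' r' =>
      obtain ⟨κ', h1', -, h2', h3'⟩ := h'
      rw [h1] at h1'
      cases h1'
      cases ihl h2 h2'
      cases ihr h3 h3'
      rfl

theorem IsDrawing.matches (h : IsDrawing rot Φ B a p) :
    Matches rot B a (Φ p) (Φ (topPos B a)) := by
  induction B generalizing a p with
  | nil => exact h.leaf a le_rfl (by simp)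
  | node u l r ihl ihr =>
    obtain ⟨κ, h1, h2, h3, h4⟩ := h.root
    have hl := ihl h.left
    have hr := ihr h.right
    exact ⟨κ, h1, by rw [h2, h3, h4], by rw [h2]; exact hl, by rw [h2, h3]; exact hr⟩

theorem Matches.exists_isDrawing {v w : CubicVertex (n + 2)} (h : Matches rot B a v w) (p : ℕ)
    (hp : p < 2 * a ∨ 2 * (a + B.numNodes) < p) :
    ∃ Φ, IsDrawing rot Φ B a p ∧ Φ p = v ∧ Φ (topPos B a) = w := by
  induction B generalizing a p v w with
  | nil =>
    have hpa : ¬ 2 * a = p := by simp at hp; omega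
    refine ⟨fun x => if x = p then v else w, ⟨fun i h1 h2 => ?_, fun k h1 h2 => ?_⟩, ?_, ?_⟩
    · have : i = a := by simp at h2; omega
      subst this
      simp only [if_neg hpa]
      exact h
    · simp at h2; omega
    · simp
    · simp [topPos, hpa]
  | node u l r ihl ihr =>
    obtain ⟨κ, h1, h2, h3, h4⟩ := h
    set c := 2 * (a + l.numNodes) + 1 with hc
    simp only [BinaryTree.numNodes] at hp
    obtain ⟨Φl, hl1, hl2, hl3⟩ := ihl h3 c (by omega)
    obtain ⟨Φr, hr1, hr2, hr3⟩ := ihr h4 c (by omega)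
    -- The branches occupy the positions on the two sides of `c`, and both partial maps send `c`,
    -- the parent of their tops, to `w`. Overriding at `p` is harmless because `p` lies outside the
    -- range.
    let Φ : ℕ → CubicVertex (n + 2) := fun x =>
      if x = p then v else if x < c then Φl x else if x = c then w else Φr x
    have eL : ∀ x, 2 * a ≤ x → x < c → Φ x = Φl x := fun x hx1 hx2 => by
      simp only [Φ, if_pos hx2, if_neg (show x ≠ p by omega)]
    have eC : Φ c = w := by simp [Φ, show c ≠ p by omega]
    have eR : ∀ x, c < x → x ≤ 2 * (a + l.numNodes + 1 + r.numNodes) → Φ x = Φr x :=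
      fun x hx1 hx2 => by
        simp only [Φ, if_neg (show ¬ x < c by omega), if_neg (show x ≠ c by omega),
          if_neg (show x ≠ p by omega)]
    have eP : Φ p = v := by simp [Φ]
    have tl := @topPos_mem l a
    have tr := @topPos_mem r (a + l.numNodes + 1)
    have eTl : Φ (topPos l a) = rot κ v := by rw [eL _ tl.1 (by omega), hl3]
    have eTr : Φ (topPos r (a + l.numNodes + 1)) = rot κ (rot κ v) := by
      rw [eR _ (by omega) tr.2, hr3]
    refine ⟨Φ, ⟨fun i hi1 hi2 => ?_, fun k hk1 hk2 => ?_⟩, eP, eC⟩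
    · simp only [BinaryTree.numNodes] at hi2
      by_cases hi : i ≤ a + l.numNodes
      · rw [eL _ (by omega) (by omega)]
        exact hl1.leaf i hi1 hi
      · rw [eR _ (by omega) (by omega)]
        exact hr1.leaf i (by omega) (by omega)
    · simp only [BinaryTree.numNodes] at hk2
      rcases lt_trichotomy k (a + l.numNodes) with hk | rfl | hk
      · have b1 := leftPos_mem hk1 hk
        have b2 := rightPos_mem hk1 hk
        have ePar : Φ (parPos l a c (2 * k + 1)) = Φl (parPos l a c (2 * k + 1)) := by
          rcases @parPos_cases l a c (2 * k + 1) (by omega) (by omega) with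
            ⟨-, h5⟩ | ⟨k', h5, h6, h7, -⟩
          · rw [h5, eC, hl2]
          · rw [h7]; exact eL _ (by omega) (by omega)
        rw [leftPos_left hk, rightPos_left hk, parPos_left (by omega), ePar,
          eL _ (by omega) (by omega), eL _ (by omega) (by omega), eL _ (by omega) (by omega)]
        exact hl1.node k hk1 hk
      · rw [leftPos_root, rightPos_root, parPos_root, eTl, eTr, eP]
        exact ⟨κ, eC.trans h1, rfl, rfl, h2⟩
      · have b1 := leftPos_mem (B := r) (a := a + l.numNodes + 1) (k := k) (by omega) (by omega)
        have b2 := rightPos_mem (B := r) (a := a + l.numNodes + 1) (k := k) (by omega) (by omega)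
        have ePar : Φ (parPos r (a + l.numNodes + 1) c (2 * k + 1)) =
            Φr (parPos r (a + l.numNodes + 1) c (2 * k + 1)) := by
          rcases @parPos_cases r (a + l.numNodes + 1) c (2 * k + 1) (by omega) (by omega) with
            ⟨-, h5⟩ | ⟨k', h5, h6, h7, -⟩
          · rw [h5, eC, hr2]
          · rw [h7]; exact eR _ (by omega) (by omega)
        rw [leftPos_right hk, rightPos_right hk, parPos_right (by omega), ePar,
          eR _ (by omega) (by omega), eR _ (by omega) (by omega), eR _ (by omega) (by omega)]
        exact hr1.node k (by omega) (by omega)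

end Drawing

/-! ### The cubic tree of a plane binary tree -/

section TreeGraph

variable {n : ℕ}

/-- The position of a vertex; the leaf with the largest label is the parent of the topmost
vertex. -/
def vertexPos : CubicVertex (n + 2) → ℕ
  | .inl i => 2 * (i : ℕ)
  | .inr k => 2 * (k : ℕ) + 1

/-- The vertex at a position. -/
def vertexAt (n x : ℕ) : CubicVertex (n + 2) :=
  if h : x % 2 = 1 ∧ x / 2 < n then Sum.inr ⟨x / 2, h.2⟩ else Sum.inl (Fin.ofNat (n + 2) (x / 2))

theorem vertexAt_even {i : ℕ} : vertexAt n (2 * i) = Sum.inl (Fin.ofNat (n + 2) i) := by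
  simp [vertexAt]

theorem vertexAt_odd {k : ℕ} (h : k < n) : vertexAt n (2 * k + 1) = Sum.inr ⟨k, h⟩ := by
  have e1 : (2 * k + 1) / 2 = k := by omega
  have e2 : (2 * k + 1) % 2 = 1 := by omega
  simp only [vertexAt, e1, e2, h, and_self, dif_pos]

theorem vertexAt_vertexPos (v : CubicVertex (n + 2)) : vertexAt n (vertexPos v) = v := by
  rcases v with i | k
  · rw [vertexPos, vertexAt_even]
    congr 1
    exact Fin.ext (Nat.mod_eq_of_lt i.2)
  · rw [vertexPos, vertexAt_odd (show (k : ℕ) < n by omega)]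

/-- The positions at which there is a vertex. -/
def IsPos (n x : ℕ) : Prop := x ≤ 2 * n ∨ x = 2 * n + 2

theorem vertexPos_isPos (v : CubicVertex (n + 2)) : IsPos n (vertexPos v) := by
  unfold IsPos
  rcases v with i | k
  · simp only [vertexPos]; omega
  · simp only [vertexPos]; omega

theorem vertexPos_vertexAt {x : ℕ} (h : IsPos n x) : vertexPos (vertexAt n x) = x := by
  unfold IsPos at h
  rcases Nat.even_or_odd' x with ⟨i, rfl | rfl⟩
  · rw [vertexAt_even, vertexPos]
    simp only [Fin.ofNat]
    rw [Nat.mod_eq_of_lt (by omega)]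
  · rw [vertexAt_odd (by omega), vertexPos]

/-- The position of the parent in the tree `B`, hung up at the leaf with the largest label. -/
abbrev hungPar (n : ℕ) (B : BinaryTree Unit) (x : ℕ) : ℕ := parPos B 0 (2 * n + 2) x

/-- Adjacency of positions in the tree `B`. -/
def PosAdj (n : ℕ) (B : BinaryTree Unit) (x y : ℕ) : Prop :=
  (x ≠ 2 * n + 2 ∧ hungPar n B x = y) ∨ (y ≠ 2 * n + 2 ∧ hungPar n B y = x)

theorem PosAdj.symm {B : BinaryTree Unit} {x y : ℕ} (h : PosAdj n B x y) : PosAdj n B y x :=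
  Or.symm h

variable {B : BinaryTree Unit} (hB : B.numNodes = n)
include hB

theorem hungPar_cases {x : ℕ} (hx : x ≤ 2 * n) :
    (x = topPos B 0 ∧ hungPar n B x = 2 * n + 2) ∨ ∃ k < n, hungPar n B x = 2 * k + 1 ∧
      (x = leftPos B 0 k ∨ x = rightPos B 0 k) := by
  rcases @parPos_cases B 0 (2 * n + 2) x (by omega) (by omega) with h | ⟨k, -, h2, h3⟩
  · exact Or.inl h
  · exact Or.inr ⟨k, by omega, h3⟩

theorem hungPar_isPos {x : ℕ} (hx : x ≤ 2 * n) : IsPos n (hungPar n B x) := by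
  unfold IsPos
  rcases hungPar_cases hB hx with ⟨-, h⟩ | ⟨k, h1, h2, -⟩ <;> omega

theorem hungPar_ne {x : ℕ} (hx : x ≤ 2 * n) : hungPar n B x ≠ x := by
  rcases hungPar_cases hB hx with ⟨-, h⟩ | ⟨k, h1, h2, h3 | h3⟩
  · omega
  · have := leftPos_mem (B := B) (a := 0) (k := k) (by omega) (by omega); omega
  · have := rightPos_mem (B := B) (a := 0) (k := k) (by omega) (by omega); omega

theorem posAdj_node {k y : ℕ} (hk : k < n) (hy : IsPos n y) : PosAdj n B (2 * k + 1) y ↔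
    y = hungPar n B (2 * k + 1) ∨ y = leftPos B 0 k ∨ y = rightPos B 0 k := by
  have b1 := leftPos_mem (B := B) (a := 0) (k := k) (by omega) (by omega)
  have b2 := rightPos_mem (B := B) (a := 0) (k := k) (by omega) (by omega)
  constructor
  · rintro (⟨-, h⟩ | ⟨h1, h2⟩)
    · exact Or.inl h.symm
    · rcases hungPar_cases hB (x := y) (hy.resolve_right h1) with ⟨-, h⟩ | ⟨k', h3, h4, h5⟩
      · omega
      · have : k' = k := by omega
        exact Or.inr (this ▸ h5)
  · rintro (rfl | rfl | rfl)
    · exact Or.inl ⟨by omega, rfl⟩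
    · exact Or.inr ⟨by omega, parPos_leftPos (by omega) (by omega)⟩
    · exact Or.inr ⟨by omega, parPos_rightPos (by omega) (by omega)⟩

theorem posAdj_leaf {i y : ℕ} (hi : i ≤ n) (hy : IsPos n y) : PosAdj n B (2 * i) y ↔
    y = hungPar n B (2 * i) := by
  constructor
  · rintro (⟨-, h⟩ | ⟨h1, h2⟩)
    · exact h.symm
    · rcases hungPar_cases hB (x := y) (hy.resolve_right h1) with ⟨-, h⟩ | ⟨k', h3, h4, h5⟩ <;>
        omega
  · rintro rfl
    exact Or.inl ⟨by omega, rfl⟩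

theorem posAdj_root {y : ℕ} (hy : IsPos n y) : PosAdj n B (2 * n + 2) y ↔ y = topPos B 0 := by
  have ht := @topPos_mem B 0
  constructor
  · rintro (⟨h, -⟩ | ⟨h1, h2⟩)
    · exact absurd rfl h
    · rcases hungPar_cases hB (x := y) (hy.resolve_right h1) with ⟨h, -⟩ | ⟨k', h3, h4, h5⟩
      · exact h
      · omega
  · rintro rfl
    exact Or.inr ⟨by omega, parPos_topPos⟩

/-- If the parent of `k` were also its child, two steps up from `k` would leave the subtree of `k`
and return to it, against `parPos_not_below`. -/
theorem node_neighbors_distinct {k : ℕ} (hk : k < n) :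
    hungPar n B (2 * k + 1) ≠ leftPos B 0 k ∧ hungPar n B (2 * k + 1) ≠ rightPos B 0 k ∧
      leftPos B 0 k ≠ rightPos B 0 k := by
  have b1 := leftPos_mem (B := B) (a := 0) (k := k) (by omega) (by omega)
  have b2 := rightPos_mem (B := B) (a := 0) (k := k) (by omega) (by omega)
  have h0 := parPos_not_below (B := B) (a := 0) (p := 2 * n + 2) (k := k) (x := 2 * k + 1)
    (by omega) (by omega) (by omega) (by omega) (by omega) (Or.inr rfl)
  have key : ∀ x, x ≤ 2 * n → hungPar n B x = 2 * k + 1 → hungPar n B (2 * k + 1) ≠ x := by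
    intro x hx h1 h2
    have h3 : parPos B 0 (2 * n + 2) (2 * k + 1) = x := h2
    rw [h3] at h0
    refine parPos_not_below (B := B) (a := 0) (p := 2 * n + 2) (k := k) (x := x) (by omega)
      (by omega) (by omega) (by omega) (by omega) (Or.inl h0) ?_
    rw [show parPos B 0 (2 * n + 2) x = 2 * k + 1 from h1]
    exact posBelow_self (by omega) (by omega)
  exact ⟨key _ (by omega) (parPos_leftPos (by omega) (by omega)),
    key _ (by omega) (parPos_rightPos (by omega) (by omega)), by omega⟩

end TreeGraph

section TreeGraph

variable {n : ℕ} {B : BinaryTree Unit}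

/-- The graph of the cubic tree of `B`. -/
def treeGraph (hB : B.numNodes = n) : SimpleGraph (CubicVertex (n + 2)) where
  Adj u v := PosAdj n B (vertexPos u) (vertexPos v)
  symm := ⟨fun _ _ h => h.symm⟩
  loopless := ⟨fun v h => by
    rcases h with ⟨h1, h2⟩ | ⟨h1, h2⟩ <;>
      exact hungPar_ne hB ((vertexPos_isPos v).resolve_right h1) h2⟩

/-- The rotation system of the cubic tree of `B`. -/
def treeRot (n : ℕ) (B : BinaryTree Unit) (κ : Fin (n + 2 - 2)) (u : CubicVertex (n + 2)) :
    CubicVertex (n + 2) :=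
  if vertexPos u = hungPar n B (2 * κ + 1) then vertexAt n (leftPos B 0 κ)
  else if vertexPos u = leftPos B 0 κ then vertexAt n (rightPos B 0 κ)
  else vertexAt n (hungPar n B (2 * κ + 1))

theorem leftPos_isPos (hB : B.numNodes = n) {k : ℕ} (hk : k < n) : IsPos n (leftPos B 0 k) := by
  have b1 := leftPos_mem (B := B) (a := 0) (k := k) (by omega) (by omega)
  unfold IsPos; omega

theorem rightPos_isPos (hB : B.numNodes = n) {k : ℕ} (hk : k < n) :
    IsPos n (rightPos B 0 k) := by
  have b2 := rightPos_mem (B := B) (a := 0) (k := k) (by omega) (by omega)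
  unfold IsPos; omega

theorem isDrawing_treeRot (hB : B.numNodes = n) :
    IsDrawing (treeRot n B) (vertexAt n) B 0 (2 * n + 2) where
  leaf i _ _ := vertexAt_even
  node k _ h2 := by
    have hk : k < n := by omega
    have hd := node_neighbors_distinct hB hk
    have e1 := vertexPos_vertexAt (hungPar_isPos hB (x := 2 * k + 1) (by omega))
    refine ⟨⟨k, hk⟩, vertexAt_odd hk, ?_, ?_, ?_⟩
    · simp only [treeRot, e1, if_true]
    · simp only [treeRot, vertexPos_vertexAt (leftPos_isPos hB hk), hd.1.symm, if_false, if_true]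
    · simp only [treeRot, vertexPos_vertexAt (rightPos_isPos hB hk), hd.2.1.symm, hd.2.2.symm,
        if_false]

theorem eq_vertexAt_iff {x : ℕ} (hx : IsPos n x) (w : CubicVertex (n + 2)) :
    w = vertexAt n x ↔ vertexPos w = x := by
  constructor
  · rintro rfl; exact vertexPos_vertexAt hx
  · rintro rfl; exact (vertexAt_vertexPos w).symm

theorem neighborSet_node (hB : B.numNodes = n) (κ : Fin (n + 2 - 2)) :
    (treeGraph hB).neighborSet (Sum.inr κ) = {vertexAt n (hungPar n B (2 * κ + 1)),
      vertexAt n (leftPos B 0 κ), vertexAt n (rightPos B 0 κ)} := by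
  have hk : (κ : ℕ) < n := by omega
  ext w
  rw [SimpleGraph.mem_neighborSet, Set.mem_insert_iff, Set.mem_insert_iff, Set.mem_singleton_iff,
    eq_vertexAt_iff (hungPar_isPos hB (by omega)), eq_vertexAt_iff (leftPos_isPos hB hk),
    eq_vertexAt_iff (rightPos_isPos hB hk)]
  exact posAdj_node hB hk (vertexPos_isPos w)

theorem topPos_isPos (hB : B.numNodes = n) : IsPos n (topPos B 0) := by
  have := @topPos_mem B 0
  unfold IsPos; omega

theorem neighborSet_leaf (hB : B.numNodes = n) (i : Fin (n + 2)) :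
    (treeGraph hB).neighborSet (Sum.inl i) =
      {vertexAt n (if (i : ℕ) ≤ n then hungPar n B (2 * i) else topPos B 0)} := by
  ext w
  rw [SimpleGraph.mem_neighborSet, Set.mem_singleton_iff]
  split_ifs with hi
  · rw [eq_vertexAt_iff (hungPar_isPos hB (by omega))]
    exact posAdj_leaf hB hi (vertexPos_isPos w)
  · rw [eq_vertexAt_iff (topPos_isPos hB)]
    have h := posAdj_root hB (vertexPos_isPos w)
    have e : vertexPos (Sum.inl i : CubicVertex (n + 2)) = 2 * n + 2 := by
      rw [vertexPos]; omega
    rw [← e] at h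
    exact h

theorem ncard_neighborSet_node (hB : B.numNodes = n) (κ : Fin (n + 2 - 2)) :
    ((treeGraph hB).neighborSet (Sum.inr κ)).ncard = 3 := by
  have hk : (κ : ℕ) < n := by omega
  have hd := node_neighbors_distinct hB hk
  have hne : ∀ {x y : ℕ}, IsPos n x → IsPos n y → x ≠ y → vertexAt n x ≠ vertexAt n y :=
    fun hx hy hxy h => hxy (by
      rw [← vertexPos_vertexAt hx, ← vertexPos_vertexAt hy, h])
  have h1 := hungPar_isPos hB (x := 2 * κ + 1) (by omega)
  have h2 := leftPos_isPos hB hk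
  have h3 := rightPos_isPos hB hk
  rw [neighborSet_node, Set.ncard_eq_three]
  exact ⟨_, _, _, hne h1 h2 hd.1, hne h1 h3 hd.2.1, hne h2 h3 hd.2.2, rfl⟩

theorem ncard_neighborSet_leaf (hB : B.numNodes = n) (i : Fin (n + 2)) :
    ((treeGraph hB).neighborSet (Sum.inl i)).ncard = 1 := by
  rw [neighborSet_leaf, Set.ncard_singleton]

/-- A vertex is adjacent to its parent. -/
theorem treeGraph_adj_hungPar (hB : B.numNodes = n) {x : ℕ} (hx : x ≤ 2 * n) :
    (treeGraph hB).Adj (vertexAt n x) (vertexAt n (hungPar n B x)) := by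
  refine Or.inl ?_
  rw [vertexPos_vertexAt (Or.inl hx), vertexPos_vertexAt (hungPar_isPos hB hx)]
  exact ⟨by omega, rfl⟩

theorem connected_treeGraph (hB : B.numNodes = n) : (treeGraph hB).Connected := by
  have hroot : ∀ x, 2 * 0 ≤ x → x ≤ 2 * (0 + B.numNodes) →
      (treeGraph hB).Reachable (vertexAt n x) (vertexAt n (2 * n + 2)) := by
    refine position_induction ?_ fun k h1 h2 h3 => ⟨?_, ?_⟩
    · have ht := @topPos_mem B 0
      have := treeGraph_adj_hungPar hB (x := topPos B 0) (by omega)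
      rw [hungPar, parPos_topPos] at this
      exact this.reachable
    · have b1 := leftPos_mem (B := B) (a := 0) (k := k) (by omega) (by omega)
      have := treeGraph_adj_hungPar hB (x := leftPos B 0 k) (by omega)
      rw [hungPar, parPos_leftPos h1 h2] at this
      exact this.reachable.trans h3
    · have b2 := rightPos_mem (B := B) (a := 0) (k := k) (by omega) (by omega)
      have := treeGraph_adj_hungPar hB (x := rightPos B 0 k) (by omega)
      rw [hungPar, parPos_rightPos h1 h2] at this
      exact this.reachable.trans h3
  have hall : ∀ v, (treeGraph hB).Reachable v (vertexAt n (2 * n + 2)) := by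
    intro v
    rw [← vertexAt_vertexPos v]
    rcases vertexPos_isPos v with h | h
    · exact hroot _ (by omega) (by omega)
    · rw [h]
  exact { preconnected := fun u v => (hall u).trans (hall v).symm
          nonempty := ⟨Sum.inl 0⟩ }

/-- Degree count: (n + 2) + 3n is twice 2n + 1, one less than the number of vertices, and a
connected graph with that many edges is a tree. -/
theorem isTree_treeGraph (hB : B.numNodes = n) : (treeGraph hB).IsTree := by
  classical
  rw [SimpleGraph.isTree_iff_connected_and_card]
  refine ⟨connected_treeGraph hB, ?_⟩
  have h := (treeGraph hB).sum_degrees_eq_twice_card_edges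
  have hdeg : ∀ v, (treeGraph hB).degree v = ((treeGraph hB).neighborSet v).ncard := fun v => by
    rw [← SimpleGraph.card_neighborSet_eq_degree, Set.ncard_eq_toFinset_card', Set.toFinset_card]
  simp only [hdeg, Fintype.sum_sum_type, ncard_neighborSet_leaf, ncard_neighborSet_node,
    Finset.sum_const, Finset.card_univ, Fintype.card_fin, smul_eq_mul] at h
  rw [Nat.card_eq_fintype_card, ← SimpleGraph.edgeFinset_card, Nat.card_eq_fintype_card,
    Fintype.card_sum, Fintype.card_fin, Fintype.card_fin]
  omega

theorem finRotate_eq_ofNat {i : Fin (n + 2)} (hi : (i : ℕ) ≤ n) :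
    finRotate (n + 2) i = Fin.ofNat (n + 2) (i + 1) := by
  have h := finRotate_of_lt (n := n + 1) (k := i) (by omega)
  rw [h]
  exact Fin.ext (Nat.mod_eq_of_lt (by omega)).symm

theorem finRotate_eq_zero {i : Fin (n + 2)} (hi : ¬ (i : ℕ) ≤ n) : finRotate (n + 2) i = 0 := by
  have : i = Fin.last (n + 1) := Fin.ext (by rw [Fin.val_last]; omega)
  rw [this, finRotate_last]

/-- The planar cubic tree of a plane binary tree. -/
def planarCubicTree (hB : B.numNodes = n) : PlanarCubicTree (n + 2) where
  graph := treeGraph hB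
  isTree := isTree_treeGraph hB
  leaf_degree := ncard_neighborSet_leaf hB
  interior_degree := ncard_neighborSet_node hB
  rot := treeRot n B
  rot_adj κ u _ := by
    rw [← SimpleGraph.mem_neighborSet, neighborSet_node]
    unfold treeRot
    split_ifs <;> simp
  rot_cyclic κ u w hu hw := by
    have hk : (κ : ℕ) < n := by omega
    obtain ⟨κ', h0, h1, h2, h3⟩ := (isDrawing_treeRot hB).node κ (by omega) (by omega)
    rw [vertexAt_odd hk] at h0
    cases h0
    rw [← SimpleGraph.mem_neighborSet, neighborSet_node] at hu hw
    have h1' : treeRot n B κ (vertexAt n (hungPar n B (2 * κ + 1))) = _ := h1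
    have h2' : treeRot n B κ (vertexAt n (leftPos B 0 κ)) = _ := h2
    have h3' : treeRot n B κ (vertexAt n (rightPos B 0 κ)) = vertexAt n (hungPar n B (2 * κ + 1)) :=
      h3
    rcases hu with rfl | rfl | rfl <;> rcases hw with rfl | rfl | rfl
    · exact ⟨0, rfl⟩
    · exact ⟨1, h1'⟩
    · exact ⟨2, by simp only [Function.iterate_succ, Function.iterate_zero, Function.comp_apply,
        id, h1', h2']⟩
    · exact ⟨2, by simp only [Function.iterate_succ, Function.iterate_zero, Function.comp_apply,
        id, h2', h3']⟩
    · exact ⟨0, rfl⟩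
    · exact ⟨1, h2'⟩
    · exact ⟨1, h3'⟩
    · exact ⟨2, by simp only [Function.iterate_succ, Function.iterate_zero, Function.comp_apply,
        id, h3', h1']⟩
    · exact ⟨0, rfl⟩
  leaf_order i v h := by
    have hd := isDrawing_treeRot hB
    rw [← SimpleGraph.mem_neighborSet, neighborSet_leaf, Set.mem_singleton_iff] at h
    have hi : (Sum.inl i : CubicVertex (n + 2)) = vertexAt n (2 * i) :=
      (vertexAt_vertexPos (Sum.inl i)).symm
    have hlast : (Sum.inl (Fin.ofNat (n + 2) (n + 1)) : CubicVertex (n + 2)) =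
        vertexAt n (2 * n + 2) := by
      rw [show 2 * n + 2 = 2 * (n + 1) by ring, vertexAt_even]
    rw [h, hi]
    split_ifs with hin
    · rw [finRotate_eq_ofNat hin]
      rcases hin.lt_or_eq with hlt | heq
      · exact hd.firstLeaf_leaf.1 i (by omega) (by omega)
      -- From the last leaf of `B` the walk leaves through the top and ends at the leaf `n + 1`.
      · rw [heq]
        have := hd.firstLeaf_leaf.2 (Fin.ofNat (n + 2) (n + 1)) (by
          rw [← hlast]; exact .atLeaf _ _)
        rwa [hB, zero_add] at this
    -- From the leaf `n + 1` the walk enters `B` from above and reaches the leaf 0.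
    · rw [finRotate_eq_zero hin]
      have e : 2 * (i : ℕ) = 2 * n + 2 := by omega
      rw [e]
      exact hd.firstLeaf_top

end TreeGraph

/-! ### Every planar cubic tree is the tree of a plane binary tree -/

namespace PlanarCubicTree

section Rotation

variable {N : ℕ} (T : PlanarCubicTree N) {κ : Fin (N - 2)} {u w : CubicVertex N}

/-- A fixed neighbour would be the whole orbit and hence the only neighbour, against degree three.
-/
theorem rot_ne (h : T.graph.Adj (Sum.inr κ) u) : T.rot κ u ≠ u := by
  intro hu
  have hs : T.graph.neighborSet (Sum.inr κ) ⊆ {u} := by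
    intro w hw
    obtain ⟨m, rfl⟩ := T.rot_cyclic κ u w h hw
    exact Function.iterate_fixed hu m
  have := Set.ncard_le_ncard hs
  rw [T.interior_degree, Set.ncard_singleton] at this
  omega

theorem rot_rot_ne (h : T.graph.Adj (Sum.inr κ) u) : T.rot κ (T.rot κ u) ≠ u := by
  intro hu
  have hs : T.graph.neighborSet (Sum.inr κ) ⊆ {u, T.rot κ u} := by
    intro w hw
    obtain ⟨m, rfl⟩ := T.rot_cyclic κ u w h hw
    clear hw
    induction m with
    | zero => exact Or.inl rfl
    | succ m ih =>
      rw [Function.iterate_succ_apply']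
      rcases ih with ih | ih
      · rw [ih]; exact Or.inr rfl
      · rw [Set.mem_singleton_iff.1 ih]; exact Or.inl hu
  have := (Set.ncard_le_ncard hs).trans_eq (Set.ncard_pair (T.rot_ne h).symm)
  rw [T.interior_degree] at this
  omega

theorem neighborSet_eq (h : T.graph.Adj (Sum.inr κ) u) :
    T.graph.neighborSet (Sum.inr κ) = {u, T.rot κ u, T.rot κ (T.rot κ u)} := by
  have h1 := T.rot_adj κ u h
  have h2 := T.rot_adj κ _ h1
  symm
  refine Set.eq_of_subset_of_ncard_le ?_ ?_
  · rintro w (rfl | rfl | rfl)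
    exacts [h, h1, h2]
  · rw [T.interior_degree, Set.ncard_eq_three.2 ⟨_, _, _, (T.rot_ne h).symm,
      (T.rot_rot_ne h).symm, (T.rot_ne h1).symm, rfl⟩]

/-- The image is one of the three neighbours, and the last two are excluded since the rotation has
no fixed points and no 2-cycles there. -/
theorem rot_rot_rot (h : T.graph.Adj (Sum.inr κ) u) :
    T.rot κ (T.rot κ (T.rot κ u)) = u := by
  have h1 := T.rot_adj κ u h
  have h2 := T.rot_adj κ _ h1
  have h3 : T.rot κ (T.rot κ (T.rot κ u)) ∈ T.graph.neighborSet (Sum.inr κ) := T.rot_adj κ _ h2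
  rw [T.neighborSet_eq h] at h3
  rcases h3 with h3 | h3 | h3
  · exact h3
  · exact absurd h3 (T.rot_rot_ne h1)
  · exact absurd h3 (T.rot_ne h2)

end Rotation

section Extraction

variable {n : ℕ} (T : PlanarCubicTree (n + 2))

/-- Without cycles, the only neighbour of the end of a path that lies on the path is the penultimate
vertex. -/
theorem notMem_support_concat {r u v w : CubicVertex (n + 2)} {q : T.graph.Walk r u}
    (hq : q.IsPath) (huv : T.graph.Adj u v) (hv : v ∉ q.support) (hvw : T.graph.Adj v w)
    (hwu : w ≠ u) : w ∉ (q.concat huv).support := fun hw => by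
  have := T.isTree.isAcyclic.eq_penultimate_of_adj_end (hq.concat hv huv) hvw hw
  rw [SimpleGraph.Walk.penultimate_concat] at this
  exact hwu this

/-- A walk away from a vertex never returns to it. -/
theorem inl_ne_of_firstLeaf {r u v : CubicVertex (n + 2)} {i : Fin (n + 2)}
    (h : FirstLeaf T.rot u v i) (q : T.graph.Walk r u) (hq : q.IsPath) (huv : T.graph.Adj u v)
    (hv : v ∉ q.support) : Sum.inl i ≠ r := by
  induction h with
  | atLeaf u i =>
    rintro rfl
    exact hv q.start_mem_support
  | atInterior u κ i _ ih =>
    have h1 := T.rot_adj κ u huv.symm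
    exact ih (q.concat huv) (hq.concat hv huv) h1
      (T.notMem_support_concat hq huv hv h1 (T.rot_ne huv.symm))

theorem firstLeaf_inr {N : ℕ} {rot : Fin (N - 2) → CubicVertex N → CubicVertex N}
    {u : CubicVertex N} {κ : Fin (N - 2)} {i : Fin N} (h : FirstLeaf rot u (Sum.inr κ) i) :
    FirstLeaf rot (Sum.inr κ) (rot κ u) i := by
  cases h with
  | atInterior _ _ _ h => exact h

theorem firstLeaf_inl {N : ℕ} {rot : Fin (N - 2) → CubicVertex N → CubicVertex N}
    {u : CubicVertex N} {i j : Fin N} (h : FirstLeaf rot u (Sum.inl j) i) : i = j := by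
  cases h with
  | atLeaf => rfl

/-- Here `d` is fuel: a path is shorter than the number of vertices. At an interior vertex, the walk
that leaves the left branch enters the right branch at the next leaf, and the walk that leaves the
right branch exits through `u`, since the rotation has order three. Carrying the exit leaf along
lets the two recursive calls be chained. -/
theorem exists_matches_of_isPath (d : ℕ) {u v : CubicVertex (n + 2)}
    (q : T.graph.Walk (Sum.inl (Fin.last (n + 1))) u) (hq : q.IsPath)
    (hd : Fintype.card (CubicVertex (n + 2)) ≤ q.length + d)
    (huv : T.graph.Adj u v) (hv : v ∉ q.support) (i : ℕ) (hi : i ≤ n + 1)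
    (h : FirstLeaf T.rot u v (Fin.ofNat (n + 2) i)) :
    ∃ B, Matches T.rot B i u v ∧ i + B.numNodes ≤ n ∧
      FirstLeaf T.rot v u (Fin.ofNat (n + 2) (i + B.numNodes + 1)) := by
  induction d generalizing u v i with
  | zero => exact absurd hq.length_lt (by omega)
  | succ d ih =>
    -- The leaf `n + 1` starts the path, and a walk away from it never returns.
    have hin : i ≤ n := by
      have := T.inl_ne_of_firstLeaf h q hq huv hv
      by_contra hc
      refine this (congrArg Sum.inl (Fin.ext ?_))
      simp only [Fin.ofNat, Fin.val_last]
      rw [Nat.mod_eq_of_lt (by omega)]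
      omega
    rcases v with j | κ
    · have hj := firstLeaf_inl h
      refine ⟨.nil, congrArg Sum.inl hj.symm, hin, ?_⟩
      have := T.leaf_order j u huv.symm
      have hjv : (j : ℕ) = i := by
        rw [← hj]
        exact Nat.mod_eq_of_lt (by omega)
      rw [finRotate_eq_ofNat (by omega), hjv] at this
      exact this
    · have h1 := T.rot_adj κ u huv.symm
      have h2 := T.rot_adj κ _ h1
      have hq' := hq.concat hv huv
      have hlen : Fintype.card (CubicVertex (n + 2)) ≤ (q.concat huv).length + d := by
        rw [SimpleGraph.Walk.length_concat]; omega
      obtain ⟨l, hl1, hl2, hl3⟩ := ih (q.concat huv) hq' hlen h1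
        (T.notMem_support_concat hq huv hv h1 (T.rot_ne huv.symm)) i hi (firstLeaf_inr h)
      obtain ⟨r, hr1, hr2, hr3⟩ := ih (q.concat huv) hq' hlen h2
        (T.notMem_support_concat hq huv hv h2 (T.rot_rot_ne huv.symm)) (i + l.numNodes + 1)
        (by omega) (firstLeaf_inr hl3)
      have h3 := T.rot_rot_rot huv.symm
      refine ⟨.node () l r, ⟨κ, rfl, h3, hl1, hr1⟩, ?_, ?_⟩
      · simp only [BinaryTree.numNodes]; omega
      · have := firstLeaf_inr hr3
        rw [h3] at this
        have e : i + (BinaryTree.node () l r).numNodes + 1 =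
            i + l.numNodes + 1 + r.numNodes + 1 := by
          simp only [BinaryTree.numNodes]; omega
        rw [e]
        exact this

theorem exists_matches : ∃ B v, B.numNodes = n ∧
    T.graph.Adj (Sum.inl (Fin.last (n + 1))) v ∧
    Matches T.rot B 0 (Sum.inl (Fin.last (n + 1))) v := by
  obtain ⟨v, hv⟩ := Set.ncard_eq_one.1 (T.leaf_degree (Fin.last (n + 1)))
  have hadj : T.graph.Adj (Sum.inl (Fin.last (n + 1))) v := by
    rw [← SimpleGraph.mem_neighborSet, hv]; rfl
  have h := T.leaf_order _ _ hadj
  rw [finRotate_last] at h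
  obtain ⟨B, h1, h2, h3⟩ := T.exists_matches_of_isPath _ .nil .nil
    (Nat.le_add_left _ _) hadj (by simpa using hadj.ne') 0 (by omega) h
  refine ⟨B, v, ?_, hadj, h1⟩
  -- The walk that leaves the extracted tree ends at the leaf `n + 1`; comparing labels gives the
  -- number of nodes.
  have := congrArg Fin.val (firstLeaf_inl h3)
  simp only [Fin.ofNat, Fin.val_last] at this
  rw [Nat.mod_eq_of_lt (by omega)] at this
  omega

end Extraction

end PlanarCubicTree

/-! ### Classification of cubic trees by their drawings -/

namespace PlanarCubicTree

section Classification

variable {n : ℕ} {B : BinaryTree Unit}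

theorem vertexAt_root : vertexAt n (2 * n + 2) = Sum.inl (Fin.last (n + 1)) := by
  rw [show 2 * n + 2 = 2 * (n + 1) by ring, vertexAt_even]
  exact congrArg Sum.inl (Fin.ext (Nat.mod_eq_of_lt (by omega)))

variable (T : PlanarCubicTree (n + 2)) {Φ : ℕ → CubicVertex (n + 2)}

theorem eq_of_adj_inl {i : Fin (n + 2)} {v w : CubicVertex (n + 2)}
    (hv : T.graph.Adj (Sum.inl i) v) (hw : T.graph.Adj (Sum.inl i) w) : v = w := by
  obtain ⟨y, hy⟩ := Set.ncard_eq_one.1 (T.leaf_degree i)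
  rw [← SimpleGraph.mem_neighborSet, hy, Set.mem_singleton_iff] at hv hw
  rw [hv, hw]

section Drawing

variable (hB : B.numNodes = n) (hd : IsDrawing T.rot Φ B 0 (2 * n + 2))
  (hr : Φ (2 * n + 2) = Sum.inl (Fin.last (n + 1)))
  (hadj : T.graph.Adj (Φ (2 * n + 2)) (Φ (topPos B 0)))
include hB hd hadj

theorem adj_of_isDrawing {x : ℕ} (hx : x ≤ 2 * n) :
    T.graph.Adj (Φ x) (Φ (hungPar n B x)) := by
  refine position_induction (B := B) (a := 0) (S := fun x => T.graph.Adj (Φ x) (Φ (hungPar n B x)))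
    ?_ (fun k h1 h2 h3 => ?_) x (by omega) (by omega)
  · rw [hungPar, parPos_topPos]
    exact hadj.symm
  · obtain ⟨κ, g1, g2, g3, -⟩ := hd.node k h1 h2
    rw [g1] at h3
    have h4 := T.rot_adj κ _ h3
    rw [g2] at h4
    have h5 := T.rot_adj κ _ h4
    rw [g3] at h5
    rw [hungPar, hungPar, parPos_leftPos h1 h2, parPos_rightPos h1 h2, g1]
    exact ⟨h4.symm, h5.symm⟩

theorem adj_of_posAdj {x y : ℕ} (hx : IsPos n x) (hy : IsPos n y) (h : PosAdj n B x y) :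
    T.graph.Adj (Φ x) (Φ y) := by
  rcases h with ⟨h1, rfl⟩ | ⟨h1, rfl⟩
  · exact T.adj_of_isDrawing hB hd hadj (hx.resolve_right h1)
  · exact (T.adj_of_isDrawing hB hd hadj (hy.resolve_right h1)).symm

include hr

theorem exists_posAdj_of_adj {x : ℕ} (hx : IsPos n x) {w : CubicVertex (n + 2)}
    (h : T.graph.Adj (Φ x) w) : ∃ y, IsPos n y ∧ PosAdj n B x y ∧ Φ y = w := by
  rcases hx with hx | rfl
  · have hp := T.adj_of_isDrawing hB hd hadj hx
    have hpos := hungPar_isPos hB hx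
    rcases Nat.even_or_odd' x with ⟨i, rfl | rfl⟩
    · rw [hd.leaf i (by omega) (by omega)] at h hp
      exact ⟨_, hpos, (posAdj_leaf hB (by omega) hpos).2 rfl, T.eq_of_adj_inl hp h⟩
    · have hi : i < n := by omega
      obtain ⟨κ, g1, g2, g3, -⟩ := hd.node i (by omega) (by omega)
      rw [g1] at h hp
      rw [← SimpleGraph.mem_neighborSet, T.neighborSet_eq hp, g2, g3] at h
      rcases h with rfl | rfl | rfl
      · exact ⟨_, hpos, (posAdj_node hB hi hpos).2 (Or.inl rfl), rfl⟩
      · have := leftPos_isPos hB hi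
        exact ⟨_, this, (posAdj_node hB hi this).2 (Or.inr (Or.inl rfl)), rfl⟩
      · have := rightPos_isPos hB hi
        exact ⟨_, this, (posAdj_node hB hi this).2 (Or.inr (Or.inr rfl)), rfl⟩
  · rw [hr] at h
    rw [hr] at hadj
    have := topPos_isPos hB
    exact ⟨_, this, (posAdj_root hB this).2 rfl, T.eq_of_adj_inl hadj h⟩

/-- The image is closed under adjacency and the tree is connected, so the map is onto; on a finite
type it is then bijective. -/
theorem bijective_of_isDrawing :
    Function.Bijective fun u : CubicVertex (n + 2) => Φ (vertexPos u) := by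
  rw [← Finite.surjective_iff_bijective]
  have key : ∀ w, ∃ x, IsPos n x ∧ Φ x = w := by
    intro w
    have hw := T.isTree.connected.preconnected (Φ (2 * n + 2)) w
    rw [SimpleGraph.reachable_iff_reflTransGen] at hw
    induction hw with
    | refl => exact ⟨_, Or.inr rfl, rfl⟩
    | tail _ h ih =>
      obtain ⟨x, hx, rfl⟩ := ih
      obtain ⟨y, hy, -, rfl⟩ := T.exists_posAdj_of_adj hB hd hr hadj hx h
      exact ⟨y, hy, rfl⟩
  intro w
  obtain ⟨x, hx, rfl⟩ := key w
  exact ⟨vertexAt n x, congrArg Φ (vertexPos_vertexAt hx)⟩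

/-- The bijection given by `Φ` fixes the leaves and maps interior vertices to interior vertices, so
it is a renaming. -/
theorem same_of_isDrawing : Same (planarCubicTree hB) T := by
  have hbij := T.bijective_of_isDrawing hB hd hr hadj
  have hinr : ∀ κ : Fin (n + 2 - 2), ∃ κ' : Fin (n + 2 - 2),
      Φ (vertexPos (Sum.inr κ : CubicVertex (n + 2))) = Sum.inr κ' := fun κ => by
    obtain ⟨κ', h, -⟩ := hd.node κ (by omega) (by omega)
    exact ⟨κ', h⟩
  choose f hf using hinr
  have hfinj : Function.Injective f := fun κ κ' h => by
    have : (Sum.inr κ : CubicVertex (n + 2)) = Sum.inr κ' := hbij.1 (by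
      simp only [hf, h])
    exact Sum.inr_injective this
  let e : Fin (n + 2 - 2) ≃ Fin (n + 2 - 2) :=
    Equiv.ofBijective f (Finite.injective_iff_bijective.1 hfinj)
  have he : ∀ u, rename e u = Φ (vertexPos u) := by
    rintro (i | κ)
    · have hi : rename e (Sum.inl i : CubicVertex (n + 2)) = Sum.inl i := by simp [rename]
      rw [hi, vertexPos]
      by_cases hin : (i : ℕ) ≤ n
      · rw [hd.leaf i (by omega) (by omega)]
        exact congrArg Sum.inl (Fin.ext (Nat.mod_eq_of_lt i.2).symm)
      · have : 2 * (i : ℕ) = 2 * n + 2 := by omega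
        rw [this, hr]
        exact congrArg Sum.inl (Fin.ext (by rw [Fin.val_last]; omega))
    · rw [hf]
      simp [rename, e]
  have hat : ∀ {x}, IsPos n x → rename e (vertexAt n x) = Φ x := fun hx => by
    rw [he, vertexPos_vertexAt hx]
  refine ⟨e, fun u v => ?_, fun κ u hu => ?_⟩
  · rw [he, he]
    constructor
    · intro h
      obtain ⟨y, hy, h1, h2⟩ := T.exists_posAdj_of_adj hB hd hr hadj (vertexPos_isPos u) h
      rw [← vertexPos_vertexAt hy] at h2 h1
      cases hbij.1 h2
      exact h1
    · exact T.adj_of_posAdj hB hd hadj (vertexPos_isPos u) (vertexPos_isPos v)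
  · have hk : (κ : ℕ) < n := by omega
    obtain ⟨κ', g1, g2, g3, g4⟩ := hd.node κ (by omega) (by omega)
    have hκ : e κ = κ' := by
      have := hf κ
      rw [vertexPos, g1] at this
      exact (Sum.inr_injective this).symm
    rw [hκ, he]
    have hu' := (posAdj_node hB hk (vertexPos_isPos u)).1 hu
    change T.rot κ' _ = rename e (treeRot n B κ u)
    unfold treeRot
    split_ifs with h1 h2
    · rw [hat (leftPos_isPos hB hk), h1, ← g2]
    · rw [hat (rightPos_isPos hB hk), h2, ← g3]
    · rw [hat (hungPar_isPos hB (by omega)), (hu'.resolve_left h1).resolve_left h2]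
      exact g4

end Drawing

theorem exists_same : ∃ (B : BinaryTree Unit) (hB : B.numNodes = n),
    Same (planarCubicTree hB) T := by
  obtain ⟨B, v, hB, hadj, hm⟩ := T.exists_matches
  obtain ⟨Φ, hd, h1, h2⟩ := hm.exists_isDrawing (2 * n + 2) (by omega)
  refine ⟨B, hB, T.same_of_isDrawing hB hd h1 ?_⟩
  rw [h1, h2]
  exact hadj

/-- Transporting the drawing of `B` along the renaming gives a drawing inside the rotation system of
`B'`, entered through the same edge at the last leaf; `Matches.unique` compares the two. -/
theorem eq_of_same {B' : BinaryTree Unit} (hB : B.numNodes = n) (hB' : B'.numNodes = n)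
    (h : Same (planarCubicTree hB) (planarCubicTree hB')) : B = B' := by
  obtain ⟨e, h1, h2⟩ := h
  have hl : ∀ i : Fin (n + 2), rename e (Sum.inl i) = (Sum.inl i : CubicVertex (n + 2)) :=
    fun i => by simp [rename]
  have hd := isDrawing_treeRot hB
  have hd' : IsDrawing (treeRot n B') (fun x => rename e (vertexAt n x)) B 0 (2 * n + 2) :=
    { leaf := fun i g1 g2 => by rw [hd.leaf i g1 g2, hl]
      node := fun k g1 g2 => by
        obtain ⟨κ, f1, f2, f3, f4⟩ := hd.node k g1 g2
        have hk : k < n := by omega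
        have hκ : (κ : ℕ) = k :=
          congrArg Fin.val (Sum.inr_injective (f1.symm.trans (vertexAt_odd hk)))
        have hnb := neighborSet_node hB κ
        rw [hκ] at hnb
        have key : ∀ u, u ∈ ({vertexAt n (hungPar n B (2 * k + 1)), vertexAt n (leftPos B 0 k),
            vertexAt n (rightPos B 0 k)} : Set (CubicVertex (n + 2))) →
            treeRot n B' (e κ) (rename e u) = rename e (treeRot n B κ u) := fun u hu =>
          h2 κ u (by rw [← hnb] at hu; exact hu)
        refine ⟨e κ, by rw [f1]; simp [rename], ?_, ?_, ?_⟩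
        · rw [← f2]; exact key _ (Or.inl rfl)
        · rw [← f3]; exact key _ (Or.inr (Or.inl rfl))
        · rw [← f4]; exact key _ (Or.inr (Or.inr rfl)) }
  have hm := hd'.matches
  have hm' := (isDrawing_treeRot hB').matches
  have toAdj : ∀ {C : BinaryTree Unit} (hC : C.numNodes = n),
      (planarCubicTree hC).graph.Adj (Sum.inl (Fin.last (n + 1))) (vertexAt n (topPos C 0)) := by
    intro C hC
    rw [← vertexAt_root]
    change PosAdj _ _ _ _
    rw [vertexPos_vertexAt (Or.inr rfl), vertexPos_vertexAt (topPos_isPos hC)]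
    exact (posAdj_root hC (topPos_isPos hC)).2 rfl
  have ht := (h1 _ _).2 (toAdj hB)
  simp only [vertexAt_root, hl] at hm hm' ht
  rw [(planarCubicTree hB').eq_of_adj_inl ht (toAdj hB')] at hm
  exact hm.unique hm'

end Classification

end PlanarCubicTree

/-! ### The amplitude as a sum over plane binary trees -/

section PairSums

variable {K : Type*} [Field K] {n : ℕ}

/-- The pair of leaves i < j in [a, b] corresponds to the pair of nodes i ≤ j - 1 in [a, b). -/
theorem sum_lt_eq_pairSum (s : Fin (n + 2) → Fin (n + 2) → K) {a b : ℕ} (hb : b ≤ n) :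
    ∑ i ∈ Finset.univ.filter (fun i : Fin (n + 2) => a ≤ (i : ℕ) ∧ (i : ℕ) ≤ b),
      ∑ j ∈ Finset.univ.filter (fun j : Fin (n + 2) => a ≤ (j : ℕ) ∧ (j : ℕ) ≤ b) with i < j,
        s i j = pairSum (mandelstamSubst s) (Finset.Ico a b) := by
  rw [pairSum, Finset.sum_sigma']
  symm
  refine Finset.sum_bij (fun p _ => ⟨p.1.1.castSucc.castSucc, p.1.2.succ.castSucc⟩) ?_ ?_ ?_ ?_
  · rintro ⟨⟨i, j⟩, hij⟩ h
    have hij' : (i : ℕ) ≤ j := hij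
    simp only [Finset.mem_filter, Finset.mem_univ, true_and, Finset.mem_Ico, Finset.mem_sigma,
      Fin.lt_def, Fin.val_castSucc, Fin.val_succ] at h ⊢
    omega
  · rintro ⟨⟨i, j⟩, hij⟩ _ ⟨⟨i', j'⟩, hij'⟩ _ h
    simpa [Fin.ext_iff] using h
  · rintro ⟨i, j⟩ h
    simp only [Finset.mem_filter, Finset.mem_univ, true_and, Finset.mem_sigma,
      Fin.lt_def] at h
    refine ⟨⟨(⟨i, by omega⟩, ⟨j - 1, by omega⟩), ?_⟩, ?_, ?_⟩
    · simp only [Fin.mk_le_mk]; omega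
    · simp only [Finset.mem_filter, Finset.mem_univ, true_and, Finset.mem_Ico]; omega
    · refine Sigma.ext (Fin.ext rfl) (heq_of_eq (Fin.ext ?_))
      simp only [Fin.val_castSucc, Fin.val_succ]
      omega
  · intro p _
    rfl

theorem sum_sum_eq_two_mul {s : Fin (n + 2) → Fin (n + 2) → K} (hdiag : ∀ i, s i i = 0)
    (hsymm : ∀ i j, s i j = s j i) (L : Finset (Fin (n + 2))) :
    ∑ i ∈ L, ∑ j ∈ L, s i j = 2 * ∑ i ∈ L, ∑ j ∈ L with i < j, s i j := by
  have h : ∀ i j, s i j = (if i < j then s i j else 0) + if j < i then s j i else 0 := by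
    intro i j
    rcases lt_trichotomy i j with h | rfl | h
    · simp [h, h.not_gt]
    · simp [hdiag]
    · simp [h, h.not_gt, hsymm i j]
  have hs : ∑ i ∈ L, ∑ j ∈ L, s i j =
      ∑ i ∈ L, ∑ j ∈ L, (if i < j then s i j else 0) +
        ∑ i ∈ L, ∑ j ∈ L, if j < i then s j i else 0 := by
    simp only [← Finset.sum_add_distrib]
    exact Finset.sum_congr rfl fun i _ => Finset.sum_congr rfl fun j _ => h i j
  rw [hs, Finset.sum_comm (f := fun i j => if j < i then s j i else 0), two_mul]
  simp only [Finset.sum_filter]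

theorem sum_castSucc_eq_two_mul {s : Fin (n + 2) → Fin (n + 2) → K} (hdiag : ∀ i, s i i = 0)
    (hsymm : ∀ i j, s i j = s j i) :
    ∑ i : Fin (n + 1), ∑ j : Fin (n + 1), s i.castSucc j.castSucc =
      2 * ∑ p, mandelstamSubst s p := by
  have h1 : (Finset.univ.filter fun i : Fin (n + 2) => 0 ≤ (i : ℕ) ∧ (i : ℕ) ≤ n) =
      Finset.univ.map Fin.castSuccEmb := by
    ext i
    simp only [Finset.mem_filter, Finset.mem_univ, true_and, Finset.mem_map, zero_le]
    constructor
    · intro h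
      exact ⟨⟨i, by omega⟩, rfl⟩
    · rintro ⟨j, rfl⟩
      simp only [Fin.castSuccEmb_apply, Fin.val_castSucc]
      omega
  have h2 : ∑ p, mandelstamSubst s p = pairSum (mandelstamSubst s) (Finset.Ico 0 n) := by
    rw [pairSum, Finset.filter_true_of_mem]
    intro p _
    simp only [Finset.mem_Ico]
    omega
  rw [h2, ← sum_lt_eq_pairSum s le_rfl, ← sum_sum_eq_two_mul hdiag hsymm, h1]
  simp only [Finset.sum_map, Fin.castSuccEmb_apply]

/-- The sum of `s` over ordered pairs of the first n + 1 particles is twice the sum in question. By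
the row relations it is also minus the sum of the last column, which is zero. Characteristic zero
allows dividing by 2. -/
theorem IsMandelstam.sum_mandelstamSubst [CharZero K] {s : Fin (n + 2) → Fin (n + 2) → K}
    (h : IsMandelstam s) : ∑ p, mandelstamSubst s p = 0 := by
  have h1 := sum_castSucc_eq_two_mul h.diag h.symm
  have h2 : ∀ i : Fin (n + 1), ∑ j : Fin (n + 1), s i.castSucc j.castSucc =
      -s i.castSucc (Fin.last (n + 1)) := fun i => by
    have := h.sum_eq_zero i.castSucc
    rw [Fin.sum_univ_castSucc] at this
    exact eq_neg_of_add_eq_zero_left this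
  have h3 : ∑ i : Fin (n + 1), s i.castSucc (Fin.last (n + 1)) = 0 := by
    have := h.sum_eq_zero (Fin.last (n + 1))
    rw [Fin.sum_univ_castSucc, h.diag, add_zero] at this
    rw [← this]
    exact Finset.sum_congr rfl fun i _ => h.symm _ _
  rw [Finset.sum_congr rfl fun i _ => h2 i, Finset.sum_neg_distrib, h3, neg_zero] at h1
  exact (mul_eq_zero.1 h1.symm).resolve_left two_ne_zero

/-- The Mandelstam variables are parametrized by the points of the hyperplane. -/
theorem exists_isMandelstam (x : IntervalIdx n → K) (hx : ∑ p, x p = 0) :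
    ∃ s : Fin (n + 2) → Fin (n + 2) → K, IsMandelstam s ∧ mandelstamSubst s = x := by
  obtain ⟨y, hy0, hy⟩ : ∃ y : ℕ → ℕ → K, (∀ i, y i i = 0) ∧
      ∀ (i j : Fin n) (h : i ≤ j), y i (j + 1) = x ⟨(i, j), h⟩ := by
    refine ⟨fun i j => if h : i < j ∧ j ≤ n then x ⟨(⟨i, by omega⟩, ⟨j - 1, by omega⟩), by
      simp only [Fin.mk_le_mk]; omega⟩ else 0, fun i => by simp, fun i j h => ?_⟩
    have h' : (i : ℕ) ≤ j := h
    exact dif_pos ⟨by omega, by omega⟩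
  let a : Fin (n + 1) → Fin (n + 1) → K := fun i j => y (min i j) (max i j)
  -- The last row and column are forced by the other row sums. The last row sum then vanishes
  -- exactly because ∑ x = 0.
  let s : Fin (n + 2) → Fin (n + 2) → K :=
    Fin.snoc (fun i => Fin.snoc (a i) (-∑ j, a i j)) (Fin.snoc (fun i => -∑ j, a i j) 0)
  have ha : ∀ i j, a i j = a j i := fun i j => by
    simp only [a, min_comm, max_comm]
  have s1 : ∀ i j : Fin (n + 1), s i.castSucc j.castSucc = a i j := fun i j => by
    simp only [s, Fin.snoc_castSucc]
  have s2 : ∀ i : Fin (n + 1), s i.castSucc (Fin.last _) = -∑ j, a i j := fun i => by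
    simp only [s, Fin.snoc_castSucc, Fin.snoc_last]
  have s3 : ∀ i : Fin (n + 1), s (Fin.last _) i.castSucc = -∑ j, a i j := fun i => by
    simp only [s, Fin.snoc_castSucc, Fin.snoc_last]
  have s4 : s (Fin.last _) (Fin.last _) = 0 := by
    simp only [s, Fin.snoc_last]
  have hdiag : ∀ i, s i i = 0 := fun i => by
    refine Fin.lastCases s4 (fun i => ?_) i
    rw [s1]
    simp only [a, min_self, max_self, hy0]
  have hsymm : ∀ i j, s i j = s j i := fun i j => by
    refine Fin.lastCases ?_ (fun i => ?_) i <;> refine Fin.lastCases ?_ (fun j => ?_) j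
    · rfl
    · rw [s2, s3]
    · rw [s2, s3]
    · rw [s1, s1, ha]
  have hsub : mandelstamSubst s = x := by
    funext ⟨⟨i, j⟩, hij⟩
    have hij' : (i : ℕ) ≤ j := hij
    simp only [mandelstamSubst, s1, a, Fin.val_castSucc, Fin.val_succ]
    rw [min_eq_left (by omega), max_eq_right (by omega), hy i j hij]
  refine ⟨s, ⟨hdiag, hsymm, fun i => ?_⟩, hsub⟩
  rw [Fin.sum_univ_castSucc]
  refine Fin.lastCases ?_ (fun i => ?_) i
  · have := sum_castSucc_eq_two_mul hdiag hsymm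
    rw [hsub, hx, mul_zero] at this
    simp only [s1] at this
    simp only [s3, s4, Finset.sum_neg_distrib, this, neg_zero, add_zero]
  · simp only [s1, s2, add_neg_cancel]

end PairSums

/-! ### Weights of cubic trees as products over nodes -/

namespace PlanarCubicTree

section Weights

variable {n : ℕ} {B : BinaryTree Unit} (hB : B.numNodes = n)
include hB

/-- A vertex is determined by the edge to its parent. -/
theorem edge_eq_iff {k x : ℕ} (hk : k < n) (hx : x ≤ 2 * n) :
    s(vertexAt n x, vertexAt n (hungPar n B x)) =
      s((vertexAt n (2 * k + 1)), vertexAt n (hungPar n B (2 * k + 1))) ↔ x = 2 * k + 1 := by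
  have hinj : ∀ {y z}, IsPos n y → IsPos n z → vertexAt n y = vertexAt n z → y = z :=
    fun hy hz h => by rw [← vertexPos_vertexAt hy, h, vertexPos_vertexAt hz]
  constructor
  · intro h
    rw [Sym2.eq_iff] at h
    rcases h with ⟨h, -⟩ | ⟨h1, h2⟩
    · exact hinj (Or.inl hx) (Or.inl (by omega)) h
    · have e1 := hinj (Or.inl hx) (hungPar_isPos hB (by omega)) h1
      have e2 := hinj (hungPar_isPos hB hx) (Or.inl (by omega)) h2
      have n1 := parPos_not_below (B := B) (a := 0) (p := 2 * n + 2) (k := k) (x := 2 * k + 1)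
        (by omega) (by omega) (by omega) (by omega) (by omega) (Or.inr rfl)
      rw [show parPos B 0 (2 * n + 2) (2 * k + 1) = x from e1.symm] at n1
      have n2 := parPos_not_below (B := B) (a := 0) (p := 2 * n + 2) (k := k) (x := x)
        (by omega) (by omega) (by omega) (by omega) (by omega) (Or.inl n1)
      rw [show parPos B 0 (2 * n + 2) x = 2 * k + 1 from e2] at n2
      exact absurd (posBelow_self (by omega) (by omega)) n2
  · rintro rfl
    rfl

/-- Climbing from parent to parent stays outside the subtree of `k`, hence avoids the deleted edge,
and ends at the last leaf. -/
theorem reachable_of_not_posBelow {k x : ℕ} (hk : k < n) (hx : x ≤ 2 * n)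
    (h : ¬ PosBelow B 0 x k) :
    ((treeGraph hB).deleteEdges {s(vertexAt n (2 * k + 1),
      vertexAt n (hungPar n B (2 * k + 1)))}).Reachable (vertexAt n x)
        (vertexAt n (2 * n + 2)) := by
  have hadj : ∀ x, x ≤ 2 * n → ¬ PosBelow B 0 x k →
      ((treeGraph hB).deleteEdges {s(vertexAt n (2 * k + 1),
        vertexAt n (hungPar n B (2 * k + 1)))}).Adj (vertexAt n x)
          (vertexAt n (hungPar n B x)) := by
    intro x hx h
    rw [SimpleGraph.deleteEdges_adj, Set.mem_singleton_iff, edge_eq_iff hB hk hx]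
    refine ⟨treeGraph_adj_hungPar hB hx, ?_⟩
    rintro rfl
    exact h (posBelow_self (by omega) (by omega))
  have hstep : ∀ j x, x ≤ 2 * n → hungPar n B x = 2 * j + 1 →
      (¬ PosBelow B 0 (2 * j + 1) k → ((treeGraph hB).deleteEdges {s(vertexAt n (2 * k + 1),
        vertexAt n (hungPar n B (2 * k + 1)))}).Reachable (vertexAt n (2 * j + 1))
          (vertexAt n (2 * n + 2))) → ¬ PosBelow B 0 x k →
      ((treeGraph hB).deleteEdges {s(vertexAt n (2 * k + 1),
        vertexAt n (hungPar n B (2 * k + 1)))}).Reachable (vertexAt n x)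
          (vertexAt n (2 * n + 2)) := by
    intro j x hx hj ih h
    have h1 := parPos_not_below (B := B) (a := 0) (p := 2 * n + 2) (k := k) (x := x)
        (by omega) (by omega) (by omega) (by omega) (by omega) (Or.inl h)
    have h2 := hadj x hx h
    rw [hj] at h2
    rw [show parPos B 0 (2 * n + 2) x = 2 * j + 1 from hj] at h1
    exact h2.reachable.trans (ih h1)
  refine position_induction (B := B) (a := 0) (S := fun x => ¬ PosBelow B 0 x k →
    ((treeGraph hB).deleteEdges {s(vertexAt n (2 * k + 1),
      vertexAt n (hungPar n B (2 * k + 1)))}).Reachable (vertexAt n x)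
        (vertexAt n (2 * n + 2))) (fun ht => ?_) (fun j h1 h2 h3 => ⟨?_, ?_⟩) x (by omega)
        (by omega) h
  · have hm := @topPos_mem B 0
    have := hadj _ (by omega) ht
    rw [show hungPar n B (topPos B 0) = 2 * n + 2 from parPos_topPos] at this
    exact this.reachable
  · have b1 := leftPos_mem h1 h2
    exact hstep j _ (by omega) (parPos_leftPos h1 h2) h3
  · have b1 := rightPos_mem h1 h2
    exact hstep j _ (by omega) (parPos_rightPos h1 h2) h3

/-- The deleted edge is the only one between the subtree of `k` and its complement. -/
theorem posBelow_of_reachable {k : ℕ} (hk : k < n) {u v : CubicVertex (n + 2)}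
    (hu : PosBelow B 0 (vertexPos u) k)
    (h : ((treeGraph hB).deleteEdges {s(vertexAt n (2 * k + 1),
      vertexAt n (hungPar n B (2 * k + 1)))}).Reachable u v) : PosBelow B 0 (vertexPos v) k := by
  rw [SimpleGraph.reachable_iff_reflTransGen] at h
  induction h with
  | refl => exact hu
  | @tail v w _ h ih =>
    rw [SimpleGraph.deleteEdges_adj, Set.mem_singleton_iff] at h
    obtain ⟨h1 | h1, h2⟩ := h
    · rw [← h1.2]
      refine parPos_below (by omega) (by omega) ih ?_
      intro h3
      apply h2
      have hw : w = vertexAt n (hungPar n B (2 * k + 1)) := by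
        rw [← h3, h1.2, vertexAt_vertexPos]
      rw [hw, ← h3, vertexAt_vertexPos]
    · by_contra hc
      have hw := (vertexPos_isPos w).resolve_right h1.1
      refine parPos_not_below (B := B) (a := 0) (p := 2 * n + 2) (by omega) (by omega) (by omega)
        (by omega) (by omega) (Or.inl hc) ?_
      rw [show parPos B 0 (2 * n + 2) (vertexPos w) = vertexPos v from h1.2]
      exact ih

/-- A binary tree has one more leaf than nodes, so the upper end is included for leaves although it
is excluded for nodes. -/
theorem lowerLeaves_planarCubicTree {k : ℕ} (hk : k < n) :
    (planarCubicTree hB).lowerLeaves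
      s(vertexAt n (2 * k + 1), vertexAt n (hungPar n B (2 * k + 1))) =
      Finset.univ.filter fun i : Fin (n + 2) =>
        lowEnd B 0 k ≤ (i : ℕ) ∧ (i : ℕ) ≤ highEnd B 0 k := by
  have hb := ends_bounds (B := B) (a := 0) (k := k) (by omega) (by omega)
  ext i
  simp only [lowerLeaves, Finset.mem_filter, Finset.mem_univ, true_and]
  constructor
  · intro h
    by_contra hc
    have hlast := h (Fin.last (n + 1)) rfl
    by_cases hi : (i : ℕ) ≤ n
    · refine hlast ?_
      have := reachable_of_not_posBelow hB hk (x := 2 * i) (by omega)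
        (by unfold PosBelow; omega)
      rw [vertexAt_root] at this
      have e : vertexAt n (2 * i) = Sum.inl i := vertexAt_vertexPos (Sum.inl i)
      rw [e] at this
      exact this
    · have : i = Fin.last (n + 1) := Fin.ext (by rw [Fin.val_last]; omega)
      rw [this] at hlast
      exact hlast (SimpleGraph.Reachable.refl _)
  · intro h j hj hr
    have := posBelow_of_reachable hB hk (u := Sum.inl i)
      (by simp only [PosBelow, vertexPos]; omega) hr
    simp only [PosBelow, vertexPos] at this
    omega

end Weights

section Weights

variable {m : ℕ} {B : BinaryTree Unit}

/-- The interior edges join the nodes other than the root to their parents; the edge above the root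
ends in a leaf. -/
theorem weight_planarCubicTree {K : Type*} [Field K] (hB : B.numNodes = m + 1)
    (s : Fin (m + 1 + 2) → Fin (m + 1 + 2) → K) :
    weight s (planarCubicTree hB) = ∏ k ∈ Finset.univ.erase (rootFin m B),
      1 / pairSum (mandelstamSubst s) (Finset.Ico (lowEnd B 0 k) (highEnd B 0 k)) := by
  have hroot : ∀ k : Fin (m + 1), k ≠ rootFin m B ↔ 2 * (k : ℕ) + 1 ≠ topPos B 0 := fun k => by
    rw [Ne, Ne, topPos_eq_iff (by omega) (by omega), Fin.ext_iff, rootFin_val hB]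
  symm
  refine Finset.prod_bij (fun k _ => s(vertexAt (m + 1) (2 * k + 1),
    vertexAt (m + 1) (hungPar (m + 1) B (2 * k + 1)))) ?_ ?_ ?_ ?_
  · intro k hk
    rw [Finset.mem_erase, hroot] at hk
    simp only [interiorEdges, Finset.mem_filter, Finset.mem_univ, true_and, SimpleGraph.mem_edgeSet]
    refine ⟨treeGraph_adj_hungPar hB (by omega), fun i hi => ?_⟩
    rcases hungPar_cases hB (x := 2 * k + 1) (by omega) with ⟨h, -⟩ | ⟨k', h1, h2, -⟩
    · exact hk.1 h
    · rw [h2, vertexAt_odd h1, vertexAt_odd k.2] at hi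
      simp at hi
  · intro k _ k' _ h
    have := (edge_eq_iff hB k'.2 (x := 2 * k + 1) (by omega)).1 h
    exact Fin.ext (by omega)
  · intro e he
    simp only [interiorEdges, Finset.mem_filter, Finset.mem_univ, true_and] at he
    have key : ∀ u v : CubicVertex (m + 1 + 2), (∀ i, Sum.inl i ≠ u) → (∀ i, Sum.inl i ≠ v) →
        vertexPos u ≠ 2 * (m + 1) + 2 → hungPar (m + 1) B (vertexPos u) = vertexPos v →
        ∃ (k : Fin (m + 1)) (_ : k ∈ Finset.univ.erase (rootFin m B)),
          s(vertexAt (m + 1) (2 * k + 1), vertexAt (m + 1) (hungPar (m + 1) B (2 * k + 1))) =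
            s(u, v) := by
      intro u v hu hv h1 h2
      rcases u with i | k
      · exact absurd rfl (hu i)
      · have e1 : hungPar (m + 1) B (2 * k + 1) = vertexPos v := h2
        refine ⟨k, ?_, ?_⟩
        · rw [Finset.mem_erase, hroot]
          refine ⟨fun h3 => ?_, Finset.mem_univ _⟩
          rw [h3, show hungPar (m + 1) B (topPos B 0) = 2 * (m + 1) + 2 from parPos_topPos] at e1
          rcases v with j | k'
          · exact hv j rfl
          · simp only [vertexPos] at e1
            omega
        · rw [e1, vertexAt_vertexPos, vertexAt_odd (n := m + 1) k.2]
    induction e using Sym2.ind with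
    | _ u v =>
      simp only [SimpleGraph.mem_edgeSet, Sym2.mem_iff, not_or] at he
      obtain ⟨h | h, h'⟩ := he
      · exact key u v (fun i => (h' i).1) (fun i => (h' i).2) h.1 h.2
      · rw [Sym2.eq_swap]
        exact key v u (fun i => (h' i).2) (fun i => (h' i).1) h.1 h.2
  · intro k _
    have hb := ends_bounds (B := B) (a := 0) (k := k) (by omega) (by omega)
    rw [edgeX, lowerLeaves_planarCubicTree hB k.2, sum_lt_eq_pairSum (n := m + 1) s (by omega)]

end Weights

end PlanarCubicTree

theorem phi3Amplitude_eq_binaryTreeSum {K : Type*} [Field K] {m : ℕ}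
    (s : Fin (m + 1 + 2) → Fin (m + 1 + 2) → K) :
    phi3Amplitude s = binaryTreeSum (m + 1) (mandelstamSubst s) := by
  symm
  refine Finset.sum_bij (fun B hB => (⟦planarCubicTree
    (BinaryTree.mem_treesOfNumNodesEq.1 hB)⟧ : PC (m + 1 + 2))) ?_ ?_ ?_ ?_
  · intro B _
    exact Finset.mem_univ _
  · intro B _ B' _ h
    exact PlanarCubicTree.eq_of_same _ _ (Quotient.exact h)
  · intro T _
    induction T using Quotient.inductionOn with
    | _ T =>
      obtain ⟨B, hB, h⟩ := T.exists_same
      exact ⟨B, BinaryTree.mem_treesOfNumNodesEq.2 hB, Quotient.sound h⟩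
  · intro B hB
    have hB' := BinaryTree.mem_treesOfNumNodesEq.1 hB
    rw [prod_pairSum_eq hB', ← PlanarCubicTree.weight_planarCubicTree hB']
    rfl

end

theorem mainTheorem10 (n : ℕ) (hn : 1 ≤ n) :
    -- the boundary of the dual cone has a triangulation
    (∃ T, IsBoundaryTriangulation (lodaySimplex n) T) ∧
    -- with any triangulation:
    ∀ T, IsBoundaryTriangulation (lodaySimplex n) T →
      -- the hyperplane dual mixed volume restricts to a rational function on `⟨x, 1⟩ = 0`,
      (∃ x : IntervalIdx n → ℝ, ∑ p, x p = 0 ∧ RegularAt (lodaySimplex n) T x 0) ∧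
      -- which is the sum over plane binary trees,
      (∀ (K : Type*) [Field K] [Algebra ℝ K] (x : IntervalIdx n → K),
        ∑ p, x p = 0 → RegularAt (lodaySimplex n) T x 0 →
          hyperplaneDualMixedVolume (lodaySimplex n) T x 0
            = (-1) ^ (n - 1) * binaryTreeSum n x) ∧
      -- the substitution `x_{ij} = s_{i,j+1}` is defined and takes values in `⟨x, 1⟩ = 0`,
      (∃ s : Fin (n + 2) → Fin (n + 2) → ℝ,
        IsMandelstam s ∧ RegularAt (lodaySimplex n) T (mandelstamSubst s) 0) ∧
      -- and turns the hyperplane dual mixed volume into the planar amplitude, up to sign.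
      (∀ (K : Type*) [Field K] [Algebra ℝ K] (s : Fin (n + 2) → Fin (n + 2) → K),
        IsMandelstam s → RegularAt (lodaySimplex n) T (mandelstamSubst s) 0 →
          ∑ p, mandelstamSubst s p = 0 ∧
          hyperplaneDualMixedVolume (lodaySimplex n) T (mandelstamSubst s) 0
            = (-1) ^ (n - 1) * phi3Amplitude s) := by
  obtain ⟨m, rfl⟩ : ∃ m, n = m + 1 := ⟨n - 1, by omega⟩
  refine ⟨exists_isBoundaryTriangulation m, fun T hT => ?_⟩
  obtain ⟨x, hx, hreg⟩ : ∃ x : IntervalIdx (m + 1) → ℝ,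
      ∑ p, x p = 0 ∧ RegularAt (lodaySimplex (m + 1)) T x 0 := by
    -- The value is -1 off the full interval, and the sum condition fixes the remaining coordinate.
    let x : IntervalIdx (m + 1) → ℝ := fun p =>
      -1 + if p = fullIdx m then (Fintype.card (IntervalIdx (m + 1)) : ℝ) else 0
    have hx : ∑ p, x p = 0 := by
      simp only [x, Finset.sum_add_distrib, Finset.sum_const, Finset.card_univ, nsmul_eq_mul,
        Finset.sum_ite_eq', Finset.mem_univ, if_true]
      ring
    refine ⟨x, hx, regularAt_of_neg hT hx fun p hp => ?_⟩
    simp only [x, if_neg hp]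
    norm_num
  refine ⟨⟨x, hx, hreg⟩, fun K _ _ y hy hy' =>
    hyperplaneDualMixedVolume_eq_binaryTreeSum hT hy hy', ?_, fun K _ _ s hs hs' => ?_⟩
  · obtain ⟨s, hs, rfl⟩ := exists_isMandelstam x hx
    exact ⟨s, hs, hreg⟩
  · have : CharZero K := charZero_of_injective_algebraMap (algebraMap ℝ K).injective
    have h0 := hs.sum_mandelstamSubst
    refine ⟨h0, ?_⟩
    rw [phi3Amplitude_eq_binaryTreeSum]
    exact hyperplaneDualMixedVolume_eq_binaryTreeSum hT h0 hs'
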